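/- **Setting.** An instance of utility configuration consists of $n$ actions; each action $i$ has a finite nonempty list of configurations, and configuration $j$ of action $i$ is a finitely supported distribution $F_{ij}$ of pairs $(u_i^A,u_i^P)$ (agent and principal utility), given as a list of point masses with positive rational probabilities of total $1$, where $u_i^A\in\mathbb Q\cup\{-\infty\}$ and $u_i^P\in\mathbb Q_{\ge 0}$. A configuration $\mathbf C=(C_1,\dots,C_n)$ chooses one configuration per action; then $(u_i^A,u_i^P)\sim F_{iC_i}$ are drawn independently, and the agent picks an action $i^*$ maximizing $u_i^A$, ties being broken in favour of the principal. Write $u^A=u^A_{i^*}$, $u^P=u^P_{i^*}$. The principal maximizes $\mathrm{val}(\mathbf C)=\mathbb E[u^P]$. For $f:(0,1]\to\mathbb R$, the instance is *$f(q)$-utility aligned* if, for some optimal configuration, $\mathbb E[u^P\mid u^A\le U]\le f(q)\,\mathbb E[u^P]$ for every threshold $U$ with $q=\Pr[u^A\le U]>0$. **The algorithm with parameter $M\ge 1$.** (1) *Preprocessing.* List all point masses $(u^A,u^P,p)$ of all $F_{ij}$, sorted in non-decreasing order of $u^P$. Split each of them, in this order, into $\lfloor pM^2\rfloor$ pieces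 of probability $1/M^2$ and one piece with the remaining probability, and replace the agent utility of the $\ell$-th piece overall by $u^A+\delta\ell$, where $\delta>0$ is infinitesimal (that is, perturbed agent utilities are the pairs $(u^A,\ell)$ in lexicographic order). (2) *Guesses.* For each profile $\hat u_1\le\dots\le\hat u_M$ of perturbed agent utilities of pieces, put $\hat u_0=-\infty$, $B_j=[\hat u_{j-1},\hat u_j)$ for $j<M$, $B_M=[\hat u_{M-1},\hat u_M]$ and $B_{\le j}=\bigcup_{k\le j}B_k$. For a configuration $\mathbf C$, let $q_{ij}=\Pr[u_i^A\in B_j\mid u_i^A\in B_{\le j}]$, let $\bar q_{ij}$ be $q_{ij}$ rounded down to a multiple of $1/(M^2n)$, and let $$\overline{\mathrm{Util}}(\mathbf C)=\sum_{j=6}^M\frac{j-5}{M-1}\sum_{i=1}^n\mathbb E[u_i^P\mid u_i^A\in B_j]\,\Pr[u_i^A\in B_j\mid u_i^A\in B_{\le j}].$$ Find a configuration that maximizes $\overline{\mathrm{Util}}$ among those for which every $\Pr[u_i^A\in B_{\le j}]$ is positive and $$\frac{1-1/M}{j}-\frac1{M^2}\le\sum_{i=1}^n\bar q_{ij}\le\frac{1+1/M}{j-1}\qquad(1\le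 j\le M),$$ where there is no upper bound for $j=1$; if there is no such configuration, discard the profile. (3) Return, among the configurations found, one with the largest value $\mathrm{val}$ (an arbitrary configuration if none was found). **Theorem.** (a) For every real $c>0$ there is $K>0$ such that, for every $M\ge1$ and every instance that is $\frac1{c\sqrt q}$-utility aligned, every output $\mathbf C$ of the algorithm with parameter $M$ satisfies $\mathrm{val}(\mathbf C)\ge(1-K/\sqrt M)\,\mathrm{val}(\mathbf C')$ for all configurations $\mathbf C'$. That is, the algorithm is a $(1-O(1/\sqrt M))$-approximation. (b) The algorithm can be implemented by one program, with input $M$ and an instance, whose running time (counting bit operations) is polynomial in the bit size of the instance for each fixed $M$. (c) Consequently there is a polynomial-time approximation scheme (one program with input a rational $\varepsilon>0$ and an instance, which computes a $(1-\varepsilon)$-approximate solution in time polynomial in the bit size of the instance for each fixed $\varepsilon$) for each of the following problems. All distributions are finitely supported with rational data, and ties are broken in favour of the principal or seller. - *Delegated choice with independent random biases*: there are $n\ge1$ actions with independent random values $v_i\ge0$ and biases $b_i$; the principal offers a nonempty set $S$ of actions, the agent picks $i\in S$ maximizing $v_i+b_i$, and the principal wants to maximize the expectation of $v_i$. - *Delegated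 choice with random biases and an outside option*: as before, but $S$ may be empty, and the principal gets $0$ if no $i\in S$ has $v_i+b_i\ge b_0$, where $b_0$ is an independent random variable. - *Assortment optimization with independent utilities*: there are items with fixed prices $p_i\ge0$ and independent random values $v_i$, and an independent random outside utility $u_0$; the seller offers a set $S$, the buyer picks $i\in S$ maximizing $v_i-p_i$ if this is at least $u_0$ and nothing otherwise, and the seller wants to maximize the expected revenue $p_i$. -/

import Mathlib

open Finset

/-! ### Programs with a step count

A small first-order language over finite data.  Data are built from booleans, natural numbers and
rational numbers by products, options and lists.  There are no function values, the only loop is a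
left fold over a list, and each primitive operation is charged the square of the number of bits it
reads and writes, which dominates schoolbook arithmetic on binary numbers. -/

/-- Types of data. -/
inductive Ty : Type
  | bool : Ty
  | nat : Ty
  | rat : Ty
  | prod : Ty → Ty → Ty
  | opt : Ty → Ty
  | list : Ty → Ty

/-- The values of a type of data. -/
@[reducible] def Ty.Val : Ty → Type
  | .bool => Bool
  | .nat => ℕ
  | .rat => ℚ
  | .prod σ τ => σ.Val × τ.Val
  | .opt τ => Option τ.Val
  | .list τ => List τ.Val

/-- The bit size of a value (numbers are written in binary). -/
def Ty.size : (τ : Ty) → τ.Val → ℕ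
  | .bool, _ => 1
  | .nat, k => Nat.size k + 1
  | .rat, q => Nat.size q.num.natAbs + Nat.size q.den + 1
  | .prod σ τ, x => σ.size x.1 + τ.size x.2 + 1
  | .opt τ, o => match o with
    | none => 1
    | some x => τ.size x + 1
  | .list τ, l => (l.map fun x => τ.size x + 1).sum + 1

/-- Primitive operations. -/
inductive Prim : Ty → Ty → Type
  | id {σ : Ty} : Prim σ σ
  | fst {σ τ : Ty} : Prim (.prod σ τ) σ
  | snd {σ τ : Ty} : Prim (.prod σ τ) τ
  | boolLit {σ : Ty} (b : Bool) : Prim σ .bool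
  | natLit {σ : Ty} (k : ℕ) : Prim σ .nat
  | none {σ τ : Ty} : Prim σ (.opt τ)
  | some {τ : Ty} : Prim τ (.opt τ)
  | nil {σ τ : Ty} : Prim σ (.list τ)
  | cons {τ : Ty} : Prim (.prod τ (.list τ)) (.list τ)
  | uncons {τ : Ty} : Prim (.list τ) (.opt (.prod τ (.list τ)))
  | range : Prim .nat (.list .nat)
  | natAdd : Prim (.prod .nat .nat) .nat
  | natMul : Prim (.prod .nat .nat) .nat
  | natLe : Prim (.prod .nat .nat) .bool
  | natToRat : Prim .nat .rat
  | ratAdd : Prim (.prod .rat .rat) .rat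
  | ratSub : Prim (.prod .rat .rat) .rat
  | ratMul : Prim (.prod .rat .rat) .rat
  | ratDiv : Prim (.prod .rat .rat) .rat
  | ratLe : Prim (.prod .rat .rat) .bool
  | ratFloor : Prim .rat .nat

/-- The meaning of the primitive operations. -/
def Prim.eval : {σ τ : Ty} → Prim σ τ → σ.Val → τ.Val
  | _, _, .id, x => x
  | _, _, .fst, x => x.1
  | _, _, .snd, x => x.2
  | _, _, .boolLit b, _ => b
  | _, _, .natLit k, _ => k
  | _, _, .none, _ => Option.none
  | _, _, .some, x => Option.some x
  | _, _, .nil, _ => []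
  | _, _, .cons, x => x.1 :: x.2
  | _, _, .uncons, l => match l with
    | [] => Option.none
    | a :: t => Option.some (a, t)
  | _, _, .range, k => List.range k
  | _, _, .natAdd, x => Nat.add x.1 x.2
  | _, _, .natMul, x => Nat.mul x.1 x.2
  | _, _, .natLe, x => Nat.ble x.1 x.2
  | _, _, .natToRat, k => (Nat.cast k : ℚ)
  | _, _, .ratAdd, x => ((x.1 : ℚ) + (x.2 : ℚ) : ℚ)
  | _, _, .ratSub, x => ((x.1 : ℚ) - (x.2 : ℚ) : ℚ)
  | _, _, .ratMul, x => ((x.1 : ℚ) * (x.2 : ℚ) : ℚ)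
  | _, _, .ratDiv, x => ((x.1 : ℚ) / (x.2 : ℚ) : ℚ)
  | _, _, .ratLe, x => decide ((x.1 : ℚ) ≤ (x.2 : ℚ))
  | _, _, .ratFloor, q => ⌊(q : ℚ)⌋₊

/-- Programs. -/
inductive Prog : Ty → Ty → Type
  | prim {σ τ : Ty} (p : Prim σ τ) : Prog σ τ
  | comp {ρ σ τ : Ty} (g : Prog σ τ) (f : Prog ρ σ) : Prog ρ τ
  | pair {ρ σ τ : Ty} (f : Prog ρ σ) (g : Prog ρ τ) : Prog ρ (.prod σ τ)
  | ite {σ τ : Ty} (c : Prog σ .bool) (f g : Prog σ τ) : Prog σ τ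
  /-- Case distinction on an option, in a context of type `σ`. -/
  | optElim {σ ρ τ : Ty} (f : Prog σ τ) (g : Prog (.prod σ ρ) τ) : Prog (.prod σ (.opt ρ)) τ
  /-- Left fold over a list, in a context of type `σ`, with a state of type `ρ`. -/
  | fold {σ ρ τ : Ty} (step : Prog (.prod σ (.prod ρ τ)) ρ) :
      Prog (.prod σ (.prod ρ (.list τ))) ρ

/-- The result of running a program on an input. -/
def Prog.eval : {σ τ : Ty} → Prog σ τ → σ.Val → τ.Val
  | _, _, .prim p, x => p.eval x
  | _, _, .comp g f, x => g.eval (f.eval x)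
  | _, _, .pair f g, x => (f.eval x, g.eval x)
  | _, _, .ite c f g, x => match c.eval x with
    | true => f.eval x
    | false => g.eval x
  | _, _, .optElim f g, x => match x.2 with
    | none => f.eval x.1
    | some y => g.eval (x.1, y)
  | _, _, .fold step, x => x.2.2.foldl (fun r y => step.eval (x.1, r, y)) x.2.1

/-- The running time (number of bit operations) of a program on an input. -/
def Prog.time : {σ τ : Ty} → Prog σ τ → σ.Val → ℕ
  | σ, τ, .prim p, x => (1 + σ.size x + τ.size (p.eval x)) ^ 2
  | _, _, .comp g f, x => f.time x + g.time (f.eval x)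
  | _, _, .pair f g, x => f.time x + g.time x + 1
  | _, _, .ite c f g, x => c.time x + (match c.eval x with
    | true => f.time x
    | false => g.time x)
  | .prod σ (.opt ρ), _, .optElim f g, x => 1 + (Ty.prod σ (.opt ρ)).size x + (match x.2 with
    | none => f.time x.1
    | some y => g.time (x.1, y))
  | .prod σ (.prod ρ (.list τ)), _, .fold step, x =>
    1 + (Ty.prod σ (.prod ρ (.list τ))).size x + (x.2.2.foldl
      (fun s y => (step.eval (x.1, s.1, y), s.2 + step.time (x.1, s.1, y))) (x.2.1, 0)).2

/-- A maximization problem with instances of type `σ` and solutions of type `τ`. -/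
structure MaxProblem (σ τ : Ty) where
  IsInstance : σ.Val → Prop
  IsSolution : σ.Val → τ.Val → Prop
  value : σ.Val → τ.Val → ℚ

/-- A polynomial-time approximation scheme: one program that, given a rational `ε > 0` and an
instance, finds a `(1 - ε)`-approximate solution, in time polynomial in the size of the instance
for each fixed `ε`. -/
def HasPTAS {σ τ : Ty} (P : MaxProblem σ τ) : Prop :=
  ∃ A : Prog (.prod .rat σ) τ, ∀ ε : ℚ, 0 < ε →
    (∃ p : Polynomial ℕ, ∀ x : σ.Val, P.IsInstance x → A.time (ε, x) ≤ p.eval (σ.size x)) ∧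
    ∀ x : σ.Val, P.IsInstance x →
      P.IsSolution x (A.eval (ε, x)) ∧
      ∀ y : τ.Val, P.IsSolution x y → (1 - ε) * P.value x y ≤ P.value x (A.eval (ε, x))

/-! ### Finite distributions and favourite choices -/

/-- Lists of mass points `(x, p)` that describe a probability distribution. -/
def IsDist {α : Type} (D : List (α × ℚ)) : Prop :=
  (∀ x ∈ D, 0 < x.2) ∧ (D.map Prod.snd).sum = 1

/-- The expectation of `f` under one finite distribution. -/
def mean {α : Type} (D : List (α × ℚ)) (f : α → ℚ) : ℚ :=
  (D.map fun x => x.2 * f x.1).sum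

/-- The expectation of `f` under independent draws from the distributions `D i`. -/
def expect {n : ℕ} {α : Type} (D : Fin n → List (α × ℚ)) (f : (Fin n → α) → ℚ) : ℚ :=
  ∑ ω : (i : Fin n) → Fin (D i).length,
    (∏ i, ((D i).get (ω i)).2) * f fun i => ((D i).get (ω i)).1

/-- The payoff `u i` of the principal when the agent picks from `S` an action `i` of largest
agent utility `a i`, ties being broken in favour of the principal; it is `0` if `S` is empty. -/
def favouritePayoff {ι β : Type} [LinearOrder β] (S : Finset ι) (a : ι → β) (u : ι → ℚ) : ℚ :=
  ((S.filter fun i => ∀ k ∈ S, a k ≤ a i).image u).max.unbotD 0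

/-! ### Utility configuration -/

/-- Instances of utility configuration: a list of actions, each a list of configurations, each a
list of mass points `((agent utility, principal utility), probability)`.  The agent utility `none`
stands for `-∞`. -/
@[reducible] def ucTy : Ty :=
  .list (.list (.list (.prod (.prod (.opt .rat) .rat) .rat)))

abbrev UCInstance : Type := ucTy.Val

/-- Agent utilities, in `ℚ ∪ {-∞}`. -/
def agentUtil : Option ℚ → WithBot ℚ
  | none => ⊥
  | some q => (q : WithBot ℚ)

structure UCInstance.Valid (I : UCInstance) : Prop where
  has_config : ∀ A ∈ I, A ≠ []
  dist : ∀ A ∈ I, ∀ D ∈ A, IsDist D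
  principal_nonneg : ∀ A ∈ I, ∀ D ∈ A, ∀ x ∈ D, 0 ≤ x.1.2

/-- A choice of one configuration for each action. -/
abbrev UCInstance.Config (I : UCInstance) : Type :=
  (i : Fin I.length) → Fin (I.get i).length

/-- The joint distribution of the two utilities of action `i` under `C`. -/
def UCInstance.law (I : UCInstance) (C : I.Config) (i : Fin I.length) :
    List ((Option ℚ × ℚ) × ℚ) :=
  (I.get i).get (C i)

/-- The utility `u^A` of the agent from the favourite action. -/
def bestAgent {n : ℕ} (x : Fin n → Option ℚ × ℚ) : WithBot ℚ :=
  Finset.univ.sup fun i => agentUtil (x i).1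

/-- The utility `u^P` of the principal from the agent's favourite action. -/
def principalPayoff {n : ℕ} (x : Fin n → Option ℚ × ℚ) : ℚ :=
  favouritePayoff Finset.univ (fun i => agentUtil (x i).1) fun i => (x i).2

/-- The expected utility of the principal. -/
def UCInstance.value (I : UCInstance) (C : I.Config) : ℚ :=
  expect (I.law C) principalPayoff

/-- `Pr[u^A ≤ U]`. -/
def UCInstance.probLe (I : UCInstance) (C : I.Config) (U : WithBot ℚ) : ℚ :=
  expect (I.law C) fun x => if bestAgent x ≤ U then 1 else 0

/-- `E[u^P | u^A ≤ U]`, meaningful if `Pr[u^A ≤ U] > 0`. -/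
def UCInstance.condValue (I : UCInstance) (C : I.Config) (U : WithBot ℚ) : ℚ :=
  expect (I.law C) (fun x => if bestAgent x ≤ U then principalPayoff x else 0) / I.probLe C U

/-- `f(q)`-utility alignment: at an optimal configuration, `E[u^P | u^A ≤ U] ≤ f(q) E[u^P]` for all
thresholds `U` with `q = Pr[u^A ≤ U] > 0`. -/
def UCInstance.UtilityAligned (f : ℝ → ℝ) (I : UCInstance) : Prop :=
  ∃ C : I.Config, (∀ C' : I.Config, I.value C' ≤ I.value C) ∧
    ∀ U : WithBot ℚ, 0 < I.probLe C U →
      (I.condValue C U : ℝ) ≤ f (I.probLe C U : ℝ) * (I.value C : ℝ)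

/-! ### The algorithm: preprocessing -/

/-- A point mass of configuration `config` of action `action`. -/
structure Mass where
  action : ℕ
  config : ℕ
  agent : WithBot ℚ
  principal : ℚ
  prob : ℚ

/-- All point masses of an instance. -/
def UCInstance.masses (I : UCInstance) : List Mass :=
  I.zipIdx.flatMap fun A => A.1.zipIdx.flatMap fun D =>
    D.1.map fun x => ⟨A.2, D.2, agentUtil x.1.1, x.1.2, x.2⟩

/-- Split a point mass into pieces of probability `1 / M ^ 2` and a remainder. -/
def Mass.split (M : ℕ) (x : Mass) : List Mass :=
  List.replicate ⌊x.prob * (M : ℚ) ^ 2⌋₊ { x with prob := 1 / (M : ℚ) ^ 2 } ++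
    [{ x with prob := x.prob - (⌊x.prob * (M : ℚ) ^ 2⌋₊ : ℚ) / (M : ℚ) ^ 2 }]

/-- Perturbed agent utilities: `(u, l)`, in lexicographic order, stands for `u + δ l` with an
infinitesimal `δ > 0`. -/
abbrev PUtil : Type := WithBot ℚ ×ₗ ℕ

/-- A point mass after preprocessing, with its perturbed agent utility. -/
structure Piece where
  action : ℕ
  config : ℕ
  agent : PUtil
  principal : ℚ
  prob : ℚ

/-- Split all masses of the sorted list `L`, and perturb the agent utility of the `l`-th piece
by `δ l`. -/
def pieces (M : ℕ) (L : List Mass) : List Piece :=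
  (L.flatMap (Mass.split M)).zipIdx.map fun x =>
    ⟨x.1.action, x.1.config, toLex (x.1.agent, x.2), x.1.principal, x.1.prob⟩

/-! ### The algorithm: bins, estimates, and the inner optimization

A guess of the bin boundaries is `g : Fin M → PUtil`; the indices are shifted by one, so `g j` is
the boundary number `j + 1`, and the boundary number `0` is `-∞`. -/

/-- `u` lies in the bin number `j + 1`. The bins contain their left ends, and only the last bin
contains its right end. -/
abbrev InBin {M : ℕ} (g : Fin M → PUtil) (j : Fin M) (u : PUtil) : Prop :=
  (∀ k : Fin M, (k : ℕ) + 1 = j → g k ≤ u) ∧ (u < g j ∨ ((j : ℕ) + 1 = M ∧ u = g j))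

/-- `u` lies in one of the first `j + 1` bins. -/
abbrev InBinLe {M : ℕ} (g : Fin M → PUtil) (j : Fin M) (u : PUtil) : Prop :=
  ∃ k : Fin M, k ≤ j ∧ InBin g k u

section Estimates

variable (I : UCInstance) (T : List Piece) {M : ℕ} (g : Fin M → PUtil) (C : I.Config)

/-- The preprocessed distribution of action `i` under `C`. -/
def newLaw (i : Fin I.length) : List Piece :=
  T.filter fun x => x.action = i ∧ x.config = C i

/-- `Pr[u_i^A ∈ B_{≤ j}]`. -/
def cumProb (j : Fin M) (i : Fin I.length) : ℚ :=
  ((newLaw I T C i).map fun x => if InBinLe g j x.agent then x.prob else 0).sum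

/-- `Pr[u_i^A ∈ B_j | u_i^A ∈ B_{≤ j}]`. -/
def condBinProb (j : Fin M) (i : Fin I.length) : ℚ :=
  ((newLaw I T C i).map fun x => if InBin g j x.agent then x.prob else 0).sum /
    cumProb I T g C j i

/-- `E[u_i^P | u_i^A ∈ B_j] * Pr[u_i^A ∈ B_j | u_i^A ∈ B_{≤ j}]`. -/
def condBinUtil (j : Fin M) (i : Fin I.length) : ℚ :=
  ((newLaw I T C i).map fun x => if InBin g j x.agent then x.principal * x.prob else 0).sum /
    cumProb I T g C j i

/-- The additive estimate of the bin probabilities, with each summand rounded down to a multiple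
of `1 / (M ^ 2 * n)`. -/
def roundedEst (j : Fin M) : ℚ :=
  ∑ i, (⌊condBinProb I T g C j i * ((M : ℚ) ^ 2 * I.length)⌋ : ℚ) / ((M : ℚ) ^ 2 * I.length)

/-- The approximate objective: the sum over the bins number `J = 6, …, M` of `(J - 5) / (M - 1)`
times the additive estimate of the principal's utility from that bin. -/
def utilEst : ℚ :=
  ∑ j : Fin M, if 6 ≤ (j : ℕ) + 1 then
    (((j : ℕ) + 1 : ℚ) - 5) / ((M : ℚ) - 1) * ∑ i, condBinUtil I T g C j i else 0

/-- The constraints of the inner optimization: the conditional probabilities are defined, and for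
the bin number `J` the estimate is between `(1 - 1/M)/J - 1/M^2` and `(1 + 1/M)/(J - 1)`
(no upper bound for `J = 1`). -/
structure Feasible : Prop where
  cond_defined : ∀ (j : Fin M) (i : Fin I.length), 0 < cumProb I T g C j i
  lower : ∀ j : Fin M,
    (1 - 1 / (M : ℚ)) / ((j : ℕ) + 1 : ℚ) - 1 / (M : ℚ) ^ 2 ≤ roundedEst I T g C j
  upper : ∀ j : Fin M, 0 < (j : ℕ) →
    roundedEst I T g C j ≤ (1 + 1 / (M : ℚ)) / ((j : ℕ) : ℚ)

end Estimates

/-- The guesses that the outer loop runs through. -/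
def IsGuess (T : List Piece) {M : ℕ} (g : Fin M → PUtil) : Prop :=
  Monotone g ∧ ∀ j, ∃ x ∈ T, x.agent = g j

/-- `s` is the result of the inner optimization for the guess `g`: an optimal solution, or `none`
if there is no feasible one. -/
def IsInnerSolution (I : UCInstance) (T : List Piece) {M : ℕ} (g : Fin M → PUtil) :
    Option I.Config → Prop
  | none => ∀ C : I.Config, ¬ Feasible I T g C
  | some C => Feasible I T g C ∧
      ∀ C' : I.Config, Feasible I T g C' → utilEst I T g C' ≤ utilEst I T g C

/-- `C` is a possible output of the algorithm with fineness parameter `M` on the instance `I`: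
sort the masses by principal utility (ties in any order), preprocess, solve the inner optimization
for each guess, and return the best of the configurations found, measured by the true expected
utility of the principal (any configuration, if none is found). -/
def IsAlgOutput (M : ℕ) (I : UCInstance) (C : I.Config) : Prop :=
  ∃ L : List Mass, L.Perm I.masses ∧ L.Pairwise (fun x y => x.principal ≤ y.principal) ∧
    ∃ sol : (Fin M → PUtil) → Option I.Config,
      (∀ g, IsGuess (pieces M L) g → IsInnerSolution I (pieces M L) g (sol g)) ∧
      (∀ g, IsGuess (pieces M L) g → ∀ C', sol g = some C' → I.value C' ≤ I.value C) ∧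
      ((∃ g, IsGuess (pieces M L) g ∧ sol g = some C) ∨
        ∀ g, IsGuess (pieces M L) g → sol g = none)

/-! ### The weakly aligned applications

A solution is a list of `n` booleans, the indicator of the offered subset. -/

/-- Finitely supported distributions of rational numbers. -/
@[reducible] def distTy : Ty := .list (.prod .rat .rat)

def offered (n : ℕ) (s : List Bool) : Finset (Fin n) :=
  Finset.univ.filter fun i => s[(i : ℕ)]? = some true

/-- Independent draws of a value and a bias for each action. -/
def valueBiasLaw (I : List (List (ℚ × ℚ) × List (ℚ × ℚ))) (i : Fin I.length) :
    List ((ℚ × ℚ) × ℚ) :=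
  (I.get i).1.flatMap fun v => (I.get i).2.map fun b => ((v.1, b.1), v.2 * b.2)

/-- Each action comes with distributions of a nonnegative value and of a bias. -/
def ValidValueBias (I : List (List (ℚ × ℚ) × List (ℚ × ℚ))) : Prop :=
  ∀ A ∈ I, IsDist A.1 ∧ IsDist A.2 ∧ ∀ v ∈ A.1, 0 ≤ v.1

/-- Delegated choice with independent random biases: the principal offers a nonempty set of
actions, the agent picks the one with the largest value plus bias, and the principal gets
its value. -/
def delegationRandomBias : MaxProblem (.list (.prod distTy distTy)) (.list .bool) where
  IsInstance I := I ≠ [] ∧ ValidValueBias I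
  IsSolution I s := s.length = I.length ∧ (offered I.length s).Nonempty
  value I s := expect (valueBiasLaw I) fun x =>
    favouritePayoff (offered I.length s) (fun i => (x i).1 + (x i).2) fun i => (x i).1

/-- Delegated choice with independent random biases and an outside option: an instance is a pair
of the distribution of the agent's utility `b₀` from the outside option, and the actions.  The
agent picks the offered action with the largest value plus bias, if this is at least `b₀`;
otherwise the principal gets `0`. -/
def delegationOutsideOption :
    MaxProblem (.prod distTy (.list (.prod distTy distTy))) (.list .bool) where
  IsInstance I := IsDist I.1 ∧ ValidValueBias I.2
  IsSolution I s := s.length = I.2.length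
  value I s := mean I.1 fun b₀ => expect (valueBiasLaw I.2) fun x =>
    if ∃ i ∈ offered I.2.length s, b₀ ≤ (x i).1 + (x i).2 then
      favouritePayoff (offered I.2.length s) (fun i => (x i).1 + (x i).2) fun i => (x i).1
    else 0

/-- Assortment optimization with independent utilities: an instance is a pair of the distribution
of the buyer's utility `u₀` from not buying, and the items, each with a price and a distribution of
the buyer's value.  The buyer picks the offered item with the largest value minus price, if this is
at least `u₀`, and the seller gets its price; otherwise the seller gets `0`. -/
def assortment : MaxProblem (.prod distTy (.list (.prod .rat distTy))) (.list .bool) where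
  IsInstance I := IsDist I.1 ∧ ∀ A ∈ I.2, (0 : ℚ) ≤ A.1 ∧ IsDist A.2
  IsSolution I s := s.length = I.2.length
  value I s := mean I.1 fun u₀ => expect (fun i => (I.2.get i).2) fun v =>
    if ∃ i ∈ offered I.2.length s, u₀ ≤ v i - (I.2.get i).1 then
      favouritePayoff (offered I.2.length s) (fun i => v i - (I.2.get i).1)
        fun i => (I.2.get i).1
    else 0

/-! APPROXIMATION. After preprocessing, distinct pieces have distinct perturbed agent utilities,
every piece has probability at most `1/M²`, and among pieces of equal original agent utility a
higher perturbed one is at least as good for the principal. So the agent's favourite is the strict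
maximum of independent draws, ties are broken correctly without further care, and the value is the
sum over pieces of the principal utility times the probability `winProb` of being drawn and beating
all other draws (`law_winner`, `value_eq_winMean`).

Number the bins from 1 and let `allLow m` be the probability that all draws lie in the first `m`
bins. For a piece in bin `J` to win it is necessary that the other draws lie in the first `J` bins,
and sufficient that they lie in the first `J - 1`. Hence the contribution `V_J` of bin `J` to the
value lies between `allLow (J-1)` and `allLow J` times the sum of conditional utilities in the
objective (`binValue_ge`, `binValue_le`). Moreover `allLow (J-1) / allLow J` is the product of the
`1 - q_iJ`, so the constraints on `∑ q_iJ` control `allLow`.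

For a feasible configuration, downward induction from `allLow M = 1` gives `allLow (J-1) ≥
(J-5)/(M-1)` for `J ≥ 6` (`allLow_ge`); therefore the objective never exceeds the true value
(`utilEst_le_winMean`). Conversely, for an optimal configuration some guess consists of approximate
quantiles of the favourite, with `allLow m` within `1/M²` of `m/M` (`exists_guess`). For this guess
the optimum is feasible (`feasible_of_guess`), and its objective is at least `∑ (1 - 5/J) V_J`
(`le_utilEst`). The inner optimum for this guess then has a true value at least as large, and the
output is no worse.

It remains to bound the loss `∑ (5/J) V_J`, and only here alignment enters: it says that the first
`m` bins contribute at most `√(m/M)/c` times the value. Summation by parts bounds the loss by `(5 +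
10/c)/√M` times the value (`sum_weights_le`, `exists_guess_utilEst`). Alignment is assumed for
thresholds of the original utility; concavity of the square root carries it over to perturbed
thresholds, which may cut through an atom (`winMean_lt_le_sqrt`).

RUNNING TIME. In units of `1/(M²n)` the rounded probabilities are natural numbers, so the inner
optimization is a knapsack problem with `M` constraint dimensions and coordinates at most `M²n²`,
solved exactly by dynamic programming. Polynomial time is proved compositionally: `PolyTime` is
closed under the list operations used. One uniform program whose time is polynomial only for fixed
`M` is covered by adding `(size + M + 2)^(M+1)` to the weight of the input (`Padded`).

APPLICATIONS. Each action gets two configurations, offered or not; an outside option is averaged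
into the principal's utility. Chebyshev's inequality shows that small agent utilities of a single
action do not raise its conditional mean (`IsWeaklyAligned`). Splitting an optimal set into one
action and two parts, each of which alone is no better than the whole, then gives alignment with `c
= 1/3` (`lowValue_self_le`). -/

/-! ### Polynomial-time functions -/

/-- A type whose elements are encoded as data.  The weight bounds the size of the encoding. -/
class Data (α : Type) where
  ty : Ty
  enc : α → ty.Val
  wt : α → ℕ
  size_le : ∀ x, ty.size (enc x) ≤ wt x

open Data

/-- The size of a rational number as the larger of those of its numerator and denominator. -/
def ratHeight (q : ℚ) : ℕ := max (Nat.size q.num.natAbs) (Nat.size q.den)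

instance : Data Bool where
  ty := .bool
  enc x := x
  wt _ := 1
  size_le _ := le_rfl

instance : Data ℕ where
  ty := .nat
  enc x := x
  wt x := Nat.size x + 1
  size_le _ := le_rfl

instance : Data ℚ where
  ty := .rat
  enc x := x
  wt x := 2 * ratHeight x + 1
  size_le x := by
    have h1 := le_max_left (Nat.size x.num.natAbs) (Nat.size x.den)
    have h2 := le_max_right (Nat.size x.num.natAbs) (Nat.size x.den)
    simp only [Ty.size, ratHeight]
    omega

section Instances

variable {α β : Type} [Data α] [Data β]

instance : Data (α × β) where
  ty := .prod (ty α) (ty β)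
  enc x := (enc x.1, enc x.2)
  wt x := wt x.1 + wt x.2 + 1
  size_le x := by
    have h1 := size_le x.1
    have h2 := size_le x.2
    simp only [Ty.size]
    omega

instance : Data (Option α) where
  ty := .opt (ty α)
  enc x := x.map enc
  wt x := match x with
    | none => 1
    | some y => wt y + 1
  size_le x := by
    cases x with
    | none => exact le_rfl
    | some y => exact Nat.succ_le_succ (size_le y)

instance : Data (List α) where
  ty := .list (ty α)
  enc l := l.map enc
  wt l := (l.map fun x => wt x + 1).sum + 1
  size_le l := by
    simp only [Ty.size, List.map_map]
    gcongr
    exact List.sum_le_sum fun x _ => Nat.succ_le_succ (size_le x)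

end Instances

/-- The encoding of a type through another one. -/
@[reducible] def Data.induced {α β : Type} [Data β] (f : α → β) : Data α where
  ty := ty β
  enc x := enc (f x)
  wt x := wt (f x)
  size_le x := size_le (f x)

/-- Polynomially bounded functions. -/
def PolyBdd {Γ : Type} [Data Γ] (f : Γ → ℕ) : Prop := ∃ k, ∀ x, f x ≤ (wt x + 2) ^ k

namespace PolyBdd

variable {Γ Δ : Type} [Data Γ] [Data Δ] {f g : Γ → ℕ}

theorem mono (hf : PolyBdd f) (h : ∀ x, g x ≤ f x) : PolyBdd g :=
  hf.imp fun _ hk x => (h x).trans (hk x)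

theorem wt' : PolyBdd (fun x : Γ => wt x) := ⟨1, fun x => by simp⟩

theorem const (c : ℕ) : PolyBdd (fun _ : Γ => c) :=
  -- The base is at least `2`, so the constant `c < 2 ^ c` can serve as its own exponent.
  ⟨c, fun x => Nat.lt_two_pow_self.le.trans (Nat.pow_le_pow_left (by omega) c)⟩

theorem mul (hf : PolyBdd f) (hg : PolyBdd g) : PolyBdd (fun x => f x * g x) := by
  obtain ⟨a, ha⟩ := hf
  obtain ⟨b, hb⟩ := hg
  exact ⟨a + b, fun x => by rw [pow_add]; exact Nat.mul_le_mul (ha x) (hb x)⟩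

theorem add (hf : PolyBdd f) (hg : PolyBdd g) : PolyBdd (fun x => f x + g x) := by
  obtain ⟨a, ha⟩ := hf
  obtain ⟨b, hb⟩ := hg
  refine ⟨a + b + 1, fun x => ?_⟩
  have h2 : 2 ≤ wt x + 2 := by omega
  have h1 : (wt x + 2) ^ a ≤ (wt x + 2) ^ (a + b) := Nat.pow_le_pow_right (by omega) (by omega)
  have h3 : (wt x + 2) ^ b ≤ (wt x + 2) ^ (a + b) := Nat.pow_le_pow_right (by omega) (by omega)
  have := ha x
  have := hb x
  calc f x + g x ≤ (wt x + 2) ^ (a + b) * 2 := by omega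
    _ ≤ (wt x + 2) ^ (a + b + 1) := by rw [pow_succ]; gcongr

theorem pow (hf : PolyBdd f) (n : ℕ) : PolyBdd (fun x => f x ^ n) := by
  obtain ⟨a, ha⟩ := hf
  exact ⟨a * n, fun x => by rw [pow_mul]; exact Nat.pow_le_pow_left (ha x) n⟩

theorem comp {h : Δ → ℕ} (hh : PolyBdd h) {e : Γ → Δ} (he : PolyBdd fun x => wt (e x)) :
    PolyBdd (fun x => h (e x)) := by
  obtain ⟨k, hk⟩ := hh
  exact ((he.add (const 2)).pow k).mono fun x => hk (e x)

end PolyBdd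

/-- Functions that are computed by programs in polynomial time with respect to the weight. -/
@[fun_prop]
structure PolyTime {Γ α : Type} [Data Γ] [Data α] (f : Γ → α) : Prop where
  exists_prog : ∃ A : Prog (ty Γ) (ty α), (∀ x, A.eval (enc x) = enc (f x)) ∧
    PolyBdd fun x => A.time (enc x)
  wt_le : PolyBdd fun x => wt (f x)

namespace PolyTime

variable {Γ Δ α β γ ρ : Type} [Data Γ] [Data Δ] [Data α] [Data β] [Data γ] [Data ρ]

theorem of_prim {f : Γ → α} (p : Prim (ty Γ) (ty α)) (hp : ∀ x, p.eval (enc x) = enc (f x))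
    (hw : PolyBdd fun x => wt (f x)) : PolyTime f := by
  refine ⟨⟨.prim p, hp, ?_⟩, hw⟩
  refine ((((PolyBdd.const 1).add PolyBdd.wt').add hw).pow 2).mono fun x => ?_
  simp only [Prog.time, hp]
  have h1 := size_le x
  have h2 := size_le (f x)
  gcongr

@[fun_prop]
theorem id : PolyTime (fun x : Γ => x) := of_prim .id (fun _ => rfl) PolyBdd.wt'

-- The second program runs on `f x`, so its time is polynomial in `wt (f x)`; the output bound
-- `wt_le` turns this into a bound in `wt x`. This is why `PolyTime` carries that bound.
@[fun_prop]
theorem comp {g : α → β} {f : Γ → α} (hg : PolyTime g) (hf : PolyTime f) :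
    PolyTime (fun x => g (f x)) := by
  obtain ⟨⟨A, hA, tA⟩, wA⟩ := hf
  obtain ⟨⟨B, hB, tB⟩, wB⟩ := hg
  refine ⟨⟨.comp B A, fun x => by simp only [Prog.eval, hA, hB], ?_⟩, wB.comp wA⟩
  simp only [Prog.time, hA]
  exact tA.add (tB.comp wA)

theorem fst' : PolyTime (fun x : α × β => x.1) :=
  of_prim .fst (fun _ => rfl) (PolyBdd.wt'.mono fun x => by simp only [wt]; omega)

theorem snd' : PolyTime (fun x : α × β => x.2) :=
  of_prim .snd (fun _ => rfl) (PolyBdd.wt'.mono fun x => by simp only [wt]; omega)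

@[fun_prop]
theorem fst {f : Γ → α × β} (hf : PolyTime f) : PolyTime (fun x => (f x).1) := fst'.comp hf

@[fun_prop]
theorem snd {f : Γ → α × β} (hf : PolyTime f) : PolyTime (fun x => (f x).2) := snd'.comp hf

@[fun_prop]
theorem prodMk {f : Γ → α} {g : Γ → β} (hf : PolyTime f) (hg : PolyTime g) :
    PolyTime (fun x => (f x, g x)) := by
  obtain ⟨⟨A, hA, tA⟩, wA⟩ := hf
  obtain ⟨⟨B, hB, tB⟩, wB⟩ := hg
  refine ⟨⟨.pair A B, fun x => ?_, ?_⟩, (wA.add wB).add (PolyBdd.const 1)⟩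
  · simp only [Prog.eval, hA, hB]; rfl
  · exact (tA.add tB).add (PolyBdd.const 1)

theorem comp₂ {g : α × β → γ} {f : Γ → α} {h : Γ → β} (hg : PolyTime g) (hf : PolyTime f)
    (hh : PolyTime h) : PolyTime (fun x => g (f x, h x)) := hg.comp (hf.prodMk hh)

/-! Constants -/

theorem natConst (k : ℕ) : PolyTime (fun _ : Γ => k) :=
  of_prim (.natLit k) (fun _ => rfl) (PolyBdd.const _)

theorem boolConst (b : Bool) : PolyTime (fun _ : Γ => b) :=
  of_prim (.boolLit b) (fun _ => rfl) (PolyBdd.const _)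

@[fun_prop]
theorem some {f : Γ → α} (hf : PolyTime f) : PolyTime (fun x => some (f x)) :=
  (of_prim (Γ := α) .some (fun _ => rfl) (PolyBdd.wt'.add (PolyBdd.const 1))).comp hf

theorem wt_cons (a : α) (l : List α) : wt (a :: l) = wt a + 1 + wt l := by
  simp only [wt, List.map_cons, List.sum_cons]; omega

@[fun_prop]
theorem cons {f : Γ → α} {g : Γ → List α} (hf : PolyTime f) (hg : PolyTime g) :
    PolyTime (fun x => f x :: g x) :=
  (of_prim (Γ := α × List α) (f := fun p => p.1 :: p.2) .cons (fun _ => rfl)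
    (PolyBdd.wt'.mono fun x => by
      rw [wt_cons]; show _ ≤ wt x.1 + wt x.2 + 1; omega)).comp₂ hf hg

/-! Arithmetic -/

theorem natSize_add_le (a b : ℕ) : Nat.size (a + b) ≤ max (Nat.size a) (Nat.size b) + 1 := by
  rw [Nat.size_le, pow_succ]
  have h1 : a < 2 ^ max (Nat.size a) (Nat.size b) := Nat.size_le.1 (le_max_left _ _)
  have h2 : b < 2 ^ max (Nat.size a) (Nat.size b) := Nat.size_le.1 (le_max_right _ _)
  omega

theorem natSize_mul_le (a b : ℕ) : Nat.size (a * b) ≤ Nat.size a + Nat.size b := by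
  rw [Nat.size_le, pow_add]
  exact Nat.mul_lt_mul'' (Nat.lt_size_self a) (Nat.lt_size_self b)

@[fun_prop]
theorem natAdd {f g : Γ → ℕ} (hf : PolyTime f) (hg : PolyTime g) :
    PolyTime (fun x => f x + g x) :=
  (of_prim (Γ := ℕ × ℕ) (f := fun p => p.1 + p.2) .natAdd (fun _ => rfl)
    (PolyBdd.wt'.mono fun x => by
      have := natSize_add_le x.1 x.2
      simp only [wt]; omega)).comp₂ hf hg

@[fun_prop]
theorem natMul {f g : Γ → ℕ} (hf : PolyTime f) (hg : PolyTime g) :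
    PolyTime (fun x => f x * g x) :=
  (of_prim (Γ := ℕ × ℕ) (f := fun p => p.1 * p.2) .natMul (fun _ => rfl)
    (PolyBdd.wt'.mono fun x => by
      have := natSize_mul_le x.1 x.2
      simp only [wt]; omega)).comp₂ hf hg

@[fun_prop]
theorem natLe {f g : Γ → ℕ} (hf : PolyTime f) (hg : PolyTime g) :
    PolyTime (fun x => decide (f x ≤ g x)) :=
  (of_prim (Γ := ℕ × ℕ) (f := fun p => decide (p.1 ≤ p.2)) .natLe
    (fun p => by
      show Nat.ble p.1 p.2 = decide (p.1 ≤ p.2)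
      rw [Bool.eq_iff_iff]; simp)
    (PolyBdd.const 1)).comp₂ hf hg

@[fun_prop]
theorem natCast {f : Γ → ℕ} (hf : PolyTime f) : PolyTime (fun x => (f x : ℚ)) :=
  (of_prim (Γ := ℕ) (f := fun p => (p : ℚ)) .natToRat (fun _ => rfl)
    ((PolyBdd.wt'.mul (PolyBdd.const 2)).add (PolyBdd.const 3) |>.mono fun x => by
      simp [wt, ratHeight]; omega)).comp hf

/-- Numerator and denominator in lowest terms divide those of any other representation, so every
fraction bounds the height. -/
theorem ratHeight_le {q : ℚ} {k : ℕ} (a b : ℤ) (hb : b ≠ 0) (hq : q = a / b)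
    (ha' : Nat.size a.natAbs ≤ k) (hb' : Nat.size b.natAbs ≤ k) : ratHeight q ≤ k := by
  have h1 : q.num ∣ a := by rw [hq, ← Rat.divInt_eq_div]; exact Rat.num_dvd a hb
  have h2 : (q.den : ℤ) ∣ b := by rw [hq, ← Rat.divInt_eq_div]; exact Rat.den_dvd a b
  refine max_le ?_ ?_
  · rcases eq_or_ne a 0 with rfl | ha
    · simp [hq]
    · exact (Nat.size_le_size (Nat.le_of_dvd (Int.natAbs_pos.2 ha)
        (Int.natAbs_dvd_natAbs.2 h1))).trans ha'
  · exact (Nat.size_le_size (Nat.le_of_dvd (Int.natAbs_pos.2 hb)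
      (by simpa using Int.natAbs_dvd_natAbs.2 h2))).trans hb'

theorem size_num_le (q : ℚ) : Nat.size q.num.natAbs ≤ ratHeight q := le_max_left _ _
theorem size_den_le (q : ℚ) : Nat.size q.den ≤ ratHeight q := le_max_right _ _

/-- Taking the maximum of the two sizes, and not their sum, makes the height additive up to `1`:
with the sum, the denominators would be counted twice. Hence a sum over a list has weight at most
linear in that of the list, and folds that add rationals stay polynomial. -/
theorem ratHeight_add_le (p q : ℚ) : ratHeight (p + q) ≤ ratHeight p + ratHeight q + 1 := by
  have hp := p.den_ne_zero
  have hq := q.den_ne_zero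
  refine ratHeight_le (p.num * q.den + q.num * p.den) (p.den * q.den)
    (by exact_mod_cast mul_ne_zero hp hq) ?_ ?_ ?_
  · push_cast
    have h1 : (p.den : ℚ) ≠ 0 := by exact_mod_cast hp
    have h2 : (q.den : ℚ) ≠ 0 := by exact_mod_cast hq
    nth_rw 1 [← Rat.num_div_den p, ← Rat.num_div_den q]
    rw [div_add_div _ _ h1 h2, mul_comm (p.den : ℚ) (q.num : ℚ)]
  · refine (Nat.size_le_size (Int.natAbs_add_le _ _)).trans ?_
    refine (natSize_add_le _ _).trans ?_
    simp only [Int.natAbs_mul, Int.natAbs_natCast]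
    have h1 := natSize_mul_le p.num.natAbs q.den
    have h2 := natSize_mul_le q.num.natAbs p.den
    have := size_num_le p
    have := size_num_le q
    have := size_den_le p
    have := size_den_le q
    omega
  · simp only [Int.natAbs_mul, Int.natAbs_natCast]
    have h1 := natSize_mul_le p.den q.den
    have := size_den_le p
    have := size_den_le q
    omega

theorem ratHeight_mul_le (p q : ℚ) : ratHeight (p * q) ≤ ratHeight p + ratHeight q := by
  have hp := p.den_ne_zero
  have hq := q.den_ne_zero
  refine ratHeight_le (p.num * q.num) (p.den * q.den)
    (by exact_mod_cast mul_ne_zero hp hq) ?_ ?_ ?_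
  · push_cast
    rw [← div_mul_div_comm, Rat.num_div_den, Rat.num_div_den]
  · simp only [Int.natAbs_mul]
    exact (natSize_mul_le _ _).trans (add_le_add (size_num_le p) (size_num_le q))
  · simp only [Int.natAbs_mul, Int.natAbs_natCast]
    exact (natSize_mul_le _ _).trans (add_le_add (size_den_le p) (size_den_le q))

theorem ratHeight_neg (q : ℚ) : ratHeight (-q) = ratHeight q := by simp [ratHeight]

theorem ratHeight_inv (q : ℚ) : ratHeight q⁻¹ ≤ ratHeight q + 1 := by
  rcases eq_or_ne q 0 with rfl | h
  · simp [ratHeight]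
  · refine ratHeight_le q.den q.num (by simpa using h) ?_ ?_ ?_
    · nth_rw 1 [← Rat.num_div_den q]
      rw [inv_div]; simp
    · simpa using (size_den_le q).trans (Nat.le_succ _)
    · exact (size_num_le q).trans (Nat.le_succ _)

theorem wt_rat_add_le (p q : ℚ) : wt (p + q) ≤ wt p + wt q + 1 := by
  have := ratHeight_add_le p q
  simp only [wt]; omega

theorem wt_rat_mul_le (p q : ℚ) : wt (p * q) ≤ wt p + wt q := by
  have := ratHeight_mul_le p q
  simp only [wt]; omega

@[fun_prop]
theorem ratAdd {f g : Γ → ℚ} (hf : PolyTime f) (hg : PolyTime g) :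
    PolyTime (fun x => f x + g x) :=
  (of_prim (Γ := ℚ × ℚ) (f := fun p => p.1 + p.2) .ratAdd (fun _ => rfl)
    (PolyBdd.wt'.mono fun x => wt_rat_add_le x.1 x.2)).comp₂ hf hg

@[fun_prop]
theorem ratSub {f g : Γ → ℚ} (hf : PolyTime f) (hg : PolyTime g) :
    PolyTime (fun x => f x - g x) :=
  (of_prim (Γ := ℚ × ℚ) (f := fun p => p.1 - p.2) .ratSub (fun _ => rfl)
    (PolyBdd.wt'.mono fun x => by
      have := ratHeight_add_le x.1 (-x.2)
      rw [ratHeight_neg, ← sub_eq_add_neg] at this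
      simp only [wt]; omega)).comp₂ hf hg

@[fun_prop]
theorem ratMul {f g : Γ → ℚ} (hf : PolyTime f) (hg : PolyTime g) :
    PolyTime (fun x => f x * g x) :=
  (of_prim (Γ := ℚ × ℚ) (f := fun p => p.1 * p.2) .ratMul (fun _ => rfl)
    (PolyBdd.wt'.mono fun x => (wt_rat_mul_le x.1 x.2).trans (Nat.le_succ _))).comp₂ hf hg

@[fun_prop]
theorem ratDiv {f g : Γ → ℚ} (hf : PolyTime f) (hg : PolyTime g) :
    PolyTime (fun x => f x / g x) :=
  (of_prim (Γ := ℚ × ℚ) (f := fun p => p.1 / p.2) .ratDiv (fun _ => rfl)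
    ((PolyBdd.wt'.add (PolyBdd.const 3)).mono fun x => by
      have := ratHeight_mul_le x.1 x.2⁻¹
      have := ratHeight_inv x.2
      rw [← div_eq_mul_inv] at *
      simp only [wt]; omega)).comp₂ hf hg

@[fun_prop]
theorem ratLe {f g : Γ → ℚ} (hf : PolyTime f) (hg : PolyTime g) :
    PolyTime (fun x => decide (f x ≤ g x)) :=
  (of_prim (Γ := ℚ × ℚ) (f := fun p => decide (p.1 ≤ p.2)) .ratLe (fun _ => rfl)
    (PolyBdd.const 1)).comp₂ hf hg

@[fun_prop]
theorem ratFloor {f : Γ → ℚ} (hf : PolyTime f) : PolyTime (fun x => ⌊f x⌋₊) :=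
  (of_prim (Γ := ℚ) (f := fun p => ⌊p⌋₊) .ratFloor (fun _ => rfl)
    (PolyBdd.wt'.mono fun x => by
      have h1 := size_num_le x
      -- A nonnegative rational is at most its numerator, and a negative one has floor `0`.
      have h2 : ⌊x⌋₊ ≤ x.num.natAbs := by
        rcases le_or_gt 0 x with hx | hx
        · refine Nat.floor_le_of_le ?_
          have h3 : x ≤ x.num := by
            nth_rw 1 [← Rat.num_div_den x]
            refine div_le_self (by exact_mod_cast Rat.num_nonneg.2 hx) ?_
            exact_mod_cast x.den_pos
          refine h3.trans ?_
          have h4 : x.num ≤ (x.num.natAbs : ℤ) := Int.le_natAbs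
          calc (x.num : ℚ) ≤ ((x.num.natAbs : ℤ) : ℚ) := Int.cast_le.2 h4
            _ = _ := Int.cast_natCast _
        · simp [Nat.floor_of_nonpos hx.le]
      have := Nat.size_le_size h2
      simp only [wt]; omega)).comp hf

/-- Lists `0, …, k - 1` of polynomial length. -/
theorem range {f : Γ → ℕ} (hf : PolyTime f) (hb : PolyBdd f) :
    PolyTime (fun x => List.range (f x)) := by
  obtain ⟨⟨A, hA, tA⟩, wA⟩ := hf
  have hw : PolyBdd fun x => wt (List.range (f x)) := by
    refine ((hb.mul ((hb.add (PolyBdd.const 2)))).add (PolyBdd.const 1)).mono fun x => ?_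
    show ((List.range (f x)).map fun k => wt k + 1).sum + 1 ≤ _
    gcongr
    have := List.sum_le_card_nsmul ((List.range (f x)).map fun k => wt k + 1) (f x + 2) ?_
    · simpa using this
    · intro k hk
      obtain ⟨j, hj, rfl⟩ := List.mem_map.1 hk
      have h1 : Nat.size j ≤ j := Nat.size_le.2 Nat.lt_two_pow_self
      have := List.mem_range.1 hj
      simp only [wt]; omega
  have he : ∀ x, (List.range (f x) : List ℕ) = enc (List.range (f x)) := fun x =>
    (List.map_id _).symm
  refine ⟨⟨.comp (.prim .range) A, fun x => ?_, ?_⟩, hw⟩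
  · simp only [Prog.eval, hA]
    exact he x
  · refine (tA.add ((((PolyBdd.const 1).add wA).add hw).pow 2)).mono fun x => ?_
    simp only [Prog.time, hA]
    have h1 := size_le (f x)
    have h2 := size_le (List.range (f x))
    rw [← he] at h2
    refine add_le_add_right (Nat.pow_le_pow_left (add_le_add (add_le_add_right h1 1) h2) 2) _

/-! Control -/

@[fun_prop]
theorem cond {c : Γ → Bool} {f g : Γ → α} (hc : PolyTime c) (hf : PolyTime f) (hg : PolyTime g) :
    PolyTime (fun x => bif c x then f x else g x) := by
  obtain ⟨⟨A, hA, tA⟩, wA⟩ := hf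
  obtain ⟨⟨B, hB, tB⟩, wB⟩ := hg
  obtain ⟨⟨D, hD, tD⟩, -⟩ := hc
  have hD' : ∀ x, D.eval (enc x) = c x := hD
  refine ⟨⟨.ite D A B, fun x => ?_, ?_⟩, (wA.add wB).mono fun x => ?_⟩
  · simp only [Prog.eval, hA, hB]
    rw [hD']
    cases c x <;> rfl
  · refine (tD.add (tA.add tB)).mono fun x => ?_
    simp only [Prog.time]
    rw [hD']
    cases c x <;> simp
  · cases c x <;> simp

@[fun_prop]
theorem boolConst' (b : Bool) : PolyTime (fun _ : Γ => b) := boolConst b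

@[fun_prop]
theorem band {f g : Γ → Bool} (hf : PolyTime f) (hg : PolyTime g) :
    PolyTime (fun x => f x && g x) := by
  convert hf.cond hg (boolConst false) using 2 with x
  cases f x <;> rfl

@[fun_prop]
theorem bor {f g : Γ → Bool} (hf : PolyTime f) (hg : PolyTime g) :
    PolyTime (fun x => f x || g x) := by
  convert hf.cond (boolConst true) hg using 2 with x
  cases f x <;> rfl

@[fun_prop]
theorem bnot {f : Γ → Bool} (hf : PolyTime f) : PolyTime (fun x => !f x) := by
  convert hf.cond (boolConst false) (boolConst true) using 2 with x
  cases f x <;> rfl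

theorem optElim {o : Γ → Option α} {f : Γ → β} {g : Γ → α → β} (ho : PolyTime o)
    (hf : PolyTime f) (hg : PolyTime fun p : Γ × α => g p.1 p.2) :
    PolyTime (fun x => (o x).elim (f x) (g x)) := by
  obtain ⟨⟨D, hD, tD⟩, wD⟩ := ho
  obtain ⟨⟨A, hA, tA⟩, wA⟩ := hf
  obtain ⟨⟨B, hB, tB⟩, wB⟩ := hg
  -- If `o x = some y`, then the weight of `y` is less than that of `o x`, so a polynomial bound in
  -- `(x, y)` is one in `x`.
  have key : ∀ {h : Γ × α → ℕ}, PolyBdd h →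
      PolyBdd fun x => (o x).elim 0 fun y => h (x, y) := by
    rintro h ⟨k, hk⟩
    refine (((PolyBdd.wt'.add wD).add (PolyBdd.const 3)).pow k).mono fun x => ?_
    rcases ho : o x with _ | y
    · simp
    · refine (hk (x, y)).trans (Nat.pow_le_pow_left ?_ k)
      simp only [wt]; omega
  refine ⟨⟨.comp (.optElim A B) (.pair (.prim .id) D), fun x => ?_, ?_⟩,
    (wA.add (key wB)).mono fun x => ?_⟩
  · simp only [Prog.eval, hD]
    rcases o x with _ | y
    · exact hA x
    · exact hB (x, y)
  · refine ((((((PolyBdd.const 1).add PolyBdd.wt').add PolyBdd.wt').pow 2).add (tD.add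
      (PolyBdd.const 1))).add (((PolyBdd.const 2).add (PolyBdd.wt'.add wD)).add
      (tA.add (key tB)))).mono fun x => ?_
    have h1 := size_le x
    have h2 := size_le (o x)
    have h3 : (Ty.prod (ty Γ) (.opt (ty α))).size (enc x, enc (o x)) ≤ wt x + wt (o x) + 1 := by
      simp only [Ty.size]
      exact Nat.succ_le_succ (add_le_add h1 h2)
    have h4 : (1 + (ty Γ).size (enc x) + (ty Γ).size (enc x)) ^ 2 ≤ (1 + wt x + wt x) ^ 2 := by
      gcongr
    simp only [Prog.time, Prog.eval, hD, Prim.eval]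
    rcases hx : o x with _ | y
    · rw [hx] at h3
      have h5 : A.time (enc x) ≤ A.time (enc x) := le_rfl
      simp only [enc, Option.map_none, Option.elim] at h3 h4 h5 ⊢
      omega
    · rw [hx] at h3
      have h5 : B.time (enc x, enc y) ≤ B.time (enc x, enc y) := le_rfl
      simp only [enc, Option.map_some, Option.elim] at h3 h4 h5 ⊢
      omega
  · rcases o x with _ | y
    · exact Nat.le_add_right _ _
    · exact Nat.le_add_left _ _

/-- Left folds with states of polynomial weight. -/
theorem foldl {l : Γ → List α} {init : Γ → ρ} {step : Γ → ρ → α → ρ} (hl : PolyTime l)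
    (hi : PolyTime init) (hs : PolyTime fun p : Γ × ρ × α => step p.1 p.2.1 p.2.2)
    {b : Γ → ℕ} (hb : PolyBdd b)
    (hbd : ∀ x l', l' <+: l x → wt (l'.foldl (step x) (init x)) ≤ b x) :
    PolyTime (fun x => (l x).foldl (step x) (init x)) := by
  obtain ⟨⟨L, hL, tL⟩, wL⟩ := hl
  obtain ⟨⟨A, hA, tA⟩, wA⟩ := hi
  obtain ⟨⟨S, hS, ⟨k, tS⟩⟩, -⟩ := hs
  have hev : ∀ x (m : List α) (r : ρ),
      (m.map enc).foldl (fun r y => S.eval (enc x, r, y)) (enc r) = enc (m.foldl (step x) r) := by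
    intro x m
    induction m with
    | nil => intro r; rfl
    | cons a m ih =>
      intro r
      rw [List.map_cons, List.foldl_cons, List.foldl_cons, ← ih]
      exact congrArg (fun r => (m.map enc).foldl (fun r y => S.eval (enc x, r, y)) r) (hS (x, r, a))
  -- `m'` is the prefix already processed. Every state that is fed to the step comes from a prefix
  -- of `l x`, so `hbd` bounds its weight, and all iterations share one bound on their time.
  have htm : ∀ x (m m' : List α) (t : ℕ), m' ++ m = l x →
      ((m.map enc).foldl (fun s y => (S.eval (enc x, s.1, y), s.2 + S.time (enc x, s.1, y)))
        (enc (m'.foldl (step x) (init x)), t)).2 ≤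
        t + m.length * (wt x + b x + wt (l x) + 4) ^ k := by
    intro x m
    induction m with
    | nil => intro m' t _; simp
    | cons a m ih =>
      intro m' t hm
      have hpre : m' <+: l x := ⟨_, hm⟩
      have h1 : S.eval (enc x, enc (m'.foldl (step x) (init x)), enc a) =
          enc ((m' ++ [a]).foldl (step x) (init x)) := by
        rw [List.foldl_append]
        exact hS (x, _, a)
      have h2 := tS (x, m'.foldl (step x) (init x), a)
      have h3 : wt a ≤ wt (l x) := by
        rw [← hm]
        simp only [wt, List.map_append, List.sum_append, List.map_cons, List.sum_cons]
        omega
      have h4 := hbd x m' hpre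
      have h5 : S.time (enc x, enc (m'.foldl (step x) (init x)), enc a) ≤
          (wt x + b x + wt (l x) + 4) ^ k := by
        refine h2.trans (Nat.pow_le_pow_left ?_ k)
        simp only [wt] at h3 h4 ⊢
        omega
      simp only [List.map_cons, List.foldl_cons]
      rw [h1]
      refine (ih (m' ++ [a]) _ (by simpa using hm)).trans ?_
      rw [List.length_cons, add_mul]
      omega
  have hlen : ∀ x, (l x).length ≤ wt (l x) := fun x => by
    simp only [wt]
    induction l x with
    | nil => simp
    | cons a t ih => simp only [List.length_cons, List.map_cons, List.sum_cons]; omega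
  refine ⟨⟨.comp (.fold S) (.pair (.prim .id) (.pair A L)), fun x => ?_, ?_⟩,
    hb.mono fun x => hbd x _ (List.prefix_refl _)⟩
  · simp only [Prog.eval, hA, hL]
    exact hev x (l x) (init x)
  · refine (((((PolyBdd.const 1).add PolyBdd.wt').add PolyBdd.wt').pow 2).add
      ((tA.add tL).add (PolyBdd.const 2)) |>.add
      (((PolyBdd.const 3).add ((PolyBdd.wt'.add wA).add wL)).add
      (wL.mul ((((PolyBdd.wt'.add hb).add wL).add (PolyBdd.const 4)).pow k)))).mono fun x => ?_
    have h1 := size_le x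
    have h2 := size_le (init x)
    have h3 := size_le (l x)
    have h4 := htm x (l x) [] 0 rfl
    have h5 := Nat.mul_le_mul_right ((wt x + b x + wt (l x) + 4) ^ k) (hlen x)
    have h6 : (Ty.prod (ty Γ) (.prod (ty ρ) (.list (ty α)))).size
        (enc x, enc (init x), enc (l x)) ≤ wt x + wt (init x) + wt (l x) + 2 := by
      have h6 : (Ty.prod (ty Γ) (.prod (ty ρ) (.list (ty α)))).size
        (enc x, enc (init x), enc (l x)) = (ty Γ).size (enc x) + ((ty ρ).size (enc (init x)) +
          (ty (List α)).size (enc (l x)) + 1) + 1 := rfl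
      omega
    have h7 : (1 + (ty Γ).size (enc x) + (ty Γ).size (enc x)) ^ 2 ≤ (1 + wt x + wt x) ^ 2 := by
      gcongr
    simp only [List.foldl_nil] at h4
    simp only [Prog.time, Prog.eval, hA, hL, Prim.eval]
    have h8 := h4.trans (add_le_add le_rfl h5)
    change Ty.size (.prod (ty Γ) (.prod (ty ρ) (.list (ty α))))
      (enc x, enc (init x), List.map enc (l x)) ≤ _ at h6
    simp only [enc] at h6 h7 h8 ⊢
    omega

end PolyTime

/-! ### Weights of lists. -/

theorem length_le_wt {α : Type} [Data α] (l : List α) : l.length ≤ wt l := by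
  simp only [wt]
  induction l with
  | nil => simp
  | cons a t ih => simp only [List.length_cons, List.map_cons, List.sum_cons]; omega

theorem wt_append {α : Type} [Data α] (l m : List α) : wt (l ++ m) + 1 = wt l + wt m := by
  simp only [wt, List.map_append, List.sum_append]; omega

theorem wt_le_of_mem {α : Type} [Data α] {l : List α} {a : α} (h : a ∈ l) : wt a + 1 ≤ wt l := by
  have : wt a + 1 ≤ (l.map fun x => wt x + 1).sum :=
    List.le_sum_of_mem (List.mem_map.2 ⟨a, h, rfl⟩)
  simp only [wt] at *
  omega

theorem wt_perm {α : Type} [Data α] {l m : List α} (h : l.Perm m) : wt l = wt m := by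
  simp only [wt, (h.map fun x => wt x + 1).sum_eq]

theorem wt_sublist {α : Type} [Data α] {l m : List α} (h : l.Sublist m) : wt l ≤ wt m := by
  have := (h.map fun x => wt x + 1).sum_le_sum (by simp)
  simp only [wt]
  omega

theorem wt_le_of_forall {α : Type} [Data α] {l : List α} {b : ℕ} (h : ∀ a ∈ l, wt a ≤ b) :
    wt l ≤ l.length * (b + 1) + 1 := by
  have := List.sum_le_card_nsmul (l.map fun k => wt k + 1) (b + 1) (by
    intro k hk
    obtain ⟨j, hj, rfl⟩ := List.mem_map.1 hk
    exact Nat.succ_le_succ (h j hj))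
  simp only [List.length_map, smul_eq_mul] at this
  exact Nat.succ_le_succ this

theorem natSize_le_self (j : ℕ) : Nat.size j ≤ j := Nat.size_le.2 Nat.lt_two_pow_self

/-! ### List operations in polynomial time. -/

namespace PolyTime

variable {Γ Δ α β γ ρ : Type} [Data Γ] [Data Δ] [Data α] [Data β] [Data γ] [Data ρ]

theorem polyBdd_length {l : Γ → List α} (hl : PolyTime l) : PolyBdd fun x => (l x).length :=
  hl.wt_le.mono fun _ => length_le_wt _

theorem congr {f g : Γ → α} (hf : PolyTime f) (h : ∀ x, g x = f x) : PolyTime g := by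
  rwa [funext h]

/-- Only booleans and natural numbers have literals; a rational is computed as the difference of the
positive and negative parts of its numerator, divided by the denominator. -/
theorem const_aux : (τ : Ty) → (v : τ.Val) →
    ∃ A : Prog (ty Γ) τ, (∀ x : Γ, A.eval (enc x) = v) ∧ PolyBdd fun x : Γ => A.time (enc x)
  | .bool, v => (boolConst v).exists_prog
  | .nat, v => (natConst v).exists_prog
  | .rat, v => by
    have h : PolyTime fun _ : Γ =>
        (((v : ℚ).num.toNat : ℚ) - ((-(v : ℚ).num).toNat : ℚ)) / ((v : ℚ).den : ℚ) :=
      (((natConst _).natCast).ratSub ((natConst _).natCast)).ratDiv ((natConst _).natCast)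
    have e : (((v : ℚ).num.toNat : ℚ) - ((-(v : ℚ).num).toNat : ℚ)) / ((v : ℚ).den : ℚ) = v := by
      nth_rw 4 [← Rat.num_div_den (v : ℚ)]
      congr 1
      exact_mod_cast Int.toNat_sub_toNat_neg (v : ℚ).num
    rw [e] at h
    exact h.exists_prog
  | .prod σ τ, v => by
    obtain ⟨A, hA, tA⟩ := const_aux σ v.1
    obtain ⟨B, hB, tB⟩ := const_aux τ v.2
    exact ⟨.pair A B, fun x => by simp only [Prog.eval, hA, hB],
      (tA.add tB).add (PolyBdd.const 1)⟩
  | .opt τ, v => match v with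
    | none => ⟨.prim .none, fun _ => rfl, by
        refine (((PolyBdd.const 1).add PolyBdd.wt').add (PolyBdd.const 1)).pow 2 |>.mono fun x => ?_
        have := size_le x
        simp only [Prog.time, Prim.eval, Ty.size]
        gcongr⟩
    | .some v => by
      obtain ⟨A, hA, tA⟩ := const_aux τ v
      refine ⟨.comp (.prim .some) A, fun x => by simp only [Prog.eval, hA, Prim.eval], ?_⟩
      simp only [Prog.time, hA]
      exact tA.add (PolyBdd.const _)
  | .list τ, v => by
    induction v with
    | nil =>
      refine ⟨.prim .nil, fun _ => rfl, ?_⟩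
      refine (((PolyBdd.const 1).add PolyBdd.wt').add (PolyBdd.const 1)).pow 2 |>.mono fun x => ?_
      have := size_le x
      simp only [Prog.time, Prim.eval, Ty.size, List.map_nil, List.sum_nil]
      gcongr
    | cons a l ih =>
      obtain ⟨A, hA, tA⟩ := const_aux τ a
      obtain ⟨B, hB, tB⟩ := ih
      refine ⟨.comp (.prim .cons) (.pair A B), fun x => by
        simp only [Prog.eval, hA, hB, Prim.eval], ?_⟩
      simp only [Prog.time, Prog.eval, hA, hB]
      exact ((tA.add tB).add (PolyBdd.const _)).add (PolyBdd.const _)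

@[fun_prop]
theorem const (c : α) : PolyTime (fun _ : Γ => c) :=
  ⟨const_aux (ty α) (enc c), PolyBdd.const _⟩

@[fun_prop]
theorem option_elim {o : Γ → Option α} {f : Γ → β} {g : Γ → α → β} (ho : PolyTime o)
    (hf : PolyTime f) (hg : PolyTime fun p : Γ × α => g p.1 p.2) :
    PolyTime (fun x => (o x).elim (f x) (g x)) := optElim ho hf hg

/-- Elements weigh less than the list, so the values of `f` on them have a common bound that depends
on `x` alone. -/
theorem exists_bound {l : Γ → List α} {f : Γ → α → β} (hl : PolyTime l)
    (hf : PolyTime fun p : Γ × α => f p.1 p.2) :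
    ∃ b : Γ → ℕ, PolyBdd b ∧ ∀ x, ∀ a ∈ l x, wt (f x a) ≤ b x := by
  obtain ⟨k, hk⟩ := hf.wt_le
  refine ⟨_, ((PolyBdd.wt'.add hl.wt_le).add (PolyBdd.const 3)).pow k, fun x a ha => ?_⟩
  refine (hk (x, a)).trans (Nat.pow_le_pow_left ?_ k)
  have := wt_le_of_mem ha
  simp only [wt] at this ⊢
  omega

/-- Left folds whose state grows by a bounded amount in each step. -/
theorem foldl_of_add {l : Γ → List α} {init : Γ → ρ} {step : Γ → ρ → α → ρ} (hl : PolyTime l)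
    (hi : PolyTime init) (hs : PolyTime fun p : Γ × ρ × α => step p.1 p.2.1 p.2.2)
    {b : Γ → ℕ} (hb : PolyBdd b) (hbd : ∀ x r, ∀ a ∈ l x, wt (step x r a) ≤ wt r + b x) :
    PolyTime (fun x => (l x).foldl (step x) (init x)) := by
  refine foldl hl hi hs (hi.wt_le.add (hl.polyBdd_length.mul hb)) fun x l' hl' => ?_
  have key : ∀ m : List α, (∀ a ∈ m, a ∈ l x) → ∀ r,
      wt (m.foldl (step x) r) ≤ wt r + m.length * b x := by
    intro m
    induction m with
    | nil => intro _ r; simp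
    | cons a m ih =>
      intro hm r
      have h1 := ih (fun c hc => hm c (List.mem_cons_of_mem _ hc)) (step x r a)
      have h2 := hbd x r a (hm a List.mem_cons_self)
      rw [List.foldl_cons, List.length_cons, add_mul]
      omega
  refine (key l' (fun a ha => hl'.subset ha) _).trans ?_
  have := hl'.length_le
  gcongr

@[fun_prop]
theorem reverse {l : Γ → List α} (hl : PolyTime l) : PolyTime (fun x => (l x).reverse) := by
  refine (foldl_of_add (init := fun _ => ([] : List α)) (step := fun _ r a => a :: r) hl
    (by fun_prop) (by fun_prop) hl.wt_le fun x r a ha => ?_).congr fun x => ?_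
  · have := wt_le_of_mem ha
    rw [wt_cons]; omega
  · simp

@[fun_prop]
theorem append {l m : Γ → List α} (hl : PolyTime l) (hm : PolyTime m) :
    PolyTime (fun x => l x ++ m x) := by
  refine (foldl_of_add (step := fun _ r a => a :: r) hl.reverse hm
    (by fun_prop) hl.wt_le fun x r a ha => ?_).congr fun x => ?_
  · have := wt_le_of_mem (List.mem_reverse.1 ha)
    rw [wt_cons]; omega
  · simp

@[fun_prop]
theorem flatMap {l : Γ → List α} {f : Γ → α → List β} (hl : PolyTime l)
    (hf : PolyTime fun p : Γ × α => f p.1 p.2) : PolyTime (fun x => (l x).flatMap (f x)) := by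
  obtain ⟨b, hb, hbd⟩ := exists_bound hl hf
  refine (foldl_of_add (init := fun _ => ([] : List β)) (step := fun x r a => f x a ++ r)
    hl.reverse (by fun_prop) ?_ hb fun x r a ha => ?_).congr fun x => ?_
  · exact append (hf.comp (f := fun p : Γ × List β × α => (p.1, p.2.2)) (by fun_prop))
      (by fun_prop)
  · have := hbd x a (List.mem_reverse.1 ha)
    have := wt_append (f x a) r
    omega
  · rw [List.foldl_reverse]
    induction l x with
    | nil => rfl
    | cons a m ih => rw [List.flatMap_cons, ih, List.foldr_cons]

@[fun_prop]
theorem map {l : Γ → List α} {f : Γ → α → β} (hl : PolyTime l)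
    (hf : PolyTime fun p : Γ × α => f p.1 p.2) : PolyTime (fun x => (l x).map (f x)) := by
  have h := flatMap (f := fun x a => [f x a]) hl (by fun_prop)
  exact h.congr fun x => by rw [List.map_eq_flatMap]

@[fun_prop]
theorem filter {l : Γ → List α} {f : Γ → α → Bool} (hl : PolyTime l)
    (hf : PolyTime fun p : Γ × α => f p.1 p.2) : PolyTime (fun x => (l x).filter (f x)) := by
  have h := flatMap (f := fun x a => bif f x a then [a] else []) hl (by fun_prop)
  refine h.congr fun x => ?_
  induction l x with
  | nil => rfl
  | cons a m ih => rw [List.flatMap_cons, ← ih, List.filter_cons]; cases f x a <;> rfl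

@[fun_prop]
theorem filterMap {l : Γ → List α} {f : Γ → α → Option β} (hl : PolyTime l)
    (hf : PolyTime fun p : Γ × α => f p.1 p.2) : PolyTime (fun x => (l x).filterMap (f x)) := by
  have h := flatMap (f := fun x a => (f x a).elim [] fun b => [b]) hl (by fun_prop)
  refine h.congr fun x => ?_
  induction l x with
  | nil => rfl
  | cons a m ih => rw [List.flatMap_cons, ← ih, List.filterMap_cons]; cases f x a <;> rfl

@[fun_prop]
theorem length {l : Γ → List α} (hl : PolyTime l) : PolyTime (fun x => (l x).length) := by
  refine (foldl_of_add (init := fun _ => (0 : ℕ)) (step := fun _ r _ => r + 1) hl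
    (by fun_prop) (by fun_prop) (PolyBdd.const 2) fun x r a ha => ?_).congr fun x => ?_
  · have := natSize_add_le r 1
    have h1 : Nat.size 1 = 1 := Nat.size_one
    simp only [wt]; omega
  · have : ∀ (m : List α) r, m.foldl (fun r _ => r + 1) r = r + m.length := by
      intro m
      induction m with
      | nil => simp
      | cons a m ih => intro r; simp [ih, add_assoc, add_comm 1]
    simp [this]

theorem wt_rat_zero : wt (0 : ℚ) = 3 := by simp [wt, ratHeight]

@[fun_prop]
theorem ratSum {l : Γ → List ℚ} (hl : PolyTime l) : PolyTime (fun x => (l x).sum) := by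
  refine (foldl_of_add (init := fun _ => (0 : ℚ)) (step := fun _ r a => r + a) hl
    (by fun_prop) (by fun_prop) hl.wt_le fun x r a ha => ?_).congr fun x => ?_
  · have := wt_rat_add_le r a
    have := wt_le_of_mem ha
    omega
  · rw [List.sum_eq_foldl]

@[fun_prop]
theorem ratProd {l : Γ → List ℚ} (hl : PolyTime l) : PolyTime (fun x => (l x).prod) := by
  refine (foldl_of_add (init := fun _ => (1 : ℚ)) (step := fun _ r a => r * a) hl
    (by fun_prop) (by fun_prop) hl.wt_le fun x r a ha => ?_).congr fun x => ?_
  · have := wt_rat_mul_le r a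
    have := wt_le_of_mem ha
    omega
  · rw [List.prod_eq_foldl]

@[fun_prop]
theorem any {l : Γ → List α} {f : Γ → α → Bool} (hl : PolyTime l)
    (hf : PolyTime fun p : Γ × α => f p.1 p.2) : PolyTime (fun x => (l x).any (f x)) := by
  refine (foldl_of_add (init := fun _ => false) (step := fun x r a => r || f x a) hl
    (by fun_prop) ?_ (PolyBdd.const 1) fun x r a ha => ?_).congr fun x => ?_
  · exact bor (by fun_prop) (hf.comp (f := fun p : Γ × Bool × α => (p.1, p.2.2)) (by fun_prop))
  · simp [wt]
  · have : ∀ (m : List α) r, m.foldl (fun r a => r || f x a) r = (r || m.any (f x)) := by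
      intro m
      induction m with
      | nil => simp
      | cons a m ih => intro r; simp [ih, Bool.or_assoc]
    simp [this]

@[fun_prop]
theorem all {l : Γ → List α} {f : Γ → α → Bool} (hl : PolyTime l)
    (hf : PolyTime fun p : Γ × α => f p.1 p.2) : PolyTime (fun x => (l x).all (f x)) := by
  have h := (any (f := fun x a => !f x a) hl (by fun_prop)).bnot
  exact h.congr fun x => by rw [List.not_any_eq_all_not]; simp

@[fun_prop]
theorem natEq {f g : Γ → ℕ} (hf : PolyTime f) (hg : PolyTime g) :
    PolyTime (fun x => decide (f x = g x)) :=
  ((natLe hf hg).band (natLe hg hf)).congr fun x => by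
    rw [Bool.eq_iff_iff]; simp [le_antisymm_iff]

@[fun_prop]
theorem getD {l : Γ → List α} {k : Γ → ℕ} {d : Γ → α} (hl : PolyTime l) (hk : PolyTime k)
    (hd : PolyTime d) : PolyTime (fun x => (l x).getD (k x) (d x)) := by
  refine (snd (foldl_of_add (init := fun x => ((0 : ℕ), d x))
    (step := fun x r a => (r.1 + 1, bif decide (r.1 = k x) then a else r.2)) hl
    (by fun_prop) (by fun_prop) ((PolyBdd.const 2).add hl.wt_le) fun x r a ha => ?_)).congr
    fun x => ?_
  · have h1 := natSize_add_le r.1 1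
    have h2 : Nat.size 1 = 1 := Nat.size_one
    have h3 := wt_le_of_mem ha
    simp only [wt] at h3 ⊢
    cases decide (r.1 = k x) <;> simp only [cond_true, cond_false] <;> omega
  -- The first component of the state counts positions, and the second keeps the default until
  -- position `k x` is reached.
  · have : ∀ (m : List α) (j : ℕ) (r : α), (m.foldl (fun (r : ℕ × α) a =>
        (r.1 + 1, bif decide (r.1 = k x) then a else r.2)) (j, r)).2 =
          if j ≤ k x then m.getD (k x - j) r else r := by
      intro m
      induction m with
      | nil => intro j r; simp
      | cons a m ih =>
        intro j r
        rw [List.foldl_cons, ih]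
        rcases lt_trichotomy j (k x) with h | h | h
        · have h1 : k x - j = (k x - (j + 1)) + 1 := by omega
          simp [h.ne, h.le, h1, Nat.succ_le_of_lt h]
        · simp [h]
        · simp [h.ne', not_le.2 h, not_le.2 (h.trans (Nat.lt_succ_self j))]
    simp [this]

@[fun_prop]
theorem zipIdx {l : Γ → List α} (hl : PolyTime l) : PolyTime (fun x => (l x).zipIdx) := by
  have key : ∀ (m : List α) (r : List (α × ℕ)) (j : ℕ),
      m.foldl (fun (r : List (α × ℕ) × ℕ) a => ((a, r.2) :: r.1, r.2 + 1)) (r, j) =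
        ((m.zipIdx j).reverse ++ r, j + m.length) := by
    intro m
    induction m with
    | nil => intro r j; simp
    | cons a m ih => intro r j; simp [ih, List.zipIdx_cons, add_assoc, add_comm 1]
  refine (reverse (fst (foldl (init := fun _ => (([] : List (α × ℕ)), (0 : ℕ)))
    (step := fun _ r a => ((a, r.2) :: r.1, r.2 + 1)) hl (by fun_prop) (by fun_prop)
    (b := fun x => wt (l x) * (wt (l x) + (wt (l x) + 1) + 2) + (wt (l x) + 3)) ?_
    fun x l' hl' => ?_))).congr fun x => ?_
  · have h := hl.wt_le
    exact (h.mul ((h.add (h.add (PolyBdd.const 1))).add (PolyBdd.const 2))).add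
      (h.add (PolyBdd.const 3))
  · rw [key]
    have h0 := length_le_wt (l x)
    have h2 : wt (l'.zipIdx.reverse) ≤
        l'.zipIdx.reverse.length * (wt (l x) + (wt (l x) + 1) + 1 + 1) + 1 := by
      refine wt_le_of_forall fun a ha => ?_
      obtain ⟨h3, h4, h5⟩ := List.mem_zipIdx (List.mem_reverse.1 ha)
      have h6 : a.1 ∈ l x := hl'.subset (h5 ▸ List.getElem_mem _)
      have h7 := wt_le_of_mem h6
      have h8 := natSize_le_self a.2
      have := hl'.length_le
      simp only [wt] at h7 h0 ⊢
      omega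
    have h3 := natSize_le_self (l'.length)
    have h4 : l'.length ≤ wt (l x) := hl'.length_le.trans h0
    have h5 := h2.trans (Nat.succ_le_succ (Nat.mul_le_mul_right _
      (show l'.zipIdx.reverse.length ≤ wt (l x) by simpa using h4)))
    show wt (l'.zipIdx.reverse ++ []) + wt (0 + l'.length) + 1 ≤ _
    rw [List.append_nil, zero_add]
    have h6 : wt l'.length = Nat.size l'.length + 1 := rfl
    have e : ∀ w, w * (w + (w + 1) + 1 + 1) = w * (w + (w + 1) + 2) := fun w => by ring
    rw [e] at h5
    omega
  · simp [key]

end PolyTime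

/-! ### Maximizers and tuples. -/

/-- A member of a list with the largest value of `key`. -/
def best {α : Type} (key : α → ℚ) (l : List α) : Option α :=
  l.foldl (fun r y => r.elim (some y) fun z => bif decide (key z ≤ key y) then some y else some z)
    none

/-- The initial state is arbitrary so that the induction can pass through the fold; it competes with
the elements of the list. -/
theorem best_spec_aux {α : Type} (key : α → ℚ) (l : List α) (r : Option α) :
    (l.foldl (fun r y => r.elim (some y) fun z =>
      bif decide (key z ≤ key y) then some y else some z) r).elim (r = none ∧ l = []) fun y =>
        (y ∈ l ∨ r = some y) ∧ (∀ z ∈ l, key z ≤ key y) ∧ ∀ z, r = some z → key z ≤ key y := by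
  induction l generalizing r with
  | nil => cases r <;> simp
  | cons a l ih =>
    rw [List.foldl_cons]
    have := ih (r.elim (some a) fun z => bif decide (key z ≤ key a) then some a else some z)
    generalize (l.foldl _ _ : Option α) = o at *
    cases o with
    | none =>
      exfalso
      rcases r with _ | z
      · simp at this
      · by_cases h : key z ≤ key a <;> simp [h] at this
    | some y =>
      rcases r with _ | z
      · simp only [Option.elim] at this ⊢
        obtain ⟨h1, h2, h3⟩ := this
        have h4 := h3 a rfl
        simp only [List.mem_cons, forall_eq_or_imp]
        simp only [Option.some.injEq] at h1
        refine ⟨?_, ⟨h4, h2⟩, by simp⟩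
        rcases h1 with h1 | h1
        · exact .inl (.inr h1)
        · exact .inl (.inl h1.symm)
      · by_cases h : key z ≤ key a
        · simp only [Option.elim, h, decide_true, cond_true, Option.some.injEq] at this ⊢
          obtain ⟨h1, h2, h3⟩ := this
          have h4 := h3 a rfl
          simp only [List.mem_cons, forall_eq_or_imp]
          refine ⟨?_, ⟨h4, h2⟩, fun w hw => hw ▸ h.trans h4⟩
          rcases h1 with h1 | h1
          · exact .inl (.inr h1)
          · exact .inl (.inl h1.symm)
        · simp only [Option.elim, h, decide_false, cond_false, Option.some.injEq] at this ⊢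
          obtain ⟨h1, h2, h3⟩ := this
          have h4 := h3 z rfl
          simp only [List.mem_cons, forall_eq_or_imp]
          refine ⟨?_, ⟨(not_le.1 h).le.trans h4, h2⟩, fun w hw => hw ▸ h4⟩
          rcases h1 with h1 | h1
          · exact .inl (.inr h1)
          · exact .inr h1

theorem best_eq_none {α : Type} {key : α → ℚ} {l : List α} (h : best key l = none) : l = [] := by
  have := best_spec_aux key l none
  rw [best] at h
  rw [h] at this
  exact this.2

theorem best_eq_some {α : Type} {key : α → ℚ} {l : List α} {y : α} (h : best key l = some y) :
    y ∈ l ∧ ∀ z ∈ l, key z ≤ key y := by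
  have := best_spec_aux key l none
  rw [best] at h
  rw [h] at this
  exact ⟨this.1.resolve_right (by simp), this.2.1⟩

/-- All tuples of length `k` with entries in `l`. -/
def tuples {α : Type} (l : List α) (k : ℕ) : List (List α) :=
  (List.range k).foldl (fun r _ => r.flatMap fun t => l.map fun a => a :: t) [[]]

theorem tuples_succ {α : Type} (l : List α) (k : ℕ) :
    tuples l (k + 1) = (tuples l k).flatMap fun t => l.map fun a => a :: t := by
  simp [tuples, List.range_succ]

theorem mem_tuples {α : Type} {l : List α} {k : ℕ} {t : List α} :
    t ∈ tuples l k ↔ t.length = k ∧ ∀ a ∈ t, a ∈ l := by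
  induction k generalizing t with
  | zero =>
    simp only [tuples, List.range_zero, List.foldl_nil, List.mem_singleton, List.length_eq_zero_iff]
    exact ⟨fun h => ⟨h, by simp [h]⟩, fun h => h.1⟩
  | succ k ih =>
    rw [tuples_succ]
    simp only [List.mem_flatMap, ih, List.mem_map]
    constructor
    · rintro ⟨s, ⟨h1, h2⟩, a, ha, rfl⟩
      simpa [h1] using ⟨ha, h2⟩
    · rintro ⟨h1, h2⟩
      rcases t with _ | ⟨a, t⟩
      · simp at h1
      · simp only [List.mem_cons, forall_eq_or_imp] at h2
        exact ⟨t, ⟨by simpa using h1, h2.2⟩, a, h2.1, rfl⟩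

theorem length_tuples {α : Type} (l : List α) (k : ℕ) : (tuples l k).length = l.length ^ k := by
  induction k with
  | zero => simp [tuples]
  | succ k ih => rw [tuples_succ]; simp [List.length_flatMap, ih, pow_succ]

theorem wt_tuples_le {α : Type} [Data α] (l : List α) (k : ℕ) :
    wt (tuples l k) ≤ l.length ^ k * (k * (wt l + 1) + 2) + 1 := by
  rw [← length_tuples]
  refine wt_le_of_forall fun t ht => ?_
  obtain ⟨h1, h2⟩ := mem_tuples.1 ht
  have := wt_le_of_forall (l := t) (b := wt l) fun a ha =>
    (Nat.le_succ _).trans (wt_le_of_mem (h2 a ha))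
  rwa [h1] at this

namespace PolyTime

variable {Γ Δ α β γ ρ : Type} [Data Γ] [Data Δ] [Data α] [Data β] [Data γ] [Data ρ]

@[fun_prop]
theorem best {l : Γ → List α} {key : Γ → α → ℚ} (hl : PolyTime l)
    (hk : PolyTime fun p : Γ × α => key p.1 p.2) : PolyTime (fun x => best (key x) (l x)) := by
  have h1 : PolyTime fun p : (Γ × Option α × α) × α => key p.1.1 p.2 :=
    hk.comp (f := fun p : (Γ × Option α × α) × α => (p.1.1, p.2)) (by fun_prop)
  have h2 : PolyTime fun p : (Γ × Option α × α) × α => key p.1.1 p.1.2.2 :=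
    hk.comp (f := fun p : (Γ × Option α × α) × α => (p.1.1, p.1.2.2)) (by fun_prop)
  refine foldl_of_add hl (by fun_prop) ?_ hl.wt_le fun x r a ha => ?_
  · exact option_elim (by fun_prop) (by fun_prop) ((h1.ratLe h2).cond (by fun_prop) (by fun_prop))
  · have h3 := wt_le_of_mem ha
    rcases r with _ | z
    · simp only [wt, Option.elim] at h3 ⊢; omega
    · simp only [Option.elim]
      cases decide (key x z ≤ key x a) <;> simp only [wt, cond_true, cond_false] at h3 ⊢ <;> omega

/-- The output is exponential in `k`, so its length bound has to be supplied as the hypothesis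
`hb'`; this is the only source of super-polynomial growth in `M`. -/
theorem tuples {l : Γ → List α} {k : Γ → ℕ} (hl : PolyTime l) (hk : PolyTime k)
    (hb : PolyBdd k) (hb' : PolyBdd fun x => ((l x).length + 1) ^ k x) :
    PolyTime (fun x => tuples (l x) (k x)) := by
  refine foldl (hk.range hb) (by fun_prop) ?_ (b := fun x =>
    ((l x).length + 1) ^ k x * (k x * (wt (l x) + 1) + 2) + 1) ?_ fun x l' hl' => ?_
  · fun_prop
  · exact (hb'.mul ((hb.mul (hl.wt_le.add (PolyBdd.const 1))).add (PolyBdd.const 2))).add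
      (PolyBdd.const 1)
  -- Prefixes of a range are ranges, so each intermediate state of the fold is the list of tuples of
  -- some length `j ≤ k x`.
  · obtain ⟨j, hj, rfl⟩ : ∃ j ≤ k x, l' = List.range j := by
      rw [List.prefix_iff_eq_take] at hl'
      refine ⟨l'.length, ?_, ?_⟩
      · rw [hl']; simp
      · nth_rw 1 [hl']
        rw [List.take_range, min_eq_left]
        rw [hl']; simp
    refine (wt_tuples_le (l x) j).trans ?_
    have h1 : (l x).length ^ j ≤ ((l x).length + 1) ^ k x :=
      (Nat.pow_le_pow_left (Nat.le_succ _) j).trans (Nat.pow_le_pow_right (by omega) hj)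
    gcongr

theorem replicate {f : Γ → α} {k : Γ → ℕ} (hf : PolyTime f) (hk : PolyTime k) (hb : PolyBdd k) :
    PolyTime (fun x => List.replicate (k x) (f x)) := by
  have h := hk.range hb
  have := map (f := fun x _ => f x) h (by fun_prop)
  exact this.congr fun x => by simp [List.map_const']

end PolyTime

/-! ### Encodings of masses, pieces and perturbed utilities -/

instance : Data (WithBot ℚ) := inferInstanceAs (Data (Option ℚ))

instance {α β : Type} [Data α] [Data β] : Data (α ×ₗ β) := Data.induced fun x => ofLex x

instance : Data Mass := Data.induced fun x => (x.action, x.config, x.agent, x.principal, x.prob)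

instance : Data Piece := Data.induced fun x => (x.action, x.config, x.agent, x.principal, x.prob)

namespace PolyTime

variable {Γ α β : Type} [Data Γ] [Data α] [Data β]

@[fun_prop]
theorem lex_fst {f : Γ → α ×ₗ β} (hf : PolyTime f) : PolyTime fun x => (ofLex (f x)).1 :=
  fst ⟨hf.exists_prog, hf.wt_le⟩

@[fun_prop]
theorem lex_snd {f : Γ → α ×ₗ β} (hf : PolyTime f) : PolyTime fun x => (ofLex (f x)).2 :=
  snd ⟨hf.exists_prog, hf.wt_le⟩

@[fun_prop]
theorem toLex_mk {f : Γ → α} {g : Γ → β} (hf : PolyTime f) (hg : PolyTime g) :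
    PolyTime fun x => (toLex (f x, g x) : α ×ₗ β) :=
  ⟨(hf.prodMk hg).exists_prog, (hf.prodMk hg).wt_le⟩

theorem mass_tuple {f : Γ → Mass} (hf : PolyTime f) : PolyTime fun x =>
    ((f x).action, (f x).config, (f x).agent, (f x).principal, (f x).prob) :=
  ⟨hf.exists_prog, hf.wt_le⟩

@[fun_prop]
theorem mass_action {f : Γ → Mass} (hf : PolyTime f) : PolyTime fun x => (f x).action :=
  hf.mass_tuple.fst

@[fun_prop]
theorem mass_config {f : Γ → Mass} (hf : PolyTime f) : PolyTime fun x => (f x).config :=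
  hf.mass_tuple.snd.fst

@[fun_prop]
theorem mass_agent {f : Γ → Mass} (hf : PolyTime f) : PolyTime fun x => (f x).agent :=
  hf.mass_tuple.snd.snd.fst

@[fun_prop]
theorem mass_principal {f : Γ → Mass} (hf : PolyTime f) : PolyTime fun x => (f x).principal :=
  hf.mass_tuple.snd.snd.snd.fst

@[fun_prop]
theorem mass_prob {f : Γ → Mass} (hf : PolyTime f) : PolyTime fun x => (f x).prob :=
  hf.mass_tuple.snd.snd.snd.snd

@[fun_prop]
theorem mass_mk {a c : Γ → ℕ} {u : Γ → WithBot ℚ} {v p : Γ → ℚ} (ha : PolyTime a)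
    (hc : PolyTime c) (hu : PolyTime u) (hv : PolyTime v) (hp : PolyTime p) :
    PolyTime fun x => Mass.mk (a x) (c x) (u x) (v x) (p x) :=
  have h := ha.prodMk (hc.prodMk (hu.prodMk (hv.prodMk hp)))
  ⟨h.exists_prog, h.wt_le⟩

theorem piece_tuple {f : Γ → Piece} (hf : PolyTime f) : PolyTime fun x =>
    ((f x).action, (f x).config, (f x).agent, (f x).principal, (f x).prob) :=
  ⟨hf.exists_prog, hf.wt_le⟩

@[fun_prop]
theorem piece_action {f : Γ → Piece} (hf : PolyTime f) : PolyTime fun x => (f x).action :=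
  hf.piece_tuple.fst

@[fun_prop]
theorem piece_config {f : Γ → Piece} (hf : PolyTime f) : PolyTime fun x => (f x).config :=
  hf.piece_tuple.snd.fst

@[fun_prop]
theorem piece_agent {f : Γ → Piece} (hf : PolyTime f) : PolyTime fun x => (f x).agent :=
  hf.piece_tuple.snd.snd.fst

@[fun_prop]
theorem piece_principal {f : Γ → Piece} (hf : PolyTime f) : PolyTime fun x => (f x).principal :=
  hf.piece_tuple.snd.snd.snd.fst

@[fun_prop]
theorem piece_prob {f : Γ → Piece} (hf : PolyTime f) : PolyTime fun x => (f x).prob :=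
  hf.piece_tuple.snd.snd.snd.snd

@[fun_prop]
theorem piece_mk {a c : Γ → ℕ} {u : Γ → PUtil} {v p : Γ → ℚ} (ha : PolyTime a)
    (hc : PolyTime c) (hu : PolyTime u) (hv : PolyTime v) (hp : PolyTime p) :
    PolyTime fun x => Piece.mk (a x) (c x) (u x) (v x) (p x) :=
  have h := ha.prodMk (hc.prodMk (hu.prodMk (hv.prodMk hp)))
  ⟨h.exists_prog, h.wt_le⟩

@[fun_prop]
theorem agentUtil {f : Γ → Option ℚ} (hf : PolyTime f) : PolyTime fun x => agentUtil (f x) := by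
  have h : PolyTime fun x => (f x : WithBot ℚ) := ⟨hf.exists_prog, hf.wt_le⟩
  exact h.congr fun x => by cases f x <;> rfl

end PolyTime

/-- Instances of utility configuration as nested lists. -/
abbrev RawUC : Type := List (List (List ((Option ℚ × ℚ) × ℚ)))

/-! ### The program: preprocessing -/

namespace Impl

def botLe (a b : WithBot ℚ) : Bool :=
  Option.elim (a : Option ℚ) true fun p => Option.elim (b : Option ℚ) false fun q => decide (p ≤ q)

theorem botLe_iff (a b : WithBot ℚ) : botLe a b = true ↔ a ≤ b := by
  cases a using WithBot.recBotCoe with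
  | bot => simp [botLe]; rfl
  | coe p =>
    cases b using WithBot.recBotCoe with
    | bot =>
      simp only [le_bot_iff, WithBot.coe_ne_bot, iff_false]
      exact Bool.false_ne_true
    | coe q =>
      rw [WithBot.coe_le_coe]
      exact decide_eq_true_iff

def utilLe (a b : PUtil) : Bool :=
  !botLe (ofLex b).1 (ofLex a).1 || (botLe (ofLex a).1 (ofLex b).1 &&
    decide ((ofLex a).2 ≤ (ofLex b).2))

theorem utilLe_iff (a b : PUtil) : utilLe a b = true ↔ a ≤ b := by
  have h := botLe_iff (ofLex b).1 (ofLex a).1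
  have h' := botLe_iff (ofLex a).1 (ofLex b).1
  rw [Prod.Lex.le_iff]
  simp only [utilLe, Bool.or_eq_true, Bool.not_eq_true', Bool.and_eq_true, decide_eq_true_eq, h',
    ← Bool.not_eq_true, h, not_le]
  constructor
  · rintro (h1 | ⟨h1, h2⟩)
    · exact .inl h1
    · rcases h1.lt_or_eq with h3 | h3
      · exact .inl h3
      · exact .inr ⟨h3, h2⟩
  · rintro (h1 | ⟨h1, h2⟩)
    · exact .inl h1
    · exact .inr ⟨h1.le, h2⟩

def masses (I : RawUC) : List Mass :=
  I.zipIdx.flatMap fun A => A.1.zipIdx.flatMap fun D =>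
    D.1.map fun x => ⟨A.2, D.2, agentUtil x.1.1, x.1.2, x.2⟩

def sortMasses (L : List Mass) : List Mass :=
  L.foldl (fun r a => r.filter (fun b => !decide (a.principal ≤ b.principal)) ++
    a :: r.filter fun b => decide (a.principal ≤ b.principal)) []

theorem sortMasses_aux (L r : List Mass) (hr : r.Pairwise fun x y => x.principal ≤ y.principal) :
    (L.foldl (fun r a => r.filter (fun b => !decide (a.principal ≤ b.principal)) ++
      a :: r.filter fun b => decide (a.principal ≤ b.principal)) r).Perm (L ++ r) ∧
    (L.foldl (fun r a => r.filter (fun b => !decide (a.principal ≤ b.principal)) ++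
      a :: r.filter fun b => decide (a.principal ≤ b.principal)) r).Pairwise
        fun x y => x.principal ≤ y.principal := by
  induction L generalizing r with
  | nil => exact ⟨.refl _, hr⟩
  | cons a L ih =>
    rw [List.foldl_cons]
    have hp : (r.filter (fun b => !decide (a.principal ≤ b.principal)) ++
        a :: r.filter fun b => decide (a.principal ≤ b.principal)).Perm (a :: r) :=
      List.perm_middle.trans (List.Perm.cons a
        (List.perm_append_comm.trans (List.filter_append_perm _ r)))
    have hs := ih (r.filter (fun b => !decide (a.principal ≤ b.principal)) ++
        a :: r.filter fun b => decide (a.principal ≤ b.principal)) (by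
      rw [List.pairwise_append, List.pairwise_cons]
      refine ⟨hr.sublist List.filter_sublist, ⟨fun b hb => by simpa using (List.mem_filter.1 hb).2,
        hr.sublist List.filter_sublist⟩, fun b hb c hc => ?_⟩
      have h1 : b.principal < a.principal := by simpa using (List.mem_filter.1 hb).2
      rcases List.mem_cons.1 hc with rfl | hc
      · exact h1.le
      · have h2 : a.principal ≤ c.principal := by simpa using (List.mem_filter.1 hc).2
        exact h1.le.trans h2)
    exact ⟨hs.1.trans (((List.Perm.append_left L hp)).trans List.perm_middle), hs.2⟩

theorem sortMasses_perm (L : List Mass) : (sortMasses L).Perm L := by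
  have := (sortMasses_aux L [] .nil).1
  rwa [List.append_nil] at this

theorem sortMasses_sorted (L : List Mass) :
    (sortMasses L).Pairwise fun x y => x.principal ≤ y.principal :=
  (sortMasses_aux L [] .nil).2

/-- The number of copies is capped at `M * M`. The program must be polynomial on all inputs, also on
those with probabilities above `1`; for probabilities at most `1` the cap is never reached. -/
def split (M : ℕ) (x : Mass) : List Mass :=
  List.replicate (bif decide (⌊x.prob * ((M : ℚ) * M)⌋₊ ≤ M * M) then ⌊x.prob * ((M : ℚ) * M)⌋₊
      else M * M) ⟨x.action, x.config, x.agent, x.principal, 1 / ((M : ℚ) * M)⟩ ++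
    [⟨x.action, x.config, x.agent, x.principal,
      x.prob - (⌊x.prob * ((M : ℚ) * M)⌋₊ : ℚ) / ((M : ℚ) * M)⟩]

def pieces (M : ℕ) (L : List Mass) : List Piece :=
  (L.flatMap (split M)).zipIdx.map fun x =>
    ⟨x.1.action, x.1.config, toLex (x.1.agent, x.2), x.1.principal, x.1.prob⟩

theorem pieces_eq {M : ℕ} {L : List Mass} (hL : ∀ x ∈ L, x.prob ≤ 1) :
    pieces M L = _root_.pieces M L := by
  have : ∀ x ∈ L, split M x = x.split M := by
    intro x hx
    have h : ⌊x.prob * ((M : ℚ) * M)⌋₊ ≤ M * M := by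
      refine Nat.floor_le_of_le ?_
      push_cast
      exact mul_le_of_le_one_left (by positivity) (hL x hx)
    simp only [split, Mass.split, h, decide_true, cond_true, pow_two]
  simp only [pieces, _root_.pieces, List.flatMap_congr this]

/-! ### The program: estimates

`R` and `N` stand for the lists `0, …, M - 1` and `0, …, n - 1`. -/

def inBin (R : List ℕ) (M : ℕ) (g : List PUtil) (j : ℕ) (u : PUtil) : Bool :=
  (R.all fun k => !decide (k + 1 = j) || utilLe (g.getD k (toLex (⊥, 0))) u) &&
    (!utilLe (g.getD j (toLex (⊥, 0))) u || (decide (j + 1 = M) &&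
      (utilLe u (g.getD j (toLex (⊥, 0))) && utilLe (g.getD j (toLex (⊥, 0))) u)))

def inBinLe (R : List ℕ) (M : ℕ) (g : List PUtil) (j : ℕ) (u : PUtil) : Bool :=
  R.any fun k => decide (k ≤ j) && inBin R M g k u

def law (T : List Piece) (i c : ℕ) : List Piece :=
  T.filter fun x => decide (x.action = i) && decide (x.config = c)

def cumProb (R : List ℕ) (M : ℕ) (T : List Piece) (g : List PUtil) (i c j : ℕ) : ℚ :=
  ((law T i c).map fun x => bif inBinLe R M g j x.agent then x.prob else 0).sum

def condBinProb (R : List ℕ) (M : ℕ) (T : List Piece) (g : List PUtil) (i c j : ℕ) : ℚ :=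
  ((law T i c).map fun x => bif inBin R M g j x.agent then x.prob else 0).sum /
    cumProb R M T g i c j

def condBinUtil (R : List ℕ) (M : ℕ) (T : List Piece) (g : List PUtil) (i c j : ℕ) : ℚ :=
  ((law T i c).map fun x => bif inBin R M g j x.agent then x.principal * x.prob else 0).sum /
    cumProb R M T g i c j

/-- The rounded bin probabilities, as multiples of `1 / (M ^ 2 * n)`. -/
def roundVec (R : List ℕ) (M n : ℕ) (T : List Piece) (g : List PUtil) (i c : ℕ) : List ℕ :=
  R.map fun j => ⌊condBinProb R M T g i c j * ((M : ℚ) * M * n)⌋₊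

def score (R : List ℕ) (M : ℕ) (T : List Piece) (g : List PUtil) (i c : ℕ) : ℚ :=
  (R.map fun j : ℕ => bif decide (6 ≤ j + 1) then
    ((j : ℚ) + 1 - 5) / ((M : ℚ) - 1) * condBinUtil R M T g i c j else 0).sum

/-- The configurations of each action with their rounded probabilities and scores. -/
def options (R : List ℕ) (M : ℕ) (T : List Piece) (I : RawUC) (g : List PUtil) :
    List (List (ℕ × List ℕ × ℚ)) :=
  I.zipIdx.map fun A =>
    (A.1.zipIdx.filter fun D => R.all fun j => !decide (cumProb R M T g A.2 D.2 j ≤ 0)).map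
      fun D => (D.2, roundVec R M I.length T g A.2 D.2, score R M T g A.2 D.2)

/-! ### The program: dynamic programming -/

/-- An entry consists of the vector of summed rounded probabilities, the summed score, and the
choices made so far. -/
def extend (R : List ℕ) (S : List (List ℕ × ℚ × List ℕ)) (os : List (ℕ × List ℕ × ℚ)) :
    List (List ℕ × ℚ × List ℕ) :=
  S.flatMap fun e => os.map fun o =>
    (R.map fun j => e.1.getD j 0 + o.2.1.getD j 0, e.2.1 + o.2.2, e.2.2 ++ [o.1])

/-- One step of the dynamic program: for each vector of the grid, keep a best partial choice. -/
def dpStep (R : List ℕ) (grid : List (List ℕ)) (S : List (List ℕ × ℚ × List ℕ))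
    (os : List (ℕ × List ℕ × ℚ)) : List (List ℕ × ℚ × List ℕ) :=
  grid.filterMap fun t => (best (fun e => e.2.1) ((extend R S os).filter fun e =>
    R.all fun j => decide (e.1.getD j 0 = t.getD j 0))).elim none fun e => some (t, e.2)

/-- In the initial entry the empty list stands for the zero vector, by the default value `0` of
`getD`. -/
def dp (R : List ℕ) (grid : List (List ℕ)) (os : List (List (ℕ × List ℕ × ℚ))) :
    List (List ℕ × ℚ × List ℕ) :=
  os.foldl (dpStep R grid) [([], 0, [])]

def vecOk (R : List ℕ) (M n : ℕ) (v : List ℕ) : Bool :=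
  R.all fun j =>
    decide ((1 - 1 / (M : ℚ)) / ((j : ℚ) + 1) - 1 / ((M : ℚ) * M) ≤
      (v.getD j 0 : ℚ) / ((M : ℚ) * M * n)) &&
    (!decide (0 < j) || decide ((v.getD j 0 : ℚ) / ((M : ℚ) * M * n) ≤
      (1 + 1 / (M : ℚ)) / (j : ℚ)))

/-- The inner optimization. -/
def inner (R : List ℕ) (grid : List (List ℕ)) (M : ℕ) (T : List Piece) (I : RawUC)
    (g : List PUtil) : Option (List ℕ) :=
  (best (fun e => e.2.1) ((dp R grid (options R M T I g)).filter fun e =>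
    vecOk R M I.length e.1)).elim none fun e => some e.2.2

/-! ### The program: exact values, and the outer loop -/

def probLt (T : List Piece) (i c : ℕ) (u : PUtil) : ℚ :=
  ((law T i c).map fun y => bif !utilLe u y.agent then y.prob else 0).sum

/-- Perturbed utilities have no ties between actions, so the exact value is a sum over pieces of
their probability of being the strict maximum: a product of one factor per action instead of a sum
over all joint outcomes. -/
def value (N : List ℕ) (T : List Piece) (ch : List ℕ) : ℚ :=
  ((T.filter fun x => decide (x.config = ch.getD x.action 0)).map fun x =>
    x.prob * x.principal * (N.map fun k => bif decide (k = x.action) then 1 else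
      probLt T k (ch.getD k 0) x.agent).prod).sum

def isMono (R : List ℕ) (g : List PUtil) : Bool :=
  R.all fun j => R.all fun k => !decide (j ≤ k) ||
    utilLe (g.getD j (toLex (⊥, 0))) (g.getD k (toLex (⊥, 0)))

def outer (R N : List ℕ) (grid : List (List ℕ)) (M : ℕ) (T : List Piece) (I : RawUC)
    (gs : List (List PUtil)) : List ℕ :=
  (best (value N T) ((gs.filter (isMono R)).filterMap (inner R grid M T I))).elim
    (I.map fun _ => 0) fun ch => ch

/-- In units of `1/(M²n)` each rounded probability is at most `M²n`, hence each coordinate of the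
sum over `n` actions is at most `M²n²`; this fixes the grid. -/
def main (M : ℕ) (I : RawUC) : List ℕ :=
  outer (List.range M) (List.range I.length)
    (tuples (List.range (M * M * I.length * I.length + 1)) M) M
    (pieces M (sortMasses (masses I))) I
    (tuples ((pieces M (sortMasses (masses I))).map Piece.agent) M)

end Impl

/-! ### The program runs in polynomial time -/

namespace PolyTime

variable {Γ α β : Type} [Data Γ] [Data α] [Data β]

@[fun_prop]
theorem botLe {f g : Γ → WithBot ℚ} (hf : PolyTime f) (hg : PolyTime g) :
    PolyTime fun x => Impl.botLe (f x) (g x) := by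
  have hf' : PolyTime (α := Option ℚ) fun x => f x := hf
  have hg' : PolyTime (α := Option ℚ) fun x => g x := hg
  exact option_elim hf' (const true) (option_elim (hg'.comp fst') (const false)
    (ratLe (Γ := (Γ × ℚ) × ℚ) (snd fst') snd'))

@[fun_prop]
theorem utilLe {f g : Γ → PUtil} (hf : PolyTime f) (hg : PolyTime g) :
    PolyTime fun x => Impl.utilLe (f x) (g x) := by
  unfold Impl.utilLe; fun_prop

@[fun_prop]
theorem masses {I : Γ → RawUC} (hI : PolyTime I) : PolyTime fun x => Impl.masses (I x) := by
  unfold Impl.masses; fun_prop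

/-- Each state of the insertion sort is a permutation of a prefix of the input, so it is never
heavier than the input. -/
theorem sortMasses {L : Γ → List Mass} (hL : PolyTime L) :
    PolyTime fun x => Impl.sortMasses (L x) := by
  refine foldl hL (by fun_prop) (by fun_prop) hL.wt_le fun x l' hl' => ?_
  exact (wt_perm (Impl.sortMasses_perm l')).le.trans (wt_sublist hl'.sublist)

theorem pieces {M : Γ → ℕ} {L : Γ → List Mass} (hM : PolyTime M) (hb : PolyBdd M)
    (hL : PolyTime L) : PolyTime fun x => Impl.pieces (M x) (L x) := by
  have h : PolyTime fun p : Γ × Mass => Impl.split (M p.1) p.2 := by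
    refine append (replicate (by fun_prop) (by fun_prop) ?_) (by fun_prop)
    have h1 : PolyBdd fun p : Γ × Mass => M p.1 := hb.comp (fst'.wt_le)
    refine (h1.mul h1).mono fun p => ?_
    by_cases h : ⌊p.2.prob * ((M p.1 : ℚ) * M p.1)⌋₊ ≤ M p.1 * M p.1 <;> simp [h]
  unfold Impl.pieces
  fun_prop

variable {R N : Γ → List ℕ} {M n i c j : Γ → ℕ} {T : Γ → List Piece} {g : Γ → List PUtil}
  {u : Γ → PUtil} {I : Γ → RawUC} {S : Γ → List (List ℕ × ℚ × List ℕ)}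
  {o : Γ → List (ℕ × List ℕ × ℚ)} {os : Γ → List (List (ℕ × List ℕ × ℚ))}
  {grid : Γ → List (List ℕ)} {v : Γ → List ℕ} {gs : Γ → List (List PUtil)}

@[fun_prop]
theorem inBin (hR : PolyTime R) (hM : PolyTime M) (hg : PolyTime g) (hj : PolyTime j)
    (hu : PolyTime u) : PolyTime fun x => Impl.inBin (R x) (M x) (g x) (j x) (u x) := by
  unfold Impl.inBin; fun_prop

@[fun_prop]
theorem inBinLe (hR : PolyTime R) (hM : PolyTime M) (hg : PolyTime g) (hj : PolyTime j)
    (hu : PolyTime u) : PolyTime fun x => Impl.inBinLe (R x) (M x) (g x) (j x) (u x) := by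
  unfold Impl.inBinLe; fun_prop

@[fun_prop]
theorem law (hT : PolyTime T) (hi : PolyTime i) (hc : PolyTime c) :
    PolyTime fun x => Impl.law (T x) (i x) (c x) := by
  unfold Impl.law; fun_prop

@[fun_prop]
theorem cumProb (hR : PolyTime R) (hM : PolyTime M) (hT : PolyTime T) (hg : PolyTime g)
    (hi : PolyTime i) (hc : PolyTime c) (hj : PolyTime j) :
    PolyTime fun x => Impl.cumProb (R x) (M x) (T x) (g x) (i x) (c x) (j x) := by
  unfold Impl.cumProb; fun_prop

@[fun_prop]
theorem condBinProb (hR : PolyTime R) (hM : PolyTime M) (hT : PolyTime T) (hg : PolyTime g)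
    (hi : PolyTime i) (hc : PolyTime c) (hj : PolyTime j) :
    PolyTime fun x => Impl.condBinProb (R x) (M x) (T x) (g x) (i x) (c x) (j x) := by
  unfold Impl.condBinProb; fun_prop

@[fun_prop]
theorem condBinUtil (hR : PolyTime R) (hM : PolyTime M) (hT : PolyTime T) (hg : PolyTime g)
    (hi : PolyTime i) (hc : PolyTime c) (hj : PolyTime j) :
    PolyTime fun x => Impl.condBinUtil (R x) (M x) (T x) (g x) (i x) (c x) (j x) := by
  unfold Impl.condBinUtil; fun_prop

@[fun_prop]
theorem roundVec (hR : PolyTime R) (hM : PolyTime M) (hn : PolyTime n) (hT : PolyTime T)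
    (hg : PolyTime g) (hi : PolyTime i) (hc : PolyTime c) :
    PolyTime fun x => Impl.roundVec (R x) (M x) (n x) (T x) (g x) (i x) (c x) := by
  unfold Impl.roundVec; fun_prop

@[fun_prop]
theorem score (hR : PolyTime R) (hM : PolyTime M) (hT : PolyTime T)
    (hg : PolyTime g) (hi : PolyTime i) (hc : PolyTime c) :
    PolyTime fun x => Impl.score (R x) (M x) (T x) (g x) (i x) (c x) := by
  unfold Impl.score; fun_prop

@[fun_prop]
theorem options (hR : PolyTime R) (hM : PolyTime M) (hT : PolyTime T) (hI : PolyTime I)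
    (hg : PolyTime g) : PolyTime fun x => Impl.options (R x) (M x) (T x) (I x) (g x) := by
  unfold Impl.options; fun_prop

@[fun_prop]
theorem dpStep (hR : PolyTime R) (hgrid : PolyTime grid) (hS : PolyTime S) (ho : PolyTime o) :
    PolyTime fun x => Impl.dpStep (R x) (grid x) (S x) (o x) := by
  unfold Impl.dpStep Impl.extend; fun_prop

/-- Vectors are replaced by grid points, so they cannot grow; score and choice list grow by at most
the weight of one option in each step, which the weight of `os` pays for. -/
theorem wt_dp_le (R : List ℕ) (grid : List (List ℕ)) (os : List (List (ℕ × List ℕ × ℚ))) :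
    ∀ e ∈ Impl.dp R grid os, wt e.1 ≤ wt grid ∧ wt e.2 ≤ wt os + 4 := by
  induction os using List.reverseRecOn with
  | nil =>
    intro e he
    obtain rfl := List.mem_singleton.1 he
    refine ⟨Nat.succ_le_succ (Nat.zero_le _), ?_⟩
    show wt (0 : ℚ) + 1 + 1 ≤ _
    rw [wt_rat_zero]
    exact Nat.le_add_left _ _
  | append_singleton os o ih =>
    intro e he
    rw [Impl.dp, List.foldl_append, List.foldl_cons, List.foldl_nil] at he
    obtain ⟨t, ht, he⟩ := List.mem_filterMap.1 he
    rcases hb : _root_.best (fun e : List ℕ × ℚ × List ℕ => e.2.1)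
      ((Impl.extend R (os.foldl (Impl.dpStep R grid) [([], 0, [])]) o).filter fun e =>
        R.all fun j => decide (e.1.getD j 0 = t.getD j 0)) with _ | f
    · rw [hb] at he; simp at he
    · rw [hb] at he
      obtain rfl := Option.some.inj he
      have hf := (List.mem_filter.1 (best_eq_some hb).1).1
      obtain ⟨e', he', hf⟩ := List.mem_flatMap.1 hf
      obtain ⟨p, hp, rfl⟩ := List.mem_map.1 hf
      have h1 := (ih e' he').2
      have h2 := wt_le_of_mem hp
      have h3 := wt_le_of_mem ht
      have h4 := wt_rat_add_le e'.2.1 p.2.2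
      have h5 := wt_append e'.2.2 [p.1]
      have h6 := wt_append os [o]
      have h7 : wt [o] = wt o + 1 + 0 + 1 := rfl
      have h8 : wt [p.1] = wt p.1 + 1 + 0 + 1 := rfl
      have h9 : wt p = wt p.1 + (wt p.2.1 + wt p.2.2 + 1) + 1 := rfl
      have h10 : wt e'.2 = wt e'.2.1 + wt e'.2.2 + 1 := rfl
      have h11 : wt (e'.2.1 + p.2.2, e'.2.2 ++ [p.1]) =
        wt (e'.2.1 + p.2.2) + wt (e'.2.2 ++ [p.1]) + 1 := rfl
      refine ⟨show wt t ≤ wt grid by omega, ?_⟩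
      show wt (e'.2.1 + p.2.2, e'.2.2 ++ [p.1]) ≤ _
      omega

theorem length_dp_le (R : List ℕ) (grid : List (List ℕ)) (os : List (List (ℕ × List ℕ × ℚ))) :
    (Impl.dp R grid os).length ≤ wt grid + 1 := by
  induction os using List.reverseRecOn with
  | nil => simp [Impl.dp]
  | append_singleton os o ih =>
    rw [Impl.dp, List.foldl_append, List.foldl_cons, List.foldl_nil]
    exact (List.length_filterMap_le _ _).trans ((length_le_wt _).trans (Nat.le_succ _))

@[fun_prop]
theorem dp (hR : PolyTime R) (hgrid : PolyTime grid) (ho : PolyTime os) :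
    PolyTime fun x => Impl.dp (R x) (grid x) (os x) := by
  refine foldl ho (by fun_prop) (by fun_prop) (b := fun x =>
    (wt (grid x) + 1) * (wt (grid x) + wt (os x) + 6) + 1) ?_ fun x l' hl' => ?_
  · have h1 := hgrid.wt_le
    exact ((h1.add (.const 1)).mul ((h1.add ho.wt_le).add (.const 6))).add (.const 1)
  · have h := wt_le_of_forall (l := Impl.dp (R x) (grid x) l')
      (b := wt (grid x) + (wt (os x) + 4) + 1) fun e he => by
        have h1 := wt_dp_le _ _ _ e he
        have h2 := wt_sublist hl'.sublist
        have h3 : wt e = wt e.1 + wt e.2 + 1 := rfl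
        omega
    refine h.trans ?_
    exact Nat.succ_le_succ (Nat.mul_le_mul (length_dp_le (R x) (grid x) l') (by omega))

@[fun_prop]
theorem vecOk (hR : PolyTime R) (hM : PolyTime M) (hn : PolyTime n) (hv : PolyTime v) :
    PolyTime fun x => Impl.vecOk (R x) (M x) (n x) (v x) := by
  unfold Impl.vecOk; fun_prop

@[fun_prop]
theorem inner (hR : PolyTime R) (hgrid : PolyTime grid) (hM : PolyTime M) (hT : PolyTime T)
    (hI : PolyTime I) (hg : PolyTime g) :
    PolyTime fun x => Impl.inner (R x) (grid x) (M x) (T x) (I x) (g x) := by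
  unfold Impl.inner; fun_prop

@[fun_prop]
theorem value (hN : PolyTime N) (hT : PolyTime T) (hv : PolyTime v) :
    PolyTime fun x => Impl.value (N x) (T x) (v x) := by
  unfold Impl.value Impl.probLt; fun_prop

@[fun_prop]
theorem isMono (hR : PolyTime R) (hg : PolyTime g) :
    PolyTime fun x => Impl.isMono (R x) (g x) := by
  unfold Impl.isMono; fun_prop

@[fun_prop]
theorem outer (hR : PolyTime R) (hN : PolyTime N) (hgrid : PolyTime grid) (hM : PolyTime M)
    (hT : PolyTime T) (hI : PolyTime I) (hgs : PolyTime gs) :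
    PolyTime fun x => Impl.outer (R x) (N x) (grid x) (M x) (T x) (I x) (gs x) := by
  unfold Impl.outer; fun_prop

end PolyTime

/-! ### Expectations under independent draws -/

section Expect

variable {α β : Type}

theorem mean_eq_sum (D : List (α × ℚ)) (f : α → ℚ) :
    mean D f = ∑ k : Fin D.length, (D.get k).2 * f (D.get k).1 := by
  rw [mean, ← List.ofFn_get (D.map _), List.sum_ofFn]
  refine Fintype.sum_equiv (finCongr (by simp)) _ _ fun k => ?_
  simp

theorem expect_succ {n : ℕ} (D : Fin (n + 1) → List (α × ℚ)) (f : (Fin (n + 1) → α) → ℚ) :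
    expect D f = mean (D 0) fun a => expect (fun i => D i.succ) fun x => f (Fin.cons a x) := by
  rw [mean_eq_sum, _root_.expect,
    ← (Fin.consEquiv fun i => Fin (D i).length).sum_comp, Fintype.sum_prod_type]
  refine Finset.sum_congr rfl fun k _ => ?_
  rw [_root_.expect, Finset.mul_sum]
  refine Finset.sum_congr rfl fun ω _ => ?_
  rw [Fin.prod_univ_succ, mul_assoc]
  simp only [Fin.consEquiv, Equiv.coe_fn_mk, Fin.cons_zero, Fin.cons_succ]
  congr 3
  funext i
  refine Fin.cases ?_ (fun i => ?_) i <;> simp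

theorem expect_zero (D : Fin 0 → List (α × ℚ)) (f : (Fin 0 → α) → ℚ) :
    expect D f = f Fin.elim0 := by
  rw [_root_.expect, Fintype.sum_unique]
  simp only [Finset.univ_eq_empty, Finset.prod_empty, one_mul]
  congr 1
  exact Subsingleton.elim _ _

theorem mean_congr {D : List (α × ℚ)} {f g : α → ℚ} (h : ∀ x ∈ D, f x.1 = g x.1) :
    mean D f = mean D g := by
  rw [mean, mean]
  congr 1
  exact List.map_congr_left fun x hx => by rw [h x hx]

theorem expect_congr {n : ℕ} {D : Fin n → List (α × ℚ)} {f g : (Fin n → α) → ℚ}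
    (h : ∀ x : Fin n → α, (∀ i, ∃ p, (x i, p) ∈ D i) → f x = g x) : expect D f = expect D g := by
  refine Finset.sum_congr rfl fun ω _ => ?_
  rw [h]
  exact fun i => ⟨_, List.get_mem _ _⟩

/-- A law enters an independent expectation only through its means. So a law may be replaced by any
list with the same push-forward, however its masses are split or ordered. -/
theorem expect_congr_mean {n : ℕ} (π : Fin n → β → α) {D : Fin n → List (α × ℚ)}
    {D' : Fin n → List (β × ℚ)} (h : ∀ i φ, mean (D i) φ = mean (D' i) fun x => φ (π i x))
    (f : (Fin n → α) → ℚ) : expect D f = expect D' fun x => f fun i => π i (x i) := by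
  induction n with
  | zero =>
    rw [expect_zero, expect_zero]
    congr 1
    exact Subsingleton.elim _ _
  | succ n ih =>
    rw [expect_succ, expect_succ, h]
    congr 1
    funext a
    rw [ih (fun i => π i.succ) fun i φ => h i.succ φ]
    congr 1
    funext x
    congr 1
    funext i
    refine Fin.cases ?_ (fun i => ?_) i <;> simp

theorem expect_prod {n : ℕ} (D : Fin n → List (α × ℚ)) (φ : Fin n → α → ℚ) :
    (expect D fun x => ∏ i, φ i (x i)) = ∏ i, mean (D i) (φ i) := by
  simp only [mean_eq_sum]
  rw [Finset.prod_univ_sum, Fintype.piFinset_univ, _root_.expect]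
  exact Finset.sum_congr rfl fun ω _ => by rw [← Finset.prod_mul_distrib]

/-- Conditioning on the draw of action `i`: given its value, the other factors are independent. -/
theorem expect_pivot {n : ℕ} (D : Fin n → List (α × ℚ)) (i : Fin n) (h : α → ℚ)
    (r : Fin n → α → α → ℚ) :
    (expect D fun x => h (x i) * ∏ k ∈ univ.erase i, r k (x k) (x i)) =
      mean (D i) fun a => h a * ∏ k ∈ univ.erase i, mean (D k) fun b => r k b a := by
  -- Summing over the outcome `j` of action `i`, with an indicator as factor number `i`, turns the
  -- summand into a full product over actions, to which distributivity applies.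
  let G : Fin (D i).length → (k : Fin n) → Fin (D k).length → ℚ := fun j k m =>
    if k = i then (if (m : ℕ) = j then ((D i).get j).2 * h ((D i).get j).1 else 0) else
      ((D k).get m).2 * r k ((D k).get m).1 ((D i).get j).1
  have hG : ∀ ω : (k : Fin n) → Fin (D k).length,
      (∏ k, ((D k).get (ω k)).2) * (h ((D i).get (ω i)).1 *
        ∏ k ∈ univ.erase i, r k ((D k).get (ω k)).1 ((D i).get (ω i)).1) =
      ∑ j, ∏ k, G j k (ω k) := by
    intro ω
    rw [Finset.sum_eq_single (ω i)]
    · rw [← Finset.mul_prod_erase univ _ (Finset.mem_univ i),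
        ← Finset.mul_prod_erase univ (fun k => G (ω i) k (ω k)) (Finset.mem_univ i)]
      have : ∏ k ∈ univ.erase i, G (ω i) k (ω k) = ∏ k ∈ univ.erase i,
          (((D k).get (ω k)).2 * r k ((D k).get (ω k)).1 ((D i).get (ω i)).1) :=
        Finset.prod_congr rfl fun k hk => by simp [G, Finset.ne_of_mem_erase hk]
      rw [this, Finset.prod_mul_distrib]
      simp only [G, if_true]
      ring
    · intro j _ hj
      refine Finset.prod_eq_zero (Finset.mem_univ i) ?_
      have : (ω i : ℕ) ≠ j := fun e => hj (Fin.ext e.symm)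
      simp [G, this]
    · simp
  rw [_root_.expect, Finset.sum_congr rfl fun ω _ => hG ω, Finset.sum_comm, mean_eq_sum]
  refine Finset.sum_congr rfl fun j _ => ?_
  have h1 := (Finset.prod_univ_sum (fun k => (Finset.univ : Finset (Fin (D k).length)))
    (fun k m => G j k m)).symm
  rw [Fintype.piFinset_univ] at h1
  rw [h1, ← Finset.mul_prod_erase univ _ (Finset.mem_univ i), ← mul_assoc]
  congr 1
  · rw [Finset.sum_eq_single j]
    · simp [G]
    · intro m _ hm
      have : (m : ℕ) ≠ j := fun e => hm (Fin.ext e)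
      simp [G, this]
    · simp
  · refine Finset.prod_congr rfl fun k hk => ?_
    rw [mean_eq_sum]
    exact Finset.sum_congr rfl fun m _ => by simp [G, Finset.ne_of_mem_erase hk]

theorem expect_sum {n : ℕ} {ι : Type} (D : Fin n → List (α × ℚ)) (s : Finset ι)
    (f : ι → (Fin n → α) → ℚ) :
    (expect D fun x => ∑ j ∈ s, f j x) = ∑ j ∈ s, expect D (f j) := by
  simp only [_root_.expect, Finset.mul_sum]
  exact Finset.sum_comm

/-- The expectation of a function of the strictly best draw. -/
theorem expect_winner {n : ℕ} [NeZero n] {κ : Type} [LinearOrder κ] (D : Fin n → List (α × ℚ))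
    (a : α → κ) (hinj : ∀ i k, i ≠ k → ∀ x ∈ D i, ∀ y ∈ D k, a x.1 ≠ a y.1) (h : α → ℚ)
    (F : (Fin n → α) → ℚ)
    (hF : ∀ x : Fin n → α, (∀ i, ∃ p, (x i, p) ∈ D i) → ∀ i, (∀ k, k ≠ i → a (x k) < a (x i)) →
      F x = h (x i)) :
    expect D F = ∑ i, mean (D i) fun y =>
      h y * ∏ k ∈ univ.erase i, mean (D k) fun b => if a b < a y then 1 else 0 := by
  simp only [← expect_pivot D _ h fun k b y => if a b < a y then 1 else 0]
  rw [← expect_sum]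
  refine expect_congr fun x hx => ?_
  obtain ⟨i, -, hi⟩ := Finset.exists_max_image univ (fun i => a (x i)) Finset.univ_nonempty
  have hlt : ∀ k, k ≠ i → a (x k) < a (x i) := fun k hk => by
    refine (hi k (Finset.mem_univ k)).lt_of_ne ?_
    obtain ⟨p, hp⟩ := hx k
    obtain ⟨q, hq⟩ := hx i
    exact hinj k i hk _ hp _ hq
  rw [Finset.sum_eq_single i]
  · rw [hF x hx i hlt, Finset.prod_eq_one, mul_one]
    exact fun k hk => if_pos (hlt k (Finset.ne_of_mem_erase hk))
  · intro j _ hj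
    rw [Finset.prod_eq_zero (i := i), mul_zero]
    · simp [hj.symm]
    · exact if_neg (hlt j hj).not_gt
  · simp

end Expect

/-! ### Favourite choices -/

theorem favouritePayoff_eq {ι κ : Type} [LinearOrder κ] {S : Finset ι} {a : ι → κ} {u : ι → ℚ}
    {i : ι} (hi : i ∈ S) (h1 : ∀ k ∈ S, a k ≤ a i) (h2 : ∀ k ∈ S, a k = a i → u k ≤ u i) :
    favouritePayoff S a u = u i := by
  have hmem : i ∈ S.filter fun i => ∀ k ∈ S, a k ≤ a i := Finset.mem_filter.2 ⟨hi, h1⟩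
  have : ((S.filter fun i => ∀ k ∈ S, a k ≤ a i).image u).max = (u i : WithBot ℚ) := by
    refine le_antisymm (Finset.max_le fun v hv => ?_)
      (Finset.le_max (Finset.mem_image_of_mem u hmem))
    obtain ⟨k, hk, rfl⟩ := Finset.mem_image.1 hv
    obtain ⟨hk, hk'⟩ := Finset.mem_filter.1 hk
    exact WithBot.coe_le_coe.2 (h2 k hk (le_antisymm (h1 k hk) (hk' i hi)))
  rw [favouritePayoff, this]
  rfl

theorem favouritePayoff_empty {ι κ : Type} [LinearOrder κ] (a : ι → κ) (u : ι → ℚ) :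
    favouritePayoff ∅ a u = 0 := by
  simp [favouritePayoff]

/-- A maximizer of the lexicographic pair of agent and principal utility. -/
theorem exists_favourite {ι κ : Type} [LinearOrder κ] {S : Finset ι} (hS : S.Nonempty)
    (a : ι → κ) (u : ι → ℚ) :
    ∃ i ∈ S, (∀ k ∈ S, a k ≤ a i) ∧ (∀ k ∈ S, a k = a i → u k ≤ u i) := by
  obtain ⟨i, hi, hm⟩ := Finset.exists_max_image S (fun i => toLex (a i, u i)) hS
  refine ⟨i, hi, fun k hk => ?_, fun k hk e => ?_⟩
  · rcases Prod.Lex.le_iff.1 (hm k hk) with h | h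
    · exact h.le
    · exact h.1.le
  · rcases Prod.Lex.le_iff.1 (hm k hk) with h | h
    · exact absurd e h.ne
    · exact h.2

theorem favouritePayoff_nonneg {ι κ : Type} [LinearOrder κ] {S : Finset ι} {a : ι → κ} {u : ι → ℚ}
    (h : ∀ i ∈ S, 0 ≤ u i) : 0 ≤ favouritePayoff S a u := by
  rcases S.eq_empty_or_nonempty with rfl | hS
  · rw [favouritePayoff_empty]
  · obtain ⟨i, hi, h1, h2⟩ := exists_favourite hS a u
    rw [favouritePayoff_eq hi h1 h2]
    exact h i hi

/-! ### Properties of the pieces -/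

section Pieces

variable {M : ℕ} {L : List Mass} {I : UCInstance}

theorem pieces_length (M : ℕ) (L : List Mass) :
    (pieces M L).length = (L.flatMap (Mass.split M)).length := by simp [pieces]

theorem pieces_index {k : ℕ} (hk : k < (pieces M L).length) :
    (ofLex (pieces M L)[k].agent).2 = k := by
  simp [pieces]

theorem pieces_inj {x y : Piece} (hx : x ∈ pieces M L) (hy : y ∈ pieces M L)
    (h : x.agent = y.agent) : x = y := by
  obtain ⟨k, hk, rfl⟩ := List.getElem_of_mem hx
  obtain ⟨l, hl, rfl⟩ := List.getElem_of_mem hy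
  have h1 := pieces_index hk
  have h2 := pieces_index hl
  rw [h, h2] at h1
  subst h1
  rfl

theorem pieces_nodup (M : ℕ) (L : List Mass) : (pieces M L).Nodup := by
  rw [List.nodup_iff_injective_get]
  intro k l h
  have h1 := pieces_index k.2
  have h2 := pieces_index l.2
  simp only [List.get_eq_getElem] at h
  rw [h, h2] at h1
  exact Fin.ext h1.symm

theorem split_principal {x y : Mass} (h : y ∈ x.split M) : y.principal = x.principal := by
  rcases List.mem_append.1 h with h | h
  · rw [List.eq_of_mem_replicate h]
  · rw [List.mem_singleton.1 h]

/-- The second component of a perturbed utility is the position in the list, and splitting keeps the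
list sorted by principal utility. -/
theorem pieces_mono (hL : L.Pairwise fun x y => x.principal ≤ y.principal) {x y : Piece}
    (hx : x ∈ pieces M L) (hy : y ∈ pieces M L) (h : (ofLex x.agent).2 ≤ (ofLex y.agent).2) :
    x.principal ≤ y.principal := by
  have hp : (L.flatMap (Mass.split M)).Pairwise fun x y => x.principal ≤ y.principal := by
    rw [List.flatMap, List.pairwise_flatten]
    refine ⟨fun l hl => ?_, ?_⟩
    · obtain ⟨m, -, rfl⟩ := List.mem_map.1 hl
      rw [List.pairwise_iff_forall_sublist]
      intro a b hab
      rw [split_principal (hab.subset (List.mem_cons_self)),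
        split_principal (hab.subset (List.mem_cons_of_mem _ List.mem_cons_self))]
    · rw [List.pairwise_map]
      refine hL.imp fun {a b} hab c hc d hd => ?_
      rw [split_principal hc, split_principal hd]
      exact hab
  obtain ⟨k, hk, rfl⟩ := List.getElem_of_mem hx
  obtain ⟨l, hl, rfl⟩ := List.getElem_of_mem hy
  rw [pieces_index hk, pieces_index hl] at h
  rcases h.eq_or_lt with rfl | h
  · rfl
  · rw [List.pairwise_iff_getElem] at hp
    have := hp k l (by rwa [pieces_length] at hk) (by rwa [pieces_length] at hl) h
    simpa [pieces] using this

theorem exists_mass_of_mem_pieces {x : Piece} (hx : x ∈ pieces M L) :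
    ∃ m ∈ L, ∃ y ∈ m.split M, x.action = y.action ∧ x.config = y.config ∧
      (ofLex x.agent).1 = y.agent ∧ x.principal = y.principal ∧ x.prob = y.prob := by
  obtain ⟨y, hy, rfl⟩ := List.mem_map.1 hx
  obtain ⟨m, hm, hy⟩ := List.mem_flatMap.1 (List.fst_mem_of_mem_zipIdx hy)
  exact ⟨m, hm, y.1, hy, rfl, rfl, rfl, rfl, rfl⟩

theorem split_prob (hM : 1 ≤ M) {x y : Mass} (hx : 0 ≤ x.prob) (h : y ∈ x.split M) :
    0 ≤ y.prob ∧ y.prob ≤ 1 / (M : ℚ) ^ 2 := by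
  have hM' : (0 : ℚ) < (M : ℚ) ^ 2 := by positivity
  rcases List.mem_append.1 h with h | h
  · rw [List.eq_of_mem_replicate h]
    exact ⟨by positivity, le_rfl⟩
  · rw [List.mem_singleton.1 h]
    have h1 := Nat.floor_le (mul_nonneg hx hM'.le)
    have h2 := Nat.lt_floor_add_one (x.prob * (M : ℚ) ^ 2)
    constructor
    · rw [sub_nonneg, div_le_iff₀ hM']
      exact h1
    · rw [sub_le_iff_le_add, ← add_div, le_div_iff₀ hM']
      linarith

theorem sum_split (x : Mass) (c : ℚ) : ((x.split M).map fun y => y.prob * c).sum = x.prob * c := by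
  simp only [Mass.split, List.map_append, List.map_replicate, List.map_cons, List.map_nil,
    List.sum_append, List.sum_replicate, List.sum_cons, List.sum_nil, nsmul_eq_mul]
  ring

theorem split_fields {x y : Mass} (h : y ∈ x.split M) :
    y.action = x.action ∧ y.config = x.config ∧ y.agent = x.agent := by
  rcases List.mem_append.1 h with h | h
  · rw [List.eq_of_mem_replicate h]; exact ⟨rfl, rfl, rfl⟩
  · rw [List.mem_singleton.1 h]; exact ⟨rfl, rfl, rfl⟩

/-- The summand does not see the perturbation index, and the pieces of a mass add up to its
probability. -/
theorem sum_pieces (H : ℕ → ℕ → WithBot ℚ → ℚ → ℚ) :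
    ((pieces M L).map fun x =>
      x.prob * H x.action x.config (ofLex x.agent).1 x.principal).sum =
    (L.map fun x => x.prob * H x.action x.config x.agent x.principal).sum := by
  have h1 : (pieces M L).map (fun x =>
      x.prob * H x.action x.config (ofLex x.agent).1 x.principal) =
      (L.flatMap (Mass.split M)).map fun x =>
        x.prob * H x.action x.config x.agent x.principal := by
    rw [pieces, List.map_map]
    have h2 : (L.flatMap (Mass.split M)) = (L.flatMap (Mass.split M)).zipIdx.map Prod.fst := by
      rw [List.zipIdx_map_fst]
    nth_rw 2 [h2]
    rw [List.map_map]
    rfl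
  rw [h1]
  clear h1
  induction L with
  | nil => rfl
  | cons m L ih =>
    rw [List.flatMap_cons, List.map_append, List.sum_append, ih, List.map_cons, List.sum_cons,
      ← sum_split (M := M)]
    congr 2
    refine List.map_congr_left fun y hy => ?_
    obtain ⟨h1, h2, h3⟩ := split_fields hy
    rw [h1, h2, h3, split_principal hy]

theorem sum_zipIdx {α : Type} (l : List α) (i : ℕ) (F : α → ℚ) (hi : i < l.length) :
    (l.zipIdx.map fun A => if A.2 = i then F A.1 else 0).sum = F l[i] := by
  have key : ∀ (l : List α) (s i : ℕ) (hi : i < l.length),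
      ((l.zipIdx s).map fun A => if A.2 = s + i then F A.1 else 0).sum = F l[i] := by
    intro l
    induction l with
    | nil => intro s i hi; simp at hi
    | cons a l ih =>
      intro s i hi
      rw [List.zipIdx_cons, List.map_cons, List.sum_cons]
      rcases i with _ | i
      · have : ∀ A ∈ l.zipIdx (s + 1), (if A.2 = s + 0 then F A.1 else 0) = 0 := fun A hA => by
          obtain ⟨h, -⟩ := List.mem_zipIdx hA
          exact if_neg (by omega)
        rw [List.map_congr_left this]
        simp
      · have := ih (s + 1) i (by simpa using hi)
        rw [if_neg (by omega), zero_add]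
        have e : ∀ A : α × ℕ, A.2 = s + (i + 1) ↔ A.2 = s + 1 + i := fun A => by omega
        simpa only [e, List.getElem_cons_succ] using this
  simpa using key l 0 i hi

theorem sum_flatMap {α : Type} {β : Type} (l : List α) (f : α → List β) (F : β → ℚ) :
    ((l.flatMap f).map F).sum = (l.map fun a => ((f a).map F).sum).sum := by
  induction l with
  | nil => rfl
  | cons a l ih => simp [ih]

theorem sum_filter {α : Type} (l : List α) (p : α → Prop) [DecidablePred p] (F : α → ℚ) :
    ((l.filter fun x => p x).map F).sum = (l.map fun x => if p x then F x else 0).sum := by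
  induction l with
  | nil => rfl
  | cons a l ih => by_cases h : p a <;> simp [h, ih]

/-- The masses of one configuration. -/
theorem sum_masses (i : Fin I.length) (C : I.Config) (F : WithBot ℚ → ℚ → ℚ) :
    (I.masses.map fun x => x.prob *
      if x.action = (i : ℕ) ∧ x.config = (C i : ℕ) then F x.agent x.principal else 0).sum =
    mean (I.law C i) fun x => F (agentUtil x.1) x.2 := by
  rw [UCInstance.masses, sum_flatMap]
  have h1 : ∀ A ∈ I.zipIdx, ((A.1.zipIdx.flatMap fun D =>
      D.1.map fun x => (⟨A.2, D.2, agentUtil x.1.1, x.1.2, x.2⟩ : Mass)).map fun x => x.prob *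
        if x.action = (i : ℕ) ∧ x.config = (C i : ℕ) then F x.agent x.principal else 0).sum =
      if A.2 = (i : ℕ) then (A.1.zipIdx.map fun D => if D.2 = (C i : ℕ) then
        mean D.1 (fun x => F (agentUtil x.1) x.2) else 0).sum else 0 := by
    intro A _
    rw [sum_flatMap]
    by_cases hA : A.2 = (i : ℕ)
    · rw [if_pos hA]
      congr 1
      refine List.map_congr_left fun D _ => ?_
      rw [List.map_map]
      by_cases hD : D.2 = (C i : ℕ)
      · rw [if_pos hD, mean]
        congr 1
        refine List.map_congr_left fun x _ => ?_
        simp [hA, hD]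
      · rw [if_neg hD]
        simp [Function.comp_def, hD]
    · rw [if_neg hA]
      simp [Function.comp_def, hA]
  refine (congrArg List.sum (List.map_congr_left h1)).trans ?_
  refine (sum_zipIdx I i (fun A => (A.zipIdx.map fun D => if D.2 = (C i : ℕ) then
    mean D.1 (fun x => F (agentUtil x.1) x.2) else 0).sum) i.2).trans ?_
  exact sum_zipIdx (I.get i) (C i) (fun D => mean D fun x => F (agentUtil x.1) x.2) (C i).2

/-- The preprocessed distribution of an action, with the pieces as outcomes. -/
def pieceLaw (I : UCInstance) (T : List Piece) (C : I.Config) (i : Fin I.length) :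
    List (Piece × ℚ) := (newLaw I T C i).map fun x => (x, x.prob)

theorem mean_pieceLaw (T : List Piece) (C : I.Config) (i : Fin I.length) (F : Piece → ℚ) :
    mean (pieceLaw I T C i) F = ((newLaw I T C i).map fun x => x.prob * F x).sum := by
  rw [mean, pieceLaw, List.map_map]
  rfl

/-- The two utilities of a piece. -/
def Piece.utils (x : Piece) : Option ℚ × ℚ := ((ofLex x.agent).1, x.principal)

/-- Preprocessing only refines the outcomes: forgetting the perturbation index gives back the
original law. -/
theorem mean_law (hL : L.Perm I.masses) (C : I.Config) (i : Fin I.length)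
    (F : Option ℚ × ℚ → ℚ) :
    mean (I.law C i) F = mean (pieceLaw I (pieces M L) C i) fun x => F x.utils := by
  rw [mean_pieceLaw, newLaw, sum_filter]
  have h1 := sum_pieces (M := M) (L := L) fun a c u v =>
    if a = (i : ℕ) ∧ c = (C i : ℕ) then F ((u : Option ℚ), v) else 0
  have h2 := sum_masses i C fun u v => F ((u : Option ℚ), v)
  rw [(hL.map _).sum_eq, h2] at h1
  have h3 : ∀ x : Option ℚ × ℚ, F ((agentUtil x.1 : Option ℚ), x.2) = F x := by
    rintro ⟨_ | q, v⟩ <;> rfl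
  simp only [h3] at h1
  rw [← h1]
  congr 1
  refine List.map_congr_left fun x _ => ?_
  split_ifs <;> simp [Piece.utils]

end Pieces

/-! ### Independent draws of pieces -/

/-- Disjoint finite sets of pieces, one for each action, whose probabilities add up to `1`. -/
structure IsPieceSystem (M : ℕ) {n : ℕ} (P : Fin n → Finset Piece) : Prop where
  inj : ∀ i k, ∀ x ∈ P i, ∀ y ∈ P k, x.agent = y.agent → x = y ∧ i = k
  mono : ∀ i k, ∀ x ∈ P i, ∀ y ∈ P k, (ofLex x.agent).2 ≤ (ofLex y.agent).2 →
    x.principal ≤ y.principal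
  prob_nonneg : ∀ i, ∀ x ∈ P i, 0 ≤ x.prob
  prob_le : ∀ i, ∀ x ∈ P i, x.prob ≤ 1 / (M : ℚ) ^ 2
  principal_nonneg : ∀ i, ∀ x ∈ P i, 0 ≤ x.principal
  total : ∀ i, ∑ x ∈ P i, x.prob = 1

section Winner

variable {n : ℕ} (P : Fin n → Finset Piece)

/-- The probability that a draw has agent utility below `t`. -/
def probLt (i : Fin n) (t : PUtil) : ℚ := ∑ x ∈ P i, if x.agent < t then x.prob else 0

/-- The probability that `x` is drawn for action `i` and is the agent's favourite. -/
def winProb (i : Fin n) (x : Piece) : ℚ := x.prob * ∏ k ∈ univ.erase i, probLt P k x.agent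

/-- The expectation of `h` at the agent's favourite. -/
def winMean (h : Piece → ℚ) : ℚ := ∑ i, ∑ x ∈ P i, winProb P i x * h x

end Winner

/-! ### The value of a configuration in terms of the winning piece. -/

section Link

variable {M : ℕ} {L : List Mass} {I : UCInstance}

open Classical in
/-- The pieces of a configuration. -/
noncomputable def configPieces (I : UCInstance) (T : List Piece) (C : I.Config) (i : Fin I.length) :
    Finset Piece := (newLaw I T C i).toFinset

theorem mem_newLaw {T : List Piece} {C : I.Config} {i : Fin I.length} {x : Piece} :
    x ∈ newLaw I T C i ↔ x ∈ T ∧ x.action = i ∧ x.config = C i := by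
  simp [newLaw]

theorem mem_configPieces {T : List Piece} {C : I.Config} {i : Fin I.length} {x : Piece} :
    x ∈ configPieces I T C i ↔ x ∈ T ∧ x.action = i ∧ x.config = C i := by
  simp only [configPieces, List.mem_toFinset, mem_newLaw]

theorem sum_newLaw {T : List Piece} (hT : T.Nodup) (C : I.Config) (i : Fin I.length)
    (f : Piece → ℚ) : ((newLaw I T C i).map f).sum = ∑ x ∈ configPieces I T C i, f x := by
  classical
  have h : (newLaw I T C i).Nodup := hT.filter _
  rw [configPieces, ← List.sum_toFinset f h]

theorem mem_masses {m : Mass} (hm : m ∈ I.masses) : ∃ A ∈ I, ∃ D ∈ A, ∃ x ∈ D,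
    m.principal = x.1.2 ∧ m.prob = x.2 ∧ m.action < I.length := by
  obtain ⟨A, hA, hm⟩ := List.mem_flatMap.1 hm
  obtain ⟨D, hD, hm⟩ := List.mem_flatMap.1 hm
  obtain ⟨x, hx, rfl⟩ := List.mem_map.1 hm
  refine ⟨A.1, List.fst_mem_of_mem_zipIdx hA, D.1, List.fst_mem_of_mem_zipIdx hD, x, hx, rfl, rfl,
    ?_⟩
  simpa using (List.mem_zipIdx hA).2.1

theorem mean_one {α : Type} {D : List (α × ℚ)} (hD : IsDist D) : (mean D fun _ => 1) = 1 := by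
  simp only [mean, mul_one]
  exact hD.2

theorem isPieceSystem (hI : I.Valid) (hM : 1 ≤ M) (hL : L.Perm I.masses)
    (hs : L.Pairwise fun x y => x.principal ≤ y.principal) (C : I.Config) :
    IsPieceSystem M (configPieces I (pieces M L) C) where
  inj i k x hx y hy h := by
    rw [mem_configPieces] at hx hy
    have e := pieces_inj hx.1 hy.1 h
    exact ⟨e, Fin.ext (by rw [← hx.2.1, ← hy.2.1, e])⟩
  mono i k x hx y hy h := by
    rw [mem_configPieces] at hx hy
    exact pieces_mono hs hx.1 hy.1 h
  prob_nonneg i x hx := by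
    obtain ⟨m, hm, y, hy, -, -, -, -, e⟩ := exists_mass_of_mem_pieces (mem_configPieces.1 hx).1
    obtain ⟨A, hA, D, hD, z, hz, -, e', -⟩ := mem_masses (hL.subset hm)
    rw [e]
    exact (split_prob hM (e' ▸ ((hI.dist A hA D hD).1 z hz).le) hy).1
  prob_le i x hx := by
    obtain ⟨m, hm, y, hy, -, -, -, -, e⟩ := exists_mass_of_mem_pieces (mem_configPieces.1 hx).1
    obtain ⟨A, hA, D, hD, z, hz, -, e', -⟩ := mem_masses (hL.subset hm)
    rw [e]
    exact (split_prob hM (e' ▸ ((hI.dist A hA D hD).1 z hz).le) hy).2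
  principal_nonneg i x hx := by
    obtain ⟨m, hm, y, hy, -, -, -, e, -⟩ := exists_mass_of_mem_pieces (mem_configPieces.1 hx).1
    obtain ⟨A, hA, D, hD, z, hz, e', -⟩ := mem_masses (hL.subset hm)
    rw [e, split_principal hy, e']
    exact hI.principal_nonneg A hA D hD z hz
  total i := by
    have h := mean_law (M := M) hL C i fun _ => 1
    have hd : IsDist (I.law C i) := hI.dist _ (List.get_mem _ _) _ (List.get_mem _ _)
    rw [mean_one hd, mean_pieceLaw,
      sum_newLaw (pieces_nodup M L)] at h
    simpa using h.symm

theorem agentUtil_utils (x : Piece) : agentUtil x.utils.1 = (ofLex x.agent).1 := by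
  have : ∀ a : WithBot ℚ, agentUtil (a : Option ℚ) = a := fun a => by cases a <;> rfl
  exact this _

theorem pieceLaw_winner {T : List Piece} (hT : T.Nodup) (C : I.Config)
    (hP : IsPieceSystem M (configPieces I T C)) (hn : I ≠ []) (h : Piece → ℚ)
    (F : (Fin I.length → Piece) → ℚ)
    (hF : ∀ x : Fin I.length → Piece, (∀ i, x i ∈ configPieces I T C i) → ∀ i,
      (∀ k, k ≠ i → (x k).agent < (x i).agent) → F x = h (x i)) :
    expect (pieceLaw I T C) F = winMean (configPieces I T C) h := by
  have : NeZero I.length := ⟨fun e => hn (List.length_eq_zero_iff.1 e)⟩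
  have hmem : ∀ i y, y ∈ pieceLaw I T C i → y.1 ∈ configPieces I T C i := by
    intro i y hy
    obtain ⟨x, hx, rfl⟩ := List.mem_map.1 hy
    exact mem_configPieces.2 (mem_newLaw.1 hx)
  rw [expect_winner (pieceLaw I T C) Piece.agent
    (fun i k hik x hx y hy e => hik (hP.inj i k _ (hmem i x hx) _ (hmem k y hy) e).2) h F
    fun x hx i hi => hF x (fun i => by obtain ⟨p, hp⟩ := hx i; exact hmem i _ hp) i hi]
  refine Finset.sum_congr rfl fun i _ => ?_
  rw [mean_pieceLaw, sum_newLaw hT]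
  refine Finset.sum_congr rfl fun x _ => ?_
  have : ∀ k, (mean (pieceLaw I T C k) fun b => if b.agent < x.agent then 1 else 0) =
      probLt (configPieces I T C) k x.agent := fun k => by
    rw [mean_pieceLaw, sum_newLaw hT, probLt]
    simp
  simp only [this, winProb]
  ring

/-- Here tie-breaking is settled: a piece that beats another one only by its perturbation index is
later in the sorted order, so it is at least as good for the principal. -/
theorem utils_winner (hP : IsPieceSystem M (configPieces I (pieces M L) C))
    (x : Fin I.length → Piece) (hx : ∀ i, x i ∈ configPieces I (pieces M L) C i)
    (i : Fin I.length) (hi : ∀ k, k ≠ i → (x k).agent < (x i).agent) :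
    (principalPayoff fun i => (x i).utils) = (x i).principal ∧
    (bestAgent fun i => (x i).utils) = (ofLex (x i).agent).1 := by
  have h1 : ∀ k, (ofLex (x k).agent).1 ≤ (ofLex (x i).agent).1 := fun k => by
    rcases eq_or_ne k i with rfl | hk
    · exact le_rfl
    · rcases Prod.Lex.lt_iff.1 (hi k hk) with h | h
      · exact h.le
      · exact h.1.le
  constructor
  · rw [principalPayoff, favouritePayoff_eq (Finset.mem_univ i)]
    · rfl
    · intro k _
      rw [agentUtil_utils, agentUtil_utils]
      exact h1 k
    · intro k _ e
      rw [agentUtil_utils, agentUtil_utils] at e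
      rcases eq_or_ne k i with rfl | hk
      · exact le_rfl
      · refine hP.mono k i _ (hx k) _ (hx i) ?_
        rcases Prod.Lex.lt_iff.1 (hi k hk) with h | h
        · exact absurd e h.ne
        · exact h.2.le
  · rw [bestAgent]
    refine le_antisymm (Finset.sup_le fun k _ => ?_) ?_
    · rw [agentUtil_utils]; exact h1 k
    · rw [← agentUtil_utils]
      exact Finset.le_sup (f := fun i => agentUtil (x i).utils.1) (Finset.mem_univ i)

theorem law_winner (hP : IsPieceSystem M (configPieces I (pieces M L) C)) (hL : L.Perm I.masses)
    (hn : I ≠ []) (F : WithBot ℚ → ℚ → ℚ) :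
    (expect (I.law C) fun x => F (bestAgent x) (principalPayoff x)) =
      winMean (configPieces I (pieces M L) C) fun y => F (ofLex y.agent).1 y.principal := by
  rw [expect_congr_mean (fun _ => Piece.utils) (fun i φ => mean_law (M := M) hL C i φ)]
  refine pieceLaw_winner (pieces_nodup M L) C hP hn _ _ fun x hx i hi => ?_
  obtain ⟨h1, h2⟩ := utils_winner hP x hx i hi
  rw [h1, h2]

theorem value_eq_winMean (hP : IsPieceSystem M (configPieces I (pieces M L) C))
    (hL : L.Perm I.masses) :
    I.value C = winMean (configPieces I (pieces M L) C) Piece.principal := by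
  rcases eq_or_ne I [] with rfl | hn
  · rw [UCInstance.value, expect_zero, winMean, principalPayoff]
    exact favouritePayoff_empty _ _
  · exact law_winner hP hL hn fun _ u => u

theorem probLe_eq_winMean (hP : IsPieceSystem M (configPieces I (pieces M L) C))
    (hL : L.Perm I.masses) (hn : I ≠ []) (U : WithBot ℚ) :
    I.probLe C U = winMean (configPieces I (pieces M L) C)
      fun y => if (ofLex y.agent).1 ≤ U then 1 else 0 :=
  law_winner hP hL hn fun a _ => if a ≤ U then 1 else 0

theorem condValue_eq_winMean (hP : IsPieceSystem M (configPieces I (pieces M L) C))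
    (hL : L.Perm I.masses) (hn : I ≠ []) (U : WithBot ℚ) :
    I.condValue C U = winMean (configPieces I (pieces M L) C)
      (fun y => if (ofLex y.agent).1 ≤ U then y.principal else 0) / I.probLe C U := by
  rw [← law_winner hP hL hn fun a u => if a ≤ U then u else 0]
  rfl

/-- The winner is below `t` exactly if all draws are, and the draws are independent. -/
theorem winMean_lt (hP : IsPieceSystem M (configPieces I (pieces M L) C)) (hn : I ≠ [])
    (t : PUtil) :
    (winMean (configPieces I (pieces M L) C) fun y => if y.agent < t then 1 else 0) =
      ∏ i, probLt (configPieces I (pieces M L) C) i t := by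
  rw [← pieceLaw_winner (pieces_nodup M L) C hP hn _ fun x =>
    ∏ i, if (x i).agent < t then 1 else 0]
  · rw [expect_prod _ fun _ (y : Piece) => if y.agent < t then 1 else 0]
    refine Finset.prod_congr rfl fun i _ => ?_
    rw [mean_pieceLaw, sum_newLaw (pieces_nodup M L), probLt]
    simp
  · intro x hx i hi
    rw [Finset.prod_ite_zero]
    simp only [Finset.prod_const_one]
    refine if_congr ⟨fun h => h i (Finset.mem_univ i), fun h k _ => ?_⟩ rfl rfl
    rcases eq_or_ne k i with rfl | hk
    · exact h
    · exact (hi k hk).trans h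

end Link

/-! ### Correctness of the program -/

namespace Impl

theorem mem_extend {R : List ℕ} {S : List (List ℕ × ℚ × List ℕ)} {os : List (ℕ × List ℕ × ℚ)}
    {f : List ℕ × ℚ × List ℕ} : f ∈ extend R S os ↔ ∃ e ∈ S, ∃ o ∈ os,
      (R.map fun j => e.1.getD j 0 + o.2.1.getD j 0, e.2.1 + o.2.2, e.2.2 ++ [o.1]) = f := by
  simp only [extend, List.mem_flatMap, List.mem_map]

theorem getD_map_range {M j : ℕ} (hj : j < M) (f : ℕ → ℕ) :
    ((List.range M).map f).getD j 0 = f j := by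
  simp [List.getD_eq_getElem?_getD, hj]

theorem mem_dpStep {M : ℕ} {grid : List (List ℕ)} {S : List (List ℕ × ℚ × List ℕ)}
    {os : List (ℕ × List ℕ × ℚ)} {f : List ℕ × ℚ × List ℕ}
    (hf : f ∈ dpStep (List.range M) grid S os) : ∃ e ∈ S, ∃ o ∈ os,
      (∀ j < M, f.1.getD j 0 = e.1.getD j 0 + o.2.1.getD j 0) ∧ f.2.1 = e.2.1 + o.2.2 ∧
        f.2.2 = e.2.2 ++ [o.1] := by
  obtain ⟨t, ht, hf⟩ := List.mem_filterMap.1 hf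
  generalize hb : best (fun e : List ℕ × ℚ × List ℕ => e.2.1)
    ((extend (List.range M) S os).filter fun e =>
      (List.range M).all fun j => decide (e.1.getD j 0 = t.getD j 0)) = b at hf
  rcases b with _ | f'
  · simp at hf
  · obtain rfl := Option.some.inj hf
    obtain ⟨h1, h2⟩ := List.mem_filter.1 (best_eq_some hb).1
    obtain ⟨e, he, o, ho, rfl⟩ := mem_extend.1 h1
    refine ⟨e, he, o, ho, fun j hj => ?_, rfl, rfl⟩
    simp only [List.all_eq_true, List.mem_range, decide_eq_true_eq] at h2
    rw [← h2 j hj, getD_map_range hj]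

theorem exists_mem_dpStep {M : ℕ} {grid : List (List ℕ)} {S : List (List ℕ × ℚ × List ℕ)}
    {os : List (ℕ × List ℕ × ℚ)} {e : List ℕ × ℚ × List ℕ} (he : e ∈ S) {o : ℕ × List ℕ × ℚ}
    (ho : o ∈ os) {t : List ℕ} (ht : t ∈ grid)
    (h : ∀ j < M, t.getD j 0 = e.1.getD j 0 + o.2.1.getD j 0) :
    ∃ f ∈ dpStep (List.range M) grid S os, f.1 = t ∧ e.2.1 + o.2.2 ≤ f.2.1 := by
  have hmem : ((List.range M).map fun j => e.1.getD j 0 + o.2.1.getD j 0, e.2.1 + o.2.2,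
      e.2.2 ++ [o.1]) ∈ (extend (List.range M) S os).filter fun e =>
        (List.range M).all fun j => decide (e.1.getD j 0 = t.getD j 0) := by
    refine List.mem_filter.2 ⟨mem_extend.2 ⟨e, he, o, ho, rfl⟩, ?_⟩
    simp only [List.all_eq_true, List.mem_range, decide_eq_true_eq]
    intro j hj
    rw [getD_map_range hj, h j hj]
  rcases hb : best (fun e : List ℕ × ℚ × List ℕ => e.2.1)
    ((extend (List.range M) S os).filter fun e =>
      (List.range M).all fun j => decide (e.1.getD j 0 = t.getD j 0)) with _ | f'
  · rw [best_eq_none hb] at hmem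
    simp at hmem
  · refine ⟨(t, f'.2), List.mem_filterMap.2 ⟨t, ht, by rw [hb]; rfl⟩, rfl, ?_⟩
    exact (best_eq_some hb).2 _ hmem

theorem dp_sound {M : ℕ} {grid : List (List ℕ)} (os : List (List (ℕ × List ℕ × ℚ)))
    (S : List (List ℕ × ℚ × List ℕ)) {f : List ℕ × ℚ × List ℕ}
    (hf : f ∈ os.foldl (dpStep (List.range M) grid) S) :
    ∃ e ∈ S, ∃ sel : List (ℕ × List ℕ × ℚ), List.Forall₂ (fun o l => o ∈ l) sel os ∧
      (∀ j < M, f.1.getD j 0 = e.1.getD j 0 + (sel.map fun o => o.2.1.getD j 0).sum) ∧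
      f.2.1 = e.2.1 + (sel.map fun o => o.2.2).sum ∧ f.2.2 = e.2.2 ++ sel.map Prod.fst := by
  induction os generalizing S with
  | nil => exact ⟨f, hf, [], .nil, by simp, by simp, by simp⟩
  | cons o os ih =>
    obtain ⟨e, he, sel, h1, h2, h3, h4⟩ := ih _ hf
    obtain ⟨e', he', o', ho', k2, k3, k4⟩ := mem_dpStep he
    refine ⟨e', he', o' :: sel, .cons ho' h1, fun j hj => ?_, ?_, ?_⟩
    · rw [h2 j hj, k2 j hj, List.map_cons, List.sum_cons, add_assoc]
    · rw [h3, k3, List.map_cons, List.sum_cons, add_assoc]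
    · rw [h4, k4, List.map_cons, List.append_assoc, List.singleton_append]

/-- The vectors have natural entries, so partial sums are bounded by the total and stay in the grid.
Among entries with the same vector one of best score suffices, because later options change vector
and score independently of the past. -/
theorem dp_complete {M B : ℕ} (os : List (List (ℕ × List ℕ × ℚ)))
    (S : List (List ℕ × ℚ × List ℕ)) {e : List ℕ × ℚ × List ℕ} (he : e ∈ S)
    {sel : List (ℕ × List ℕ × ℚ)} (hsel : List.Forall₂ (fun o l => o ∈ l) sel os)
    (hB : ∀ j < M, e.1.getD j 0 + (sel.map fun o => o.2.1.getD j 0).sum ≤ B) :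
    ∃ f ∈ os.foldl (dpStep (List.range M) (tuples (List.range (B + 1)) M)) S,
      (∀ j < M, f.1.getD j 0 = e.1.getD j 0 + (sel.map fun o => o.2.1.getD j 0).sum) ∧
      e.2.1 + (sel.map fun o => o.2.2).sum ≤ f.2.1 := by
  induction hsel generalizing S e with
  | nil => exact ⟨e, he, by simp, by simp⟩
  | @cons o l sel os ho h ih =>
    simp only [List.map_cons, List.sum_cons] at hB ⊢
    let t := (List.range M).map fun j => e.1.getD j 0 + o.2.1.getD j 0
    have ht : t ∈ tuples (List.range (B + 1)) M := by
      refine mem_tuples.2 ⟨by simp [t], fun a ha => ?_⟩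
      obtain ⟨j, hj, rfl⟩ := List.mem_map.1 ha
      have := hB j (List.mem_range.1 hj)
      exact List.mem_range.2 (by omega)
    have ht' : ∀ j < M, t.getD j 0 = e.1.getD j 0 + o.2.1.getD j 0 :=
      fun j hj => getD_map_range hj _
    obtain ⟨f, hf, hft, hfs⟩ := exists_mem_dpStep he ho ht ht'
    obtain ⟨f', hf', h1, h2⟩ := ih _ hf fun j hj => by
      rw [hft, ht' j hj, add_assoc]; exact hB j hj
    refine ⟨f', hf', fun j hj => ?_, ?_⟩
    · rw [h1 j hj, hft, ht' j hj, add_assoc]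
    · linarith

/-! ### Agreement of the program's estimates with those of the algorithm. -/

section Estimates

variable {I : UCInstance} {T : List Piece} {M : ℕ} (g : Fin M → PUtil) (C : I.Config)

theorem getD_ofFn (j : Fin M) : (List.ofFn g).getD j (toLex (⊥, 0)) = g j := by
  simp [List.getD_eq_getElem?_getD]

theorem inBin_iff (j : Fin M) (u : PUtil) :
    inBin (List.range M) M (List.ofFn g) j u = true ↔ InBin g j u := by
  simp only [inBin, InBin, Bool.and_eq_true, List.all_eq_true, List.mem_range, Bool.or_eq_true,
    Bool.not_eq_true', decide_eq_true_eq, getD_ofFn, utilLe_iff,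
    ← Bool.not_eq_true, not_le]
  refine and_congr ⟨fun h k hk => ?_, fun h k hk => ?_⟩ (or_congr Iff.rfl (and_congr_right' ?_))
  · have := (h k k.2).resolve_left (not_not.2 hk)
    rwa [getD_ofFn] at this
  · rw [or_iff_not_imp_left, not_not]
    intro e
    have := h ⟨k, hk⟩ e
    rwa [← getD_ofFn g] at this
  · exact ⟨fun h => le_antisymm h.1 h.2, fun h => ⟨h.le, h.ge⟩⟩

theorem inBinLe_iff (j : Fin M) (u : PUtil) :
    inBinLe (List.range M) M (List.ofFn g) j u = true ↔ InBinLe g j u := by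
  simp only [inBinLe, InBinLe, List.any_eq_true, List.mem_range, Bool.and_eq_true,
    decide_eq_true_eq]
  constructor
  · rintro ⟨k, hk, h1, h2⟩
    exact ⟨⟨k, hk⟩, h1, (inBin_iff g ⟨k, hk⟩ u).1 h2⟩
  · rintro ⟨k, h1, h2⟩
    exact ⟨k, k.2, h1, (inBin_iff g k u).2 h2⟩

theorem law_eq (i : Fin I.length) : law T i (C i) = newLaw I T C i := by
  simp [law, newLaw]

theorem bif_eq_ite {α : Type} {b : Bool} {p : Prop} [Decidable p] (h : b = true ↔ p) (x y : α) :
    (bif b then x else y) = if p then x else y := by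
  by_cases hp : p
  · simp [h.2 hp, hp]
  · have : b = false := by simpa using mt h.1 hp
    simp [this, hp]

theorem cumProb_eq (j : Fin M) (i : Fin I.length) :
    cumProb (List.range M) M T (List.ofFn g) i (C i) j = _root_.cumProb I T g C j i := by
  simp only [cumProb, law_eq, _root_.cumProb, bif_eq_ite (inBinLe_iff g j _)]

theorem condBinProb_eq (j : Fin M) (i : Fin I.length) :
    condBinProb (List.range M) M T (List.ofFn g) i (C i) j = _root_.condBinProb I T g C j i := by
  simp only [condBinProb, law_eq, _root_.condBinProb, bif_eq_ite (inBin_iff g j _), cumProb_eq]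

theorem condBinUtil_eq (j : Fin M) (i : Fin I.length) :
    condBinUtil (List.range M) M T (List.ofFn g) i (C i) j = _root_.condBinUtil I T g C j i := by
  simp only [condBinUtil, law_eq, _root_.condBinUtil, bif_eq_ite (inBin_iff g j _), cumProb_eq]

/-- The options that a configuration selects. -/
def selection (T : List Piece) : List (ℕ × List ℕ × ℚ) :=
  List.ofFn fun i => (((C i : ℕ), roundVec (List.range M) M I.length T (List.ofFn g) i (C i),
    score (List.range M) M T (List.ofFn g) i (C i)) : ℕ × List ℕ × ℚ)

theorem mem_options (i : Fin I.length) (o : ℕ × List ℕ × ℚ) :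
    (∃ h, o ∈ (options (List.range M) M T I (List.ofFn g))[(i : ℕ)]'h) ↔
      ∃ c : Fin (I.get i).length,
        (∀ j < M, 0 < cumProb (List.range M) M T (List.ofFn g) i c j) ∧
        o = ((c : ℕ), roundVec (List.range M) M I.length T (List.ofFn g) i c,
          score (List.range M) M T (List.ofFn g) i c) := by
  simp only [options, List.getElem_map, List.getElem_zipIdx, List.mem_map, List.mem_filter,
    List.all_eq_true, List.mem_range, Bool.not_eq_true', decide_eq_false_iff_not, not_le, zero_add]
  constructor
  · rintro ⟨h, D, ⟨h1, h2⟩, rfl⟩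
    have h3 := List.mem_zipIdx h1
    exact ⟨⟨D.2, by simpa using h3.2.1⟩, h2, rfl⟩
  · rintro ⟨c, h1, rfl⟩
    refine ⟨by simp, ((I.get i)[(c : ℕ)], c), ⟨?_, h1⟩, rfl⟩
    rw [List.mem_zipIdx_iff_getElem?]
    exact List.getElem?_eq_getElem c.2

/-- A choice of one listed option per action is the same as a configuration for which all
conditional probabilities are defined. -/
theorem forall₂_options (sel : List (ℕ × List ℕ × ℚ)) :
    List.Forall₂ (fun o l => o ∈ l) sel (options (List.range M) M T I (List.ofFn g)) ↔
      ∃ C : I.Config, (∀ j i, 0 < _root_.cumProb I T g C j i) ∧ sel = selection g C T := by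
  have hlen : (options (List.range M) M T I (List.ofFn g)).length = I.length := by
    simp [options]
  rw [List.forall₂_iff_get]
  constructor
  · rintro ⟨h1, h2⟩
    have hi' : ∀ i : Fin I.length, (i : ℕ) < sel.length := fun i => by
      rw [h1, hlen]; exact i.2
    have h3 : ∀ i : Fin I.length, ∃ c : Fin (I.get i).length,
        (∀ j < M, 0 < cumProb (List.range M) M T (List.ofFn g) i c j) ∧
        sel[(i : ℕ)]'(hi' i) = ((c : ℕ),
          roundVec (List.range M) M I.length T (List.ofFn g) i c,
          score (List.range M) M T (List.ofFn g) i c) := fun i =>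
      (mem_options g i _).1 ⟨by rw [hlen]; exact i.2, h2 i (hi' i) (by rw [hlen]; exact i.2)⟩
    choose C hC1 hC2 using h3
    refine ⟨C, fun j i => by rw [← cumProb_eq]; exact hC1 i j j.2, ?_⟩
    refine List.ext_getElem (by simp [selection, h1, hlen]) fun i hi _ => ?_
    rw [hC2 ⟨i, by rwa [h1, hlen] at hi⟩]
    simp [selection]
  · rintro ⟨C, hC, rfl⟩
    refine ⟨by rw [hlen]; simp [selection], fun i hi hi' => ?_⟩
    have hi2 : i < I.length := by simpa [selection] using hi
    have := (mem_options g ⟨i, hi2⟩ ((selection g C T).get ⟨i, hi⟩)).2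
      ⟨C ⟨i, hi2⟩, fun j hj => by
        have h := hC ⟨j, hj⟩ ⟨i, hi2⟩
        rwa [← cumProb_eq] at h, by simp [selection]⟩
    exact this.2

theorem sum_map_range {R : Type} [AddCommMonoid R] (M : ℕ) (f : ℕ → R) :
    ((List.range M).map f).sum = ∑ j : Fin M, f j := by
  rw [← Finset.sum_range]
  induction M with
  | zero => rfl
  | succ M ih => rw [List.range_succ, Finset.sum_range_succ, List.map_append, List.sum_append, ih,
      List.map_singleton, List.sum_singleton]

theorem sum_selection_score :
    ((selection g C T).map fun o => o.2.2).sum = utilEst I T g C := by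
  rw [selection, List.map_ofFn, List.sum_ofFn]
  have : ∀ i : Fin I.length, score (List.range M) M T (List.ofFn g) i (C i) =
      ∑ j : Fin M, if 6 ≤ (j : ℕ) + 1 then (((j : ℕ) + 1 : ℚ) - 5) / ((M : ℚ) - 1) *
        _root_.condBinUtil I T g C j i else 0 := by
    intro i
    rw [score, sum_map_range]
    refine Finset.sum_congr rfl fun j _ => ?_
    rw [condBinUtil_eq, bif_eq_ite decide_eq_true_iff]
  simp only [Function.comp_def, this]
  rw [utilEst, Finset.sum_comm]
  refine Finset.sum_congr rfl fun j _ => ?_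
  split_ifs
  · rw [Finset.mul_sum]
  · simp

theorem condBinProb_nonneg (hP : IsPieceSystem M (configPieces I T C)) (hT : T.Nodup) (j : Fin M)
    (i : Fin I.length) : 0 ≤ _root_.condBinProb I T g C j i := by
  rw [_root_.condBinProb, _root_.cumProb, sum_newLaw hT, sum_newLaw hT]
  refine div_nonneg (Finset.sum_nonneg fun x hx => ?_) (Finset.sum_nonneg fun x hx => ?_) <;>
  · have := hP.prob_nonneg i x hx
    split_ifs <;> simp [this]

theorem condBinProb_le_one (hP : IsPieceSystem M (configPieces I T C)) (hT : T.Nodup) (j : Fin M)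
    (i : Fin I.length) : _root_.condBinProb I T g C j i ≤ 1 := by
  rw [_root_.condBinProb, _root_.cumProb, sum_newLaw hT, sum_newLaw hT]
  refine div_le_one_of_le₀ (Finset.sum_le_sum fun x hx => ?_) (Finset.sum_nonneg fun x hx => ?_)
  · have := hP.prob_nonneg i x hx
    by_cases h : InBin g j x.agent
    · have h' : InBinLe g j x.agent := ⟨j, le_rfl, h⟩
      rw [if_pos h, if_pos h']
    · rw [if_neg h]
      split_ifs <;> simp [this]
  · have := hP.prob_nonneg i x hx
    split_ifs <;> simp [this]

theorem sum_selection_vec (j : Fin M) :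
    ((selection g C T).map fun o => o.2.1.getD j 0).sum =
      ∑ i, ⌊_root_.condBinProb I T g C j i * ((M : ℚ) * M * I.length)⌋₊ := by
  rw [selection, List.map_ofFn, List.sum_ofFn]
  refine Finset.sum_congr rfl fun i _ => ?_
  simp only [Function.comp_def, roundVec]
  rw [getD_map_range j.2, condBinProb_eq]

theorem sum_selection_vec_le (hP : IsPieceSystem M (configPieces I T C)) (hT : T.Nodup)
    (j : Fin M) : ((selection g C T).map fun o => o.2.1.getD j 0).sum ≤
      M * M * I.length * I.length := by
  rw [sum_selection_vec]
  refine (Finset.sum_le_card_nsmul _ _ (M * M * I.length) fun i _ => ?_).trans ?_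
  · refine Nat.floor_le_of_le ?_
    push_cast
    exact mul_le_of_le_one_left (by positivity) (condBinProb_le_one g C hP hT j i)
  · simp [mul_comm]

/-- The summands are nonnegative, so natural and integer floors agree and the estimate is the
integer vector of the dynamic program up to scaling. -/
theorem roundedEst_eq (hP : IsPieceSystem M (configPieces I T C)) (hT : T.Nodup)
    (j : Fin M) : roundedEst I T g C j =
      (((selection g C T).map fun o => o.2.1.getD j 0).sum : ℕ) / ((M : ℚ) * M * I.length) := by
  rw [sum_selection_vec, roundedEst, Nat.cast_sum, Finset.sum_div]
  refine Finset.sum_congr rfl fun i _ => ?_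
  rw [pow_two]
  congr 1
  have h := condBinProb_nonneg g C hP hT j i
  rw [natCast_floor_eq_intCast_floor (mul_nonneg h (by positivity))]

theorem vecOk_iff (hP : IsPieceSystem M (configPieces I T C)) (hT : T.Nodup) {v : List ℕ}
    (hv : ∀ j < M, v.getD j 0 = ((selection g C T).map fun o => o.2.1.getD j 0).sum)
    (hC : ∀ j i, 0 < _root_.cumProb I T g C j i) :
    vecOk (List.range M) M I.length v = true ↔ Feasible I T g C := by
  simp only [vecOk, List.all_eq_true, List.mem_range, Bool.and_eq_true, decide_eq_true_eq,
    Bool.or_eq_true, Bool.not_eq_true', decide_eq_false_iff_not]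
  constructor
  · intro h
    refine ⟨hC, fun j => ?_, fun j hj => ?_⟩
    · have := (h j j.2).1
      rwa [hv j j.2, ← roundedEst_eq g C hP hT, ← pow_two] at this
    · have := (h j j.2).2.resolve_left (not_not.2 hj)
      rwa [hv j j.2, ← roundedEst_eq g C hP hT] at this
  · intro h j hj
    rw [hv j hj, ← roundedEst_eq g C hP hT ⟨j, hj⟩, ← pow_two, or_iff_not_imp_left, not_not]
    exact ⟨h.lower ⟨j, hj⟩, h.upper ⟨j, hj⟩⟩

/-- A configuration as a list of natural numbers. -/
def choiceList (C : I.Config) : List ℕ := List.ofFn fun i => (C i : ℕ)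

theorem selection_map_fst : (selection g C T).map Prod.fst = choiceList C := by
  simp [selection, List.map_ofFn, Function.comp_def, choiceList]

theorem exists_innerSolution (hT : T.Nodup)
    (hP : ∀ C : I.Config, IsPieceSystem M (configPieces I T C)) (g : Fin M → PUtil) :
    ∃ s : Option I.Config, IsInnerSolution I T g s ∧
      inner (List.range M) (tuples (List.range (M * M * I.length * I.length + 1)) M) M T I
        (List.ofFn g) = s.map choiceList := by
  have complete : ∀ C : I.Config, Feasible I T g C → ∃ e ∈ (dp (List.range M)
      (tuples (List.range (M * M * I.length * I.length + 1)) M)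
        (options (List.range M) M T I (List.ofFn g))).filter fun e =>
          vecOk (List.range M) M I.length e.1, utilEst I T g C ≤ e.2.1 := by
    intro C hC
    obtain ⟨f, hf, h1, h2⟩ := dp_complete (M := M) (B := M * M * I.length * I.length)
      (options (List.range M) M T I (List.ofFn g)) [([], 0, [])] (e := ([], 0, []))
      (List.mem_singleton_self _) ((forall₂_options g _).2 ⟨C, hC.cond_defined, rfl⟩)
      fun j hj => by
        rw [List.getD_nil, zero_add]
        exact sum_selection_vec_le g C (hP C) hT ⟨j, hj⟩
    refine ⟨f, List.mem_filter.2 ⟨hf, ?_⟩, ?_⟩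
    · refine (vecOk_iff g C (hP C) hT (fun j hj => ?_) hC.cond_defined).2 hC
      rw [h1 j hj, List.getD_nil, zero_add]
    · rwa [sum_selection_score, zero_add] at h2
  rw [inner]
  generalize hb : best (fun e : List ℕ × ℚ × List ℕ => e.2.1) ((dp (List.range M)
      (tuples (List.range (M * M * I.length * I.length + 1)) M)
        (options (List.range M) M T I (List.ofFn g))).filter fun e =>
          vecOk (List.range M) M I.length e.1) = b
  rcases b with _ | e
  · refine ⟨none, fun C hC => ?_, rfl⟩
    obtain ⟨e, he, -⟩ := complete C hC
    rw [best_eq_none hb] at he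
    simp at he
  · obtain ⟨h1, h2⟩ := best_eq_some hb
    obtain ⟨h1, h3⟩ := List.mem_filter.1 h1
    obtain ⟨e', he', sel, k1, k2, k3, k4⟩ := dp_sound _ _ h1
    obtain rfl := List.mem_singleton.1 he'
    obtain ⟨C, hC, rfl⟩ := (forall₂_options g sel).1 k1
    have hf : Feasible I T g C := (vecOk_iff g C (hP C) hT (fun j hj => by
      rw [k2 j hj, List.getD_nil, zero_add]) hC).1 h3
    refine ⟨some C, ⟨hf, fun C' hC' => ?_⟩, ?_⟩
    · obtain ⟨e', he', h4⟩ := complete C' hC'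
      refine h4.trans ((h2 e' he').trans ?_)
      rw [k3, zero_add, sum_selection_score]
    · simp [k4, selection_map_fst]

theorem isMono_iff : isMono (List.range M) (List.ofFn g) = true ↔ Monotone g := by
  simp only [isMono, List.all_eq_true, List.mem_range, Bool.or_eq_true, Bool.not_eq_true',
    decide_eq_false_iff_not, utilLe_iff]
  constructor
  · intro h j k hjk
    have := (h j j.2 k k.2).resolve_left (not_not.2 hjk)
    rwa [getD_ofFn, getD_ofFn] at this
  · intro h j hj k hk
    rw [or_iff_not_imp_left, not_not]
    intro hjk
    have := h (show (⟨j, hj⟩ : Fin M) ≤ ⟨k, hk⟩ from hjk)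
    rwa [← getD_ofFn g, ← getD_ofFn g] at this

theorem choiceList_getD (i : Fin I.length) : (choiceList C).getD i 0 = C i := by
  simp [choiceList, List.getD_eq_getElem?_getD]

theorem probLt_eq (hT : T.Nodup) (i : Fin I.length) (u : PUtil) :
    probLt T i (C i) u = _root_.probLt (configPieces I T C) i u := by
  rw [probLt, _root_.probLt, law_eq, sum_newLaw hT]
  refine Finset.sum_congr rfl fun x _ => bif_eq_ite ?_ _ _
  rw [Bool.not_eq_true', ← Bool.not_eq_true, utilLe_iff, not_le]

theorem value_eq (hT : T.Nodup) (hact : ∀ x ∈ T, x.action < I.length) :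
    value (List.range I.length) T (choiceList C) =
      winMean (configPieces I T C) Piece.principal := by
  -- The program runs through all pieces at once; here the sum is grouped by action.
  have h1 : ∀ l : List Piece, (∀ x ∈ l, x.action < I.length) → ∀ F : Piece → ℚ, (l.map F).sum =
      ∑ i : Fin I.length, ((l.filter fun x => x.action = (i : ℕ)).map F).sum := by
    intro l hl F
    induction l with
    | nil => simp
    | cons a l ih =>
      have h2 : ∀ i : Fin I.length, (((a :: l).filter fun x => x.action = (i : ℕ)).map F).sum =
          (if (⟨a.action, hl a List.mem_cons_self⟩ : Fin I.length) = i then F a else 0) +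
            ((l.filter fun x => x.action = (i : ℕ)).map F).sum := by
        intro i
        by_cases h : a.action = (i : ℕ)
        · simp [h]
        · have : (⟨a.action, hl a List.mem_cons_self⟩ : Fin I.length) ≠ i := fun e => h (by simp [← e])
          simp [h, this]
      rw [Finset.sum_congr rfl fun i _ => h2 i, Finset.sum_add_distrib, Finset.sum_ite_eq,
        if_pos (Finset.mem_univ _), ← ih fun x hx => hl x (List.mem_cons_of_mem _ hx)]
      simp
  rw [value, h1 _ (fun x hx => hact x (List.mem_filter.1 hx).1), winMean]
  refine Finset.sum_congr rfl fun i _ => ?_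
  have h2 : ((T.filter fun x => decide (x.config = (choiceList C).getD x.action 0)).filter
      fun x => x.action = (i : ℕ)) = newLaw I T C i := by
    rw [List.filter_filter, newLaw]
    refine List.filter_congr fun x _ => ?_
    by_cases h : x.action = (i : ℕ)
    · rw [h, choiceList_getD]
      simp
    · simp [h]
  rw [h2, sum_newLaw hT]
  refine Finset.sum_congr rfl fun x hx => ?_
  have hx' := (mem_configPieces.1 hx).2.1
  have h3 : ((List.range I.length).map fun k => bif decide (k = x.action) then 1 else
      probLt T k ((choiceList C).getD k 0) x.agent).prod =
      ∏ k ∈ univ.erase i, _root_.probLt (configPieces I T C) k x.agent := by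
    have h4 : ∀ n (f : ℕ → ℚ), ((List.range n).map f).prod = ∏ k : Fin n, f k := by
      intro n f
      rw [← Finset.prod_range]
      induction n with
      | zero => rfl
      | succ n ih => rw [List.range_succ, Finset.prod_range_succ, List.map_append,
          List.prod_append, ih, List.map_singleton, List.prod_singleton]
    rw [h4, ← Finset.mul_prod_erase univ _ (Finset.mem_univ i)]
    simp only [hx', decide_true, cond_true, one_mul]
    refine Finset.prod_congr rfl fun k hk => ?_
    have : (k : ℕ) ≠ i := fun e => Finset.ne_of_mem_erase hk (Fin.ext e)
    simp only [this, decide_false, cond_false]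
    rw [choiceList_getD, probLt_eq C hT]
  rw [h3, winProb]
  ring

end Estimates

theorem outer_spec {M : ℕ} (hM : 1 ≤ M) {I : UCInstance} (hI : I.Valid) {L : List Mass}
    (hL : L.Perm I.masses) (hs : L.Pairwise fun x y => x.principal ≤ y.principal) :
    ∃ C : I.Config, IsAlgOutput M I C ∧
      outer (List.range M) (List.range I.length)
        (tuples (List.range (M * M * I.length * I.length + 1)) M) M (_root_.pieces M L) I
        (tuples ((_root_.pieces M L).map Piece.agent) M) = List.ofFn fun i => (C i : ℕ) := by
  have hT := pieces_nodup M L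
  have hP := isPieceSystem hI hM hL hs
  have hact : ∀ x ∈ _root_.pieces M L, x.action < I.length := by
    intro x hx
    obtain ⟨m, hm, y, hy, e, -⟩ := exists_mass_of_mem_pieces hx
    obtain ⟨A, hA, D, hD, z, hz, -, -, h⟩ := mem_masses (hL.subset hm)
    rw [e, (split_fields hy).1]
    exact h
  choose sol hsol1 hsol2 using exists_innerSolution (M := M) hT hP
  have hval : ∀ C : I.Config, value (List.range I.length) (_root_.pieces M L) (choiceList C) =
      I.value C := fun C => by rw [value_eq C hT hact, value_eq_winMean (hP C) hL]
  have hg : ∀ g : Fin M → PUtil, IsGuess (_root_.pieces M L) g → List.ofFn g ∈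
      (tuples ((_root_.pieces M L).map Piece.agent) M).filter (isMono (List.range M)) := by
    intro g hg
    refine List.mem_filter.2 ⟨mem_tuples.2 ⟨by simp, fun a ha => ?_⟩, (isMono_iff g).2 hg.1⟩
    obtain ⟨j, rfl⟩ := (List.mem_ofFn' _ _).1 ha
    obtain ⟨x, hx, e⟩ := hg.2 j
    exact List.mem_map.2 ⟨x, hx, e⟩
  have hg' : ∀ l ∈ (tuples ((_root_.pieces M L).map Piece.agent) M).filter
      (isMono (List.range M)), ∃ g : Fin M → PUtil, IsGuess (_root_.pieces M L) g ∧
        List.ofFn g = l := by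
    intro l hl
    obtain ⟨h1, h2⟩ := List.mem_filter.1 hl
    obtain ⟨hlen, h3⟩ := mem_tuples.1 h1
    have e : List.ofFn (fun j : Fin M => l.get (j.cast hlen.symm)) = l :=
      List.ext_getElem (by simp [hlen]) fun i _ _ => by simp
    refine ⟨_, ⟨(isMono_iff _).1 (e.symm ▸ h2), fun j => ?_⟩, e⟩
    obtain ⟨x, hx, e⟩ := List.mem_map.1 (h3 _ (List.get_mem l (j.cast hlen.symm)))
    exact ⟨x, hx, e⟩
  rw [outer]
  generalize hb : best (value (List.range I.length) (_root_.pieces M L))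
    (((tuples ((_root_.pieces M L).map Piece.agent) M).filter (isMono (List.range M))).filterMap
      (inner (List.range M) (tuples (List.range (M * M * I.length * I.length + 1)) M) M
        (_root_.pieces M L) I)) = b
  rcases b with _ | ch
  -- If no guess has a feasible configuration, the program returns the first configuration of each
  -- action, which exists by validity.
  · have hz : ∀ i : Fin I.length, 0 < (I.get i).length := fun i =>
      List.length_pos_iff.2 (hI.has_config _ (List.get_mem _ _))
    refine ⟨fun i => ⟨0, hz i⟩, ⟨L, hL, hs, sol, fun g _ => hsol1 g, fun g hg0 C' h => ?_,
      .inr fun g hg0 => ?_⟩, ?_⟩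
    · have : choiceList C' ∈ ((tuples ((_root_.pieces M L).map Piece.agent) M).filter
          (isMono (List.range M))).filterMap (inner (List.range M)
            (tuples (List.range (M * M * I.length * I.length + 1)) M) M (_root_.pieces M L) I) :=
        List.mem_filterMap.2 ⟨_, hg g hg0, by rw [hsol2, h]; rfl⟩
      rw [best_eq_none hb] at this
      simp at this
    · rcases h : sol g with _ | C'
      · rfl
      · have : choiceList C' ∈ ((tuples ((_root_.pieces M L).map Piece.agent) M).filter
          (isMono (List.range M))).filterMap (inner (List.range M)
            (tuples (List.range (M * M * I.length * I.length + 1)) M) M (_root_.pieces M L) I) :=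
          List.mem_filterMap.2 ⟨_, hg g hg0, by rw [hsol2, h]; rfl⟩
        rw [best_eq_none hb] at this
        simp at this
    · simp only [Option.elim]
      refine List.ext_getElem (by simp) fun i _ _ => by simp
  · obtain ⟨h1, h2⟩ := best_eq_some hb
    obtain ⟨l, hl, h3⟩ := List.mem_filterMap.1 h1
    obtain ⟨g, hg0, rfl⟩ := hg' l hl
    rw [hsol2, Option.map_eq_some_iff] at h3
    obtain ⟨C, hC, rfl⟩ := h3
    refine ⟨C, ⟨L, hL, hs, sol, fun g _ => hsol1 g, fun g' hg0' C' h => ?_,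
      .inl ⟨g, hg0, hC⟩⟩, rfl⟩
    rw [← hval, ← hval]
    exact h2 _ (List.mem_filterMap.2 ⟨_, hg g' hg0', by rw [hsol2, h]; rfl⟩)

theorem main_spec {M : ℕ} (hM : 1 ≤ M) {I : UCInstance} (hI : I.Valid) :
    ∃ C : I.Config, IsAlgOutput M I C ∧ main M I = List.ofFn fun i => (C i : ℕ) := by
  have hL : (sortMasses (masses I)).Perm I.masses := sortMasses_perm _
  have hprob : ∀ x ∈ sortMasses (masses I), x.prob ≤ 1 := by
    intro x hx
    obtain ⟨A, hA, D, hD, z, hz, -, e, -⟩ := mem_masses (hL.subset hx)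
    have hd := hI.dist A hA D hD
    rw [e, ← hd.2]
    exact List.single_le_sum (by
      intro q hq
      obtain ⟨y, hy, rfl⟩ := List.mem_map.1 hq
      exact (hd.1 y hy).le) _ (List.mem_map_of_mem hz)
  have h := outer_spec hM hI hL (sortMasses_sorted (masses I))
  rwa [← pieces_eq hprob] at h

end Impl

/-! ### Polynomial running time for a fixed parameter -/

/-- Elements of `α` with property `P`, with additional weight `E`. -/
def Padded (α : Type) (P : α → Prop) (_ : α → ℕ) : Type := {x : α // P x}

instance {α : Type} [Data α] {P : α → Prop} {E : α → ℕ} : Data (Padded α P E) where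
  ty := ty α
  enc x := enc x.1
  wt x := wt x.1 + E x.1
  size_le x := (size_le x.1).trans (Nat.le_add_right _ _)

/-- Types whose weights are bounded by sizes. -/
class TameData (α : Type) [Data α] : Prop where
  wt_le : ∀ x : α, wt x ≤ 2 * (ty α).size (enc x)

instance : TameData ℚ := ⟨fun x => by
  show 2 * ratHeight x + 1 ≤ 2 * (Nat.size x.num.natAbs + Nat.size x.den + 1)
  unfold ratHeight
  omega⟩

instance {α β : Type} [Data α] [Data β] [TameData α] [TameData β] : TameData (α × β) := ⟨fun x => by
  have h1 := TameData.wt_le x.1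
  have h2 := TameData.wt_le x.2
  show wt x.1 + wt x.2 + 1 ≤ 2 * ((ty α).size (enc x.1) + (ty β).size (enc x.2) + 1)
  omega⟩

instance {α : Type} [Data α] [TameData α] : TameData (Option α) := ⟨fun x => by
  rcases x with _ | x
  · exact show 1 ≤ 2 * 1 by norm_num
  · have h1 := TameData.wt_le x
    show wt x + 1 ≤ 2 * ((ty α).size (enc x) + 1)
    omega⟩

instance {α : Type} [Data α] [TameData α] : TameData (List α) := ⟨fun l => by
  induction l with
  | nil => exact show 1 ≤ 2 * 1 by norm_num
  | cons a l ih =>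
    have h1 := TameData.wt_le a
    have h2 : (ty (List α)).size (enc (a :: l)) =
      ((ty α).size (enc a) + 1) + ((ty (List α)).size (enc l) - 1) + 1 := by
      show _ = ((ty α).size (enc a) + 1) + (((l.map enc).map fun x => (ty α).size x + 1).sum + 1 - 1)
        + 1
      rw [Nat.add_sub_cancel]
      rfl
    have h3 : 1 ≤ (ty (List α)).size (enc l) := Nat.le_add_left _ _
    rw [PolyTime.wt_cons]
    omega⟩

theorem length_masses_le (I : RawUC) : (Impl.masses I).length ≤ wt I := by
  have key : ∀ {α β : Type} [Data α] (l : List α) (f : α × ℕ → List β) (s : ℕ),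
      (∀ x, (f x).length ≤ wt x.1) → ((l.zipIdx s).flatMap f).length ≤ wt l := by
    intro α β _ l f s hf
    induction l generalizing s with
    | nil => simp
    | cons a l ih =>
      rw [List.zipIdx_cons, List.flatMap_cons, List.length_append, PolyTime.wt_cons]
      have := ih (s + 1)
      have := hf (a, s)
      simp only at this
      omega
  refine key I _ 0 fun A => key A.1 _ 0 fun D => ?_
  rw [List.length_map]
  exact length_le_wt _

theorem length_pieces_le (M : ℕ) (L : List Mass) :
    (Impl.pieces M L).length ≤ L.length * (M * M + 1) := by
  rw [Impl.pieces, List.length_map, List.length_zipIdx, List.length_flatMap]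
  refine (List.sum_le_card_nsmul _ (M * M + 1) fun k hk => ?_).trans (by simp)
  obtain ⟨x, -, rfl⟩ := List.mem_map.1 hk
  rw [Impl.split, List.length_append, List.length_replicate, List.length_singleton]
  by_cases h : ⌊x.prob * ((M : ℚ) * M)⌋₊ ≤ M * M <;> simp [h]

namespace PolyTime

variable {Γ α β : Type} [Data Γ] [Data α] [Data β]

/-- Both the grid and the list of guesses consist of `M`-tuples over lists of length below `(wt I +
M + 2)^4`. With `(wt I + M + 2)^(M+1)` polynomially bounded, so are their lengths, and everything
else is polynomial. -/
theorem main {M : Γ → ℕ} {I : Γ → RawUC} (hM : PolyTime M) (hI : PolyTime I)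
    (hb : PolyBdd fun x => (wt (I x) + M x + 2) ^ (M x + 1)) :
    PolyTime fun x => Impl.main (M x) (I x) := by
  have hw : PolyBdd fun x => wt (I x) + M x + 2 := hb.mono fun x => by
    rw [pow_succ]
    exact Nat.le_mul_of_pos_left _ (by positivity)
  have hM' : PolyBdd M := hw.mono fun x => by omega
  have hn : PolyBdd fun x => (I x).length := hw.mono fun x => by
    have := length_le_wt (I x); omega
  have hpow : ∀ f : Γ → ℕ, (∀ x, f x ≤ (wt (I x) + M x + 2) ^ 4) → PolyBdd fun x => f x ^ M x := by
    intro f hf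
    refine (hb.pow 4).mono fun x => ?_
    rw [← pow_mul, mul_comm, pow_mul]
    refine (Nat.pow_le_pow_left (hf x) _).trans ?_
    exact Nat.pow_le_pow_right (by positivity) (by omega)
  have hlen := hI.length
  have h1 : PolyTime fun x => List.range (M x) := hM.range hM'
  have h2 : PolyTime fun x => List.range (I x).length := hlen.range hn
  have hB : PolyTime fun x => M x * M x * (I x).length * (I x).length + 1 := by fun_prop
  have h3 : PolyTime fun x => List.range (M x * M x * (I x).length * (I x).length + 1) :=
    hB.range ((((hM'.mul hM').mul hn).mul hn).add (.const 1))
  have h4 := h3.tuples hM hM' (hpow _ fun x => by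
    have := length_le_wt (I x)
    rw [List.length_range]
    calc M x * M x * (I x).length * (I x).length + 1 + 1
        ≤ (wt (I x) + M x) * (wt (I x) + M x) * (wt (I x) + M x) * (wt (I x) + M x) + 1 + 1 := by
          gcongr <;> omega
      _ ≤ (wt (I x) + M x + 2) ^ 4 := by nlinarith [sq_nonneg (wt (I x) + M x)])
  have h5 : PolyTime fun x => Impl.pieces (M x) (Impl.sortMasses (Impl.masses (I x))) :=
    pieces hM hM' (sortMasses (by fun_prop))
  have h6 : PolyTime fun x =>
      (Impl.pieces (M x) (Impl.sortMasses (Impl.masses (I x)))).map Piece.agent := by fun_prop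
  have h7 := h6.tuples hM hM' (hpow _ fun x => by
    have e1 := length_pieces_le (M x) (Impl.sortMasses (Impl.masses (I x)))
    have e2 := length_masses_le (I x)
    rw [(Impl.sortMasses_perm _).length_eq] at e1
    rw [List.length_map]
    refine (Nat.succ_le_succ (e1.trans (Nat.mul_le_mul_right _ e2))).trans ?_
    calc wt (I x) * (M x * M x + 1) + 1 ≤ (wt (I x) + M x) * ((wt (I x) + M x) *
          (wt (I x) + M x) + 1) + 1 := by gcongr <;> omega
      _ ≤ (wt (I x) + M x + 2) ^ 4 := by nlinarith [sq_nonneg (wt (I x) + M x)])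
  unfold Impl.main
  exact outer h1 h2 h4 hM h5 hI h7

theorem padded_val {P : α → Prop} {E : α → ℕ} {f : α → β} (hf : PolyTime f) :
    PolyTime fun x : Padded α P E => f x.1 := by
  have h : PolyTime fun x : Padded α P E => x.1 :=
    ⟨(PolyTime.id (Γ := Padded α P E)).exists_prog, PolyBdd.wt'.mono fun x => Nat.le_add_right _ _⟩
  exact hf.comp h

/-- Padding changes the weight but not the encoding, so the program obtained is one for `α` itself;
the extra weight reappears only in its time bound. -/
theorem padded_prog {P : α → Prop} {E : α → ℕ} {f : α → β}
    (hf : PolyTime fun x : Padded α P E => f x.1) :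
    ∃ A : Prog (ty α) (ty β), (∀ x, P x → A.eval (enc x) = enc (f x)) ∧
      ∃ k, ∀ x, P x → A.time (enc x) ≤ (wt x + E x + 2) ^ k := by
  obtain ⟨A, h1, k, h2⟩ := hf.exists_prog
  exact ⟨A, fun x hx => h1 ⟨x, hx⟩, k, fun x hx => h2 ⟨x, hx⟩⟩

end PolyTime

theorem enc_rawUC (I : RawUC) : (enc I : ucTy.Val) = I :=
  List.map_id'' (fun A => List.map_id'' (fun D => List.map_id'' (fun x => by
    rcases x with ⟨⟨_ | q, u⟩, p⟩ <;> rfl) D) A) I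

theorem enc_listNat (l : List ℕ) : (enc l : (Ty.list .nat).Val) = l := List.map_id'' (fun _ => rfl) l

theorem exists_program : ∃ A : Prog (.prod .nat ucTy) (.list .nat),
    (∀ M : ℕ, 1 ≤ M → ∃ p : Polynomial ℕ, ∀ I : UCInstance, I.Valid →
      A.time (M, I) ≤ p.eval (ucTy.size I)) ∧
    ∀ M : ℕ, 1 ≤ M → ∀ I : UCInstance, I.Valid →
      ∃ C : I.Config, IsAlgOutput M I C ∧ A.eval (M, I) = List.ofFn fun i => (C i : ℕ) := by
  -- For fixed `M` this is a polynomial in the weight of the instance, while the program does not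
  -- depend on `M`.
  let E : ℕ × RawUC → ℕ := fun x => (wt x.2 + x.1 + 2) ^ (x.1 + 1)
  have h : PolyTime fun x : Padded (ℕ × RawUC) (fun _ => True) E => Impl.main x.1.1 x.1.2 :=
    PolyTime.main (PolyTime.padded_val PolyTime.fst') (PolyTime.padded_val PolyTime.snd')
      ⟨1, fun x => by
        show E x.1 ≤ (wt x.1 + E x.1 + 2) ^ 1
        rw [pow_one]; omega⟩
  obtain ⟨A, hA, k, hk⟩ :=
    PolyTime.padded_prog (f := fun x : ℕ × RawUC => Impl.main x.1 x.2) h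
  have henc : ∀ M (I : RawUC), (enc (M, I) : (Ty.prod .nat ucTy).Val) = (M, I) := fun M I => by
    show (M, enc I) = (M, I)
    rw [enc_rawUC]
  refine ⟨A, fun M _ => ⟨((Polynomial.C (wt M + 1) + 2 * Polynomial.X) +
    (2 * Polynomial.X + Polynomial.C (M + 2)) ^ (M + 1) + 2) ^ k, fun I _ => ?_⟩,
    fun M hM I hI => ?_⟩
  · have h1 := hk (M, I) trivial
    have h2 : wt (α := RawUC) I ≤ 2 * ucTy.size I := by
      have := TameData.wt_le (α := RawUC) I
      rwa [enc_rawUC] at this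
    rw [henc] at h1
    refine h1.trans ?_
    simp only [Polynomial.eval_pow, Polynomial.eval_add, Polynomial.eval_mul, Polynomial.eval_C,
      Polynomial.eval_X, Polynomial.eval_ofNat]
    refine Nat.pow_le_pow_left (add_le_add (add_le_add ?_ ?_) le_rfl) k
    · show wt M + wt (α := RawUC) I + 1 ≤ _
      omega
    · exact Nat.pow_le_pow_left (by simp only; omega) _
  · obtain ⟨C, hC, e⟩ := Impl.main_spec hM hI
    refine ⟨C, hC, ?_⟩
    have h1 := hA (M, I) trivial
    rw [henc] at h1
    rw [h1, ← e]
    exact enc_listNat _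

/-! ### Bins -/

section Bins

variable {M : ℕ} {g : Fin M → PUtil} {u v : PUtil}

/-- `u` lies in one of the first `m` bins. -/
abbrev InBins (g : Fin M → PUtil) (m : ℕ) (u : PUtil) : Prop :=
  ∃ k : Fin M, (k : ℕ) < m ∧ InBin g k u

theorem inBinLe_iff (j : Fin M) : InBinLe g j u ↔ InBins g (j + 1) u :=
  exists_congr fun k => and_congr_left' (by rw [Fin.le_def, Nat.lt_succ_iff])

/-- For a monotone profile the first bins form a down-set that is cut off at the last boundary, even
if some bins are empty. -/
theorem inBins_succ_iff (hg : Monotone g) (j : Fin M) :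
    InBins g (j + 1) u ↔ u < g j ∨ ((j : ℕ) + 1 = M ∧ u = g j) := by
  constructor
  · rintro ⟨k, hk, -, h⟩
    have hkj : k ≤ j := Nat.lt_succ_iff.1 hk
    rcases h with h | ⟨h1, h2⟩
    · exact .inl (h.trans_le (hg hkj))
    · have : k = j := Fin.ext (by have := j.2; omega)
      exact .inr (this ▸ ⟨h1, h2⟩)
  · intro h
    -- The bin of `u` is the first one whose right end is not passed; by minimality `u` is not below
    -- its left end.
    have hex : ∃ k : ℕ, ∃ hk : k < M, u < g ⟨k, hk⟩ ∨ (k + 1 = M ∧ u = g ⟨k, hk⟩) := ⟨j, j.2, h⟩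
    classical
    obtain ⟨hk, h'⟩ := Nat.find_spec hex
    have hle : Nat.find hex ≤ j := Nat.find_min' hex ⟨j.2, h⟩
    refine ⟨⟨Nat.find hex, hk⟩, Nat.lt_succ_of_le hle, fun l hl => ?_, h'⟩
    by_contra hc
    exact Nat.find_min hex (m := l) (by simp only at hl; omega) ⟨l.2, .inl (not_le.1 hc)⟩

theorem inBins_mono {m m' : ℕ} (h : m ≤ m') (hu : InBins g m u) : InBins g m' u :=
  hu.imp fun _ hk => ⟨hk.1.trans_le h, hk.2⟩

theorem inBins_zero : ¬ InBins g 0 u := fun ⟨_, h, _⟩ => Nat.not_lt_zero _ h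

theorem inBins_lt (hg : Monotone g) {m : ℕ} (h : InBins g m v) (huv : u ≤ v) : InBins g m u := by
  obtain ⟨k, hk, hb⟩ := h
  refine inBins_mono (Nat.succ_le_of_lt hk) ((inBins_succ_iff hg k).2 ?_)
  rcases (inBins_succ_iff hg k).1 ⟨k, Nat.lt_succ_self _, hb⟩ with h | ⟨h1, rfl⟩
  · exact .inl (huv.trans_lt h)
  · exact huv.lt_or_eq.imp_right fun e => ⟨h1, e⟩

theorem inBins_of_lt_of_mem (hg : Monotone g) {j : Fin M} (hv : InBin g j v)
    (hu : InBins g j u) : u < v := by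
  obtain ⟨k, hk, h⟩ := hu
  have hpos : (j : ℕ) - 1 + 1 = j := by omega
  let l : Fin M := ⟨j - 1, by have := j.2; omega⟩
  refine lt_of_lt_of_le ?_ (hv.1 l hpos)
  have := (inBins_succ_iff hg l (u := u)).1 ⟨k, by simp only [l]; omega, h⟩
  exact this.resolve_right fun h => by have := j.2; simp only [l] at h; omega

theorem inBin_iff_of_monotone (hg : Monotone g) (j : Fin M) :
    InBin g j u ↔ InBins g (j + 1) u ∧ ¬ InBins g j u := by
  constructor
  · intro h
    exact ⟨⟨j, Nat.lt_succ_self _, h⟩, fun h' => lt_irrefl _ (inBins_of_lt_of_mem hg h h')⟩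
  · rintro ⟨⟨k, hk, h⟩, h'⟩
    have : k = j := by
      refine Fin.ext (le_antisymm (Nat.lt_succ_iff.1 hk) (not_lt.1 fun hlt => h' ⟨k, hlt, h⟩))
    exact this ▸ h

theorem sum_inBin (hg : Monotone g) (hu : InBins g M u) (c : ℚ) :
    (∑ j : Fin M, if InBin g j u then c else 0) = c := by
  obtain ⟨k, -, hk⟩ := hu
  rw [Finset.sum_eq_single k]
  · rw [if_pos hk]
  · intro j _ hjk
    refine if_neg fun hj => ?_
    rcases lt_or_gt_of_ne hjk with h | h
    · exact lt_irrefl _ (inBins_of_lt_of_mem hg hk ⟨j, h, hj⟩)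
    · exact lt_irrefl _ (inBins_of_lt_of_mem hg hj ⟨k, h, hk⟩)
  · simp

end Bins

/-! ### Contribution of a bin to the value, and the lower bound from the constraints. -/

section Low

variable {M n : ℕ} (P : Fin n → Finset Piece) (g : Fin M → PUtil)

/-- The probability that the draw for action `i` lies in one of the first `m` bins. -/
def lowProb (m : ℕ) (i : Fin n) : ℚ := ∑ x ∈ P i, if InBins g m x.agent then x.prob else 0

/-- The probability that all draws lie in the first `m` bins. -/
def allLow (m : ℕ) : ℚ := ∏ i, lowProb P g m i

/-- The contribution of the bin `j` to the principal's expected utility. -/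
def binValue (j : Fin M) : ℚ :=
  ∑ i, ∑ x ∈ P i, if InBin g j x.agent then winProb P i x * x.principal else 0

/-- The unnormalized utility of the principal from action `i` in the bin `j`. -/
def binUtil (j : Fin M) (i : Fin n) : ℚ :=
  ∑ x ∈ P i, if InBin g j x.agent then x.principal * x.prob else 0

variable {P g}

theorem lowProb_nonneg (hP : IsPieceSystem M P) (m : ℕ) (i : Fin n) : 0 ≤ lowProb P g m i :=
  Finset.sum_nonneg fun x hx => by
    have := hP.prob_nonneg i x hx
    split_ifs <;> simp [this]

theorem lowProb_mono (hP : IsPieceSystem M P) {m m' : ℕ} (h : m ≤ m') (i : Fin n) :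
    lowProb P g m i ≤ lowProb P g m' i :=
  Finset.sum_le_sum fun x hx => by
    have := hP.prob_nonneg i x hx
    by_cases h1 : InBins g m x.agent
    · rw [if_pos h1, if_pos (inBins_mono h h1)]
    · rw [if_neg h1]
      split_ifs <;> simp [this]

theorem lowProb_top (hP : IsPieceSystem M P) (htop : ∀ i, ∀ x ∈ P i, InBins g M x.agent)
    (i : Fin n) : lowProb P g M i = 1 := by
  rw [← hP.total i]
  exact Finset.sum_congr rfl fun x hx => if_pos (htop i x hx)

theorem allLow_top (hP : IsPieceSystem M P) (htop : ∀ i, ∀ x ∈ P i, InBins g M x.agent) :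
    allLow P g M = 1 := Finset.prod_eq_one fun i _ => lowProb_top hP htop i

theorem probLt_nonneg (hP : IsPieceSystem M P) (i : Fin n) (t : PUtil) : 0 ≤ probLt P i t :=
  Finset.sum_nonneg fun x hx => by
    have := hP.prob_nonneg i x hx
    split_ifs <;> simp [this]

theorem winProb_nonneg (hP : IsPieceSystem M P) {i : Fin n} {x : Piece} (hx : x ∈ P i) :
    0 ≤ winProb P i x :=
  mul_nonneg (hP.prob_nonneg i x hx) (Finset.prod_nonneg fun k _ => probLt_nonneg hP k _)

theorem binUtil_nonneg (hP : IsPieceSystem M P) (j : Fin M) (i : Fin n) : 0 ≤ binUtil P g j i :=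
  Finset.sum_nonneg fun x hx => by
    have := mul_nonneg (hP.principal_nonneg i x hx) (hP.prob_nonneg i x hx)
    split_ifs <;> simp [this]

theorem binValue_nonneg (hP : IsPieceSystem M P) (j : Fin M) : 0 ≤ binValue P g j :=
  Finset.sum_nonneg fun i _ => Finset.sum_nonneg fun x hx => by
    have := mul_nonneg (winProb_nonneg hP hx) (hP.principal_nonneg i x hx)
    split_ifs <;> simp [this]

theorem winMean_eq_sum_binValue (hg : Monotone g) (htop : ∀ i, ∀ x ∈ P i, InBins g M x.agent) :
    winMean P Piece.principal = ∑ j, binValue P g j := by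
  simp only [binValue]
  rw [winMean, Finset.sum_comm]
  refine Finset.sum_congr rfl fun i _ => ?_
  rw [Finset.sum_comm]
  exact Finset.sum_congr rfl fun x hx => (sum_inBin hg (htop i x hx) _).symm

/-- A piece in bin `j` wins whenever all other draws lie in earlier bins. Completing their product
to `allLow` costs the factor `lowProb j i / lowProb (j+1) i`, which is at most `1`. -/
theorem binValue_ge (hP : IsPieceSystem M P) (hg : Monotone g) (j : Fin M)
    (hpos : ∀ i, 0 < lowProb P g (j + 1) i) :
    allLow P g j * ∑ i, binUtil P g j i / lowProb P g (j + 1) i ≤ binValue P g j := by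
  rw [binValue, Finset.mul_sum]
  refine Finset.sum_le_sum fun i _ => ?_
  have h1 : allLow P g j * (binUtil P g j i / lowProb P g (j + 1) i) ≤
      binUtil P g j i * ∏ k ∈ univ.erase i, lowProb P g j k := by
    rw [allLow, ← Finset.mul_prod_erase univ _ (Finset.mem_univ i), mul_div_assoc',
      div_le_iff₀ (hpos i)]
    have h2 := lowProb_mono hP (g := g) (Nat.le_succ j) i
    have h3 := binUtil_nonneg hP (g := g) j i
    have h4 : 0 ≤ ∏ k ∈ univ.erase i, lowProb P g j k :=
      Finset.prod_nonneg fun k _ => lowProb_nonneg hP _ _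
    have := mul_le_mul_of_nonneg_right h2 (mul_nonneg h4 h3)
    linarith
  refine h1.trans ?_
  rw [binUtil, Finset.sum_mul]
  refine Finset.sum_le_sum fun x hx => ?_
  split_ifs with h
  · have h2 : ∏ k ∈ univ.erase i, lowProb P g j k ≤ ∏ k ∈ univ.erase i, probLt P k x.agent := by
      refine Finset.prod_le_prod (fun k _ => lowProb_nonneg hP _ _) fun k _ =>
        Finset.sum_le_sum fun y hy => ?_
      have := hP.prob_nonneg k y hy
      by_cases h3 : InBins g j y.agent
      · rw [if_pos h3, if_pos (inBins_of_lt_of_mem hg h h3)]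
      · rw [if_neg h3]
        split_ifs <;> simp [this]
    have h3 := mul_nonneg (hP.principal_nonneg i x hx) (hP.prob_nonneg i x hx)
    calc _ ≤ x.principal * x.prob * ∏ k ∈ univ.erase i, probLt P k x.agent :=
          mul_le_mul_of_nonneg_left h2 h3
      _ = _ := by rw [winProb]; ring
  · rw [zero_mul]

/-- If a piece of bin `j` wins, all other draws lie in the bins up to `j`. -/
theorem binValue_le (hP : IsPieceSystem M P) (hg : Monotone g) (j : Fin M)
    (hpos : ∀ i, 0 < lowProb P g (j + 1) i) :
    binValue P g j ≤ allLow P g (j + 1) * ∑ i, binUtil P g j i / lowProb P g (j + 1) i := by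
  rw [binValue, Finset.mul_sum]
  refine Finset.sum_le_sum fun i _ => ?_
  have h1 : allLow P g (j + 1) * (binUtil P g j i / lowProb P g (j + 1) i) =
      binUtil P g j i * ∏ k ∈ univ.erase i, lowProb P g (j + 1) k := by
    rw [allLow, ← Finset.mul_prod_erase univ _ (Finset.mem_univ i)]
    have := (hpos i).ne'
    field_simp
  rw [h1, binUtil, Finset.sum_mul]
  refine Finset.sum_le_sum fun x hx => ?_
  split_ifs with h
  · have h2 : ∏ k ∈ univ.erase i, probLt P k x.agent ≤
        ∏ k ∈ univ.erase i, lowProb P g (j + 1) k := by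
      refine Finset.prod_le_prod (fun k _ => probLt_nonneg hP _ _) fun k _ =>
        Finset.sum_le_sum fun y hy => ?_
      have := hP.prob_nonneg k y hy
      by_cases h3 : y.agent < x.agent
      · rw [if_pos h3, if_pos (inBins_lt hg ((inBin_iff_of_monotone hg j).1 h).1 h3.le)]
      · rw [if_neg h3]
        split_ifs <;> simp [this]
    have h3 := mul_nonneg (hP.principal_nonneg i x hx) (hP.prob_nonneg i x hx)
    calc _ = x.principal * x.prob * ∏ k ∈ univ.erase i, probLt P k x.agent := by
          rw [winProb]; ring
      _ ≤ _ := mul_le_mul_of_nonneg_left h2 h3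
  · rw [zero_mul]

/-- The union bound for independent events. -/
theorem one_sub_sum_le_prod {ι : Type} (s : Finset ι) (q : ι → ℚ) (h0 : ∀ i ∈ s, 0 ≤ q i)
    (h1 : ∀ i ∈ s, q i ≤ 1) : 1 - ∑ i ∈ s, q i ≤ ∏ i ∈ s, (1 - q i) := by
  classical
  induction s using Finset.induction_on with
  | empty => simp
  | insert a s ha ih =>
    rw [Finset.sum_insert ha, Finset.prod_insert ha]
    have ih' := ih (fun i hi => h0 i (Finset.mem_insert_of_mem hi))
      fun i hi => h1 i (Finset.mem_insert_of_mem hi)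
    have ha0 := h0 a (Finset.mem_insert_self _ _)
    have ha1 := h1 a (Finset.mem_insert_self _ _)
    have hs : ∏ i ∈ s, (1 - q i) ≤ 1 := Finset.prod_le_one
      (fun i hi => sub_nonneg.2 (h1 i (Finset.mem_insert_of_mem hi)))
      fun i hi => sub_le_self _ (h0 i (Finset.mem_insert_of_mem hi))
    nlinarith

/-- The conditional probability of the bin `j`. -/
def binRatio (P : Fin n → Finset Piece) (g : Fin M → PUtil) (j : ℕ) (i : Fin n) : ℚ :=
  (lowProb P g (j + 1) i - lowProb P g j i) / lowProb P g (j + 1) i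

theorem binRatio_nonneg (hP : IsPieceSystem M P) (j : ℕ) (i : Fin n) : 0 ≤ binRatio P g j i :=
  div_nonneg (sub_nonneg.2 (lowProb_mono hP (Nat.le_succ j) i)) (lowProb_nonneg hP _ _)

theorem binRatio_le_one (hP : IsPieceSystem M P) (j : ℕ) (i : Fin n) : binRatio P g j i ≤ 1 :=
  div_le_one_of_le₀ (sub_le_self _ (lowProb_nonneg hP _ _)) (lowProb_nonneg hP _ _)

theorem allLow_succ_mul_prod (j : ℕ) (hpos : ∀ i, 0 < lowProb P g (j + 1) i) :
    allLow P g (j + 1) * ∏ i, (1 - binRatio P g j i) = allLow P g j := by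
  rw [allLow, allLow, ← Finset.prod_mul_distrib]
  refine Finset.prod_congr rfl fun i _ => ?_
  have := (hpos i).ne'
  rw [binRatio]
  field_simp
  ring

/-- Downward induction on `m`, where each step multiplies by at least `1 - ∑ q`. The start has
slack, as `(M-4)/(M-1) ≤ 1`, and the shift by `4` absorbs the errors `1/M` in the constraint and
`1/M²` from rounding. This is the origin of the weights `(J - 5)/(M - 1)` in the objective. -/
theorem allLow_ge (hP : IsPieceSystem M P) (htop : ∀ i, ∀ x ∈ P i, InBins g M x.agent)
    (hpos : ∀ j < M, ∀ i, 0 < lowProb P g (j + 1) i)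
    (hsum : ∀ j, 0 < j → j < M →
      ∑ i, binRatio P g j i ≤ (1 + 1 / (M : ℚ)) / j + 1 / (M : ℚ) ^ 2)
    {m : ℕ} (h5 : 5 ≤ m) (hm : m ≤ M) : ((m : ℚ) - 4) / ((M : ℚ) - 1) ≤ allLow P g m := by
  induction hk : M - m generalizing m with
  | zero =>
    obtain rfl : m = M := by omega
    rw [allLow_top hP htop]
    have : (5 : ℚ) ≤ m := by exact_mod_cast h5
    rw [div_le_one (by linarith)]
    linarith
  | succ k ih =>
    have h1 := ih (m := m + 1) (by omega) (by omega) (by omega)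
    have hlt : m < M := by omega
    rw [← allLow_succ_mul_prod m (hpos m hlt)]
    have h2 := one_sub_sum_le_prod univ (binRatio P g m) (fun i _ => binRatio_nonneg hP m i)
      fun i _ => binRatio_le_one hP m i
    have h3 := hsum m (by omega) hlt
    have hm5 : (5 : ℚ) ≤ m := by exact_mod_cast h5
    have hmM : (m : ℚ) + 1 ≤ M := by exact_mod_cast hlt
    have hM1 : 0 < (M : ℚ) - 1 := by linarith
    have hM0 : (0 : ℚ) < M := by linarith
    have hm0 : (0 : ℚ) < m := by linarith
    have e1 : (1 + 1 / (M : ℚ)) / m + 1 / (M : ℚ) ^ 2 ≤ 1 := by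
      have i1 : (1 + 1 / (M : ℚ)) / m ≤ 2 / 5 := by
        rw [div_le_div_iff₀ hm0 (by norm_num)]
        have : 1 / (M : ℚ) ≤ 1 := by rw [div_le_one hM0]; linarith
        nlinarith
      have i2 : 1 / (M : ℚ) ^ 2 ≤ 1 / 2 := by
        refine one_div_le_one_div_of_le (by norm_num) ?_
        nlinarith
      linarith
    have e2 : ((m : ℚ) - 4) ≤ (((m + 1 : ℕ) : ℚ) - 4) *
        (1 - ((1 + 1 / (M : ℚ)) / m + 1 / (M : ℚ) ^ 2)) := by
      push_cast
      -- After clearing denominators this reads `mM + m² ≤ 3M² + 3M + 3m`, which holds since `m ≤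
      -- M`.
      have i1 : ((m : ℚ) - 3) * ((1 + 1 / (M : ℚ)) / m + 1 / (M : ℚ) ^ 2) ≤ 1 := by
        have j1 : ((m : ℚ) - 3) * ((1 + 1 / (M : ℚ)) / m + 1 / (M : ℚ) ^ 2) =
          (((m : ℚ) - 3) * (M * M + M + m)) / (m * M ^ 2) := by field_simp
        rw [j1, div_le_one (by positivity)]
        nlinarith [mul_nonneg hm0.le hM0.le, mul_self_nonneg ((M : ℚ) - m),
          mul_nonneg hm0.le (sub_nonneg.2 hmM)]
      linarith
    calc ((m : ℚ) - 4) / (M - 1) ≤ (((m + 1 : ℕ) : ℚ) - 4) *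
        (1 - ((1 + 1 / (M : ℚ)) / m + 1 / (M : ℚ) ^ 2)) / (M - 1) :=
          div_le_div_of_nonneg_right e2 hM1.le
      _ = (((m + 1 : ℕ) : ℚ) - 4) / (M - 1) *
        (1 - ((1 + 1 / (M : ℚ)) / m + 1 / (M : ℚ) ^ 2)) := by ring
      _ ≤ allLow P g (m + 1) * ∏ i, (1 - binRatio P g m i) := by
        refine mul_le_mul h1 (by linarith) (by linarith) ?_
        exact Finset.prod_nonneg fun i _ => lowProb_nonneg hP _ _

end Low

/-! ### Relation to the estimates of the algorithm -/

section Relate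

variable {M : ℕ} {I : UCInstance} {T : List Piece} {g : Fin M → PUtil} {C : I.Config}

theorem cumProb_eq_lowProb (hT : T.Nodup) (j : Fin M) (i : Fin I.length) :
    cumProb I T g C j i = lowProb (configPieces I T C) g (j + 1) i := by
  rw [cumProb, sum_newLaw hT, lowProb]
  exact Finset.sum_congr rfl fun x _ => if_congr (inBinLe_iff j) rfl rfl

theorem condBinProb_eq_binRatio (hT : T.Nodup) (hg : Monotone g) (j : Fin M) (i : Fin I.length) :
    condBinProb I T g C j i = binRatio (configPieces I T C) g j i := by
  rw [condBinProb, cumProb_eq_lowProb hT, sum_newLaw hT, binRatio]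
  congr 1
  rw [lowProb, lowProb, ← Finset.sum_sub_distrib]
  refine Finset.sum_congr rfl fun x _ => ?_
  have h := inBin_iff_of_monotone hg j (u := x.agent)
  by_cases h1 : InBins g j x.agent
  · rw [if_neg fun h' => (h.1 h').2 h1, if_pos (inBins_mono (Nat.le_succ _) h1), if_pos h1, sub_self]
  · rw [if_neg h1, sub_zero]
    exact if_congr (h.trans (and_iff_left h1)) rfl rfl

theorem condBinUtil_eq_div (hT : T.Nodup) (j : Fin M) (i : Fin I.length) :
    condBinUtil I T g C j i = binUtil (configPieces I T C) g j i /
      lowProb (configPieces I T C) g (j + 1) i := by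
  rw [condBinUtil, cumProb_eq_lowProb hT, sum_newLaw hT, binUtil]

theorem roundedEst_le (hT : T.Nodup) (hg : Monotone g) (hn : I ≠ []) (hM : 1 ≤ M) (j : Fin M) :
    roundedEst I T g C j ≤ ∑ i, binRatio (configPieces I T C) g j i := by
  have hn' : (0 : ℚ) < I.length := by exact_mod_cast List.length_pos_iff.2 hn
  have hpos : 0 < (M : ℚ) ^ 2 * I.length := by positivity
  refine Finset.sum_le_sum fun i _ => ?_
  rw [condBinProb_eq_binRatio hT hg, div_le_iff₀ hpos]
  exact Int.floor_le _

theorem sum_binRatio_le (hT : T.Nodup) (hg : Monotone g) (hn : I ≠ []) (hM : 1 ≤ M) (j : Fin M) :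
    ∑ i, binRatio (configPieces I T C) g j i ≤ roundedEst I T g C j + 1 / (M : ℚ) ^ 2 := by
  have hn' : (0 : ℚ) < I.length := by exact_mod_cast List.length_pos_iff.2 hn
  have hpos : 0 < (M : ℚ) ^ 2 * I.length := by positivity
  have h : 1 / (M : ℚ) ^ 2 = ∑ _i : Fin I.length, 1 / ((M : ℚ) ^ 2 * I.length) := by
    rw [Finset.sum_const, Finset.card_univ, Fintype.card_fin, nsmul_eq_mul]
    field_simp
  rw [h, roundedEst, ← Finset.sum_add_distrib]
  refine Finset.sum_le_sum fun i _ => ?_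
  rw [condBinProb_eq_binRatio hT hg, ← add_div, le_div_iff₀ hpos]
  exact (Int.lt_floor_add_one _).le

/-- Bin by bin, the weight in the objective is at most the true factor `allLow j`; the first five
bins count `0` in the objective. -/
theorem utilEst_le_winMean (hT : T.Nodup) (hP : IsPieceSystem M (configPieces I T C))
    (hg : Monotone g) (hn : I ≠ []) (hM : 1 ≤ M)
    (htop : ∀ i, ∀ x ∈ configPieces I T C i, InBins g M x.agent) (hC : Feasible I T g C) :
    utilEst I T g C ≤ winMean (configPieces I T C) Piece.principal := by
  have hpos : ∀ j < M, ∀ i, 0 < lowProb (configPieces I T C) g (j + 1) i := fun j hj i => by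
    have := hC.cond_defined ⟨j, hj⟩ i
    rwa [cumProb_eq_lowProb hT] at this
  rw [winMean_eq_sum_binValue hg htop, utilEst]
  refine Finset.sum_le_sum fun j _ => ?_
  split_ifs with h6
  · simp only [condBinUtil_eq_div hT]
    refine le_trans ?_ (binValue_ge hP hg j (hpos j j.2))
    refine mul_le_mul_of_nonneg_right ?_ (Finset.sum_nonneg fun i _ =>
      div_nonneg (binUtil_nonneg hP _ _) (lowProb_nonneg hP _ _))
    have := allLow_ge hP htop hpos (fun j hj hj' => by
      have h1 := sum_binRatio_le (C := C) hT hg hn hM ⟨j, hj'⟩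
      have h2 := hC.upper ⟨j, hj'⟩ hj
      simp only at h1 h2
      linarith) (m := j) (by omega) j.2.le
    have e : ((j : ℕ) : ℚ) + 1 - 5 = (j : ℕ) - 4 := by ring
    rw [e]
    exact this
  · exact binValue_nonneg hP j

end Relate

/-! ### A good guess for a given configuration -/

section Guess

variable {M n : ℕ} {P : Fin n → Finset Piece}

/-- The probability that the draw for action `i` has agent utility at most `t`. -/
def probLeAt (P : Fin n → Finset Piece) (i : Fin n) (t : PUtil) : ℚ :=
  ∑ x ∈ P i, if x.agent ≤ t then x.prob else 0

theorem probLeAt_le_one (hP : IsPieceSystem M P) (i : Fin n) (t : PUtil) : probLeAt P i t ≤ 1 := by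
  rw [← hP.total i]
  exact Finset.sum_le_sum fun x hx => by
    have := hP.prob_nonneg i x hx
    split_ifs <;> simp [this]

theorem probLeAt_nonneg (hP : IsPieceSystem M P) (i : Fin n) (t : PUtil) : 0 ≤ probLeAt P i t :=
  Finset.sum_nonneg fun x hx => by
    have := hP.prob_nonneg i x hx
    split_ifs <;> simp [this]

theorem probLeAt_eq_add (i : Fin n) (t : PUtil) :
    probLeAt P i t = probLt P i t + ∑ x ∈ P i, if x.agent = t then x.prob else 0 := by
  rw [probLeAt, probLt, ← Finset.sum_add_distrib]
  refine Finset.sum_congr rfl fun x _ => ?_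
  rcases lt_trichotomy x.agent t with h | h | h
  · simp [h, h.le, h.ne]
  · simp [h]
  · simp [h.not_gt, h.not_ge, h.ne']

/-- The distribution function of the favourite jumps by at most `1/M²`, since at most one piece of
one action sits at `t`. This is what splitting and perturbing the masses is for. -/
theorem prod_probLeAt_le (hP : IsPieceSystem M P) (t : PUtil) :
    ∏ i, probLeAt P i t ≤ (∏ i, probLt P i t) + 1 / (M : ℚ) ^ 2 := by
  by_cases h : ∃ i, ∃ x ∈ P i, x.agent = t
  · obtain ⟨i, x, hx, rfl⟩ := h
    have h1 : ∀ k ∈ univ.erase i, probLeAt P k x.agent = probLt P k x.agent := fun k hk => by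
      rw [probLeAt_eq_add, Finset.sum_eq_zero, add_zero]
      intro y hy
      exact if_neg fun e => Finset.ne_of_mem_erase hk (hP.inj k i y hy x hx e).2
    have h2 : probLeAt P i x.agent = probLt P i x.agent + x.prob := by
      rw [probLeAt_eq_add, Finset.sum_eq_single x, if_pos rfl]
      · intro y hy hyx
        exact if_neg fun e => hyx (hP.inj i i y hy x hx e).1
      · exact fun h => absurd hx h
    rw [← Finset.mul_prod_erase univ _ (Finset.mem_univ i),
      ← Finset.mul_prod_erase univ (fun k => probLt P k x.agent) (Finset.mem_univ i), h2,
      Finset.prod_congr rfl h1, add_mul]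
    have h3 : ∏ k ∈ univ.erase i, probLt P k x.agent ≤ 1 := by
      rw [← Finset.prod_congr rfl h1]
      exact Finset.prod_le_one (fun k _ => probLeAt_nonneg hP k _) fun k _ => probLeAt_le_one hP k _
    have h4 := mul_le_mul_of_nonneg_left h3 (hP.prob_nonneg i x hx)
    have h5 := hP.prob_le i x hx
    linarith
  · push Not at h
    have : ∀ i, probLeAt P i t = probLt P i t := fun i => by
      rw [probLeAt_eq_add, Finset.sum_eq_zero, add_zero]
      exact fun x hx => if_neg (h i x hx)
    simp only [this]
    have : (0 : ℚ) ≤ 1 / (M : ℚ) ^ 2 := by positivity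
    linarith

/-- `f q` is the `q`-quantile of the favourite. Just below it the distribution function is at most
`q`, and it falls short of `q` by at most one jump. -/
theorem exists_threshold (hP : IsPieceSystem M P) [NeZero n] {A : Finset PUtil}
    (hA : ∀ i, ∀ x ∈ P i, x.agent ∈ A) :
    ∃ f : ℚ → PUtil, MonotoneOn f (Set.Iic 1) ∧ ∀ q ≤ 1, 0 ≤ q → f q ∈ A ∧
      ∏ i, probLt P i (f q) ≤ q ∧ q ≤ (∏ i, probLt P i (f q)) + 1 / (M : ℚ) ^ 2 := by
  have hne : A.Nonempty := by
    have : (P 0).Nonempty := by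
      by_contra h
      have := hP.total 0
      rw [Finset.not_nonempty_iff_eq_empty.1 h] at this
      simp at this
    obtain ⟨x, hx⟩ := this
    exact ⟨_, hA 0 x hx⟩
  have htop : ∏ i, probLeAt P i (A.max' hne) = 1 := by
    refine Finset.prod_eq_one fun i _ => ?_
    rw [← hP.total i]
    exact Finset.sum_congr rfl fun x hx => if_pos (A.le_max' _ (hA i x hx))
  have hF : ∀ q ≤ 1, (A.filter fun t => q ≤ ∏ i, probLeAt P i t).Nonempty := fun q hq =>
    ⟨A.max' hne, Finset.mem_filter.2 ⟨A.max'_mem hne, by rw [htop]; exact hq⟩⟩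
  refine ⟨fun q => if hq : q ≤ 1 then (A.filter fun t => q ≤ ∏ i, probLeAt P i t).min' (hF q hq)
    else A.max' hne, ?_, ?_⟩
  · intro q hq r hr hqr
    have hq' : q ≤ 1 := hq
    have hr' : r ≤ 1 := hr
    simp only [dif_pos hq', dif_pos hr']
    exact Finset.min'_subset _ (Finset.monotone_filter_right _ fun t _ ht => hqr.trans ht)
  · intro q hq hq0
    simp only [dif_pos hq]
    set t := (A.filter fun t => q ≤ ∏ i, probLeAt P i t).min' (hF q hq) with ht
    obtain ⟨h1, h2⟩ := Finset.mem_filter.1 (Finset.min'_mem _ (hF q hq))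
    rw [← ht] at h1 h2
    refine ⟨h1, ?_, h2.trans (prod_probLeAt_le hP t)⟩
    by_cases he : (A.filter fun s => s < t).Nonempty
    · have h3 := Finset.max'_mem _ he
      set s := (A.filter fun s => s < t).max' he with hs
      obtain ⟨h4, h5⟩ := Finset.mem_filter.1 h3
      have h6 : ∏ i, probLt P i t = ∏ i, probLeAt P i s := by
        refine Finset.prod_congr rfl fun i _ => Finset.sum_congr rfl fun x hx => ?_
        refine if_congr ⟨fun h => ?_, fun h => h.trans_lt h5⟩ rfl rfl
        exact Finset.le_max' _ _ (Finset.mem_filter.2 ⟨hA i x hx, h⟩)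
      rw [h6]
      by_contra hc
      have h7 : t ≤ s := Finset.min'_le _ _ (Finset.mem_filter.2 ⟨h4, (not_le.1 hc).le⟩)
      exact absurd h5 h7.not_gt
    · have h3 : probLt P 0 t = 0 := Finset.sum_eq_zero fun x hx => by
        refine if_neg fun h => he ⟨_, Finset.mem_filter.2 ⟨hA 0 x hx, h⟩⟩
      rw [Finset.prod_eq_zero (Finset.mem_univ 0) h3]
      exact hq0

theorem exists_guess (hP : IsPieceSystem M P) [NeZero n] {T : List Piece} (hM : 1 ≤ M)
    (hT : ∀ i, ∀ x ∈ P i, x ∈ T) :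
    ∃ g : Fin M → PUtil, IsGuess T g ∧ (∀ x ∈ T, InBins g M x.agent) ∧
      (∀ m, 0 < m → m < M → ∃ t : PUtil, (∃ x ∈ T, x.agent = t) ∧
        ∀ u, InBins g m u ↔ u < t) ∧
      (∀ m ≤ M, allLow P g m ≤ m / (M : ℚ)) ∧
      ∀ m ≤ M, (m : ℚ) / M ≤ allLow P g m + 1 / (M : ℚ) ^ 2 := by
  classical
  let A : Finset PUtil := (T.map Piece.agent).toFinset
  have hA : ∀ x ∈ T, x.agent ∈ A := fun x hx => List.mem_toFinset.2 (List.mem_map_of_mem hx)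
  have hA' : ∀ t ∈ A, ∃ x ∈ T, x.agent = t := fun t ht => List.mem_map.1 (List.mem_toFinset.1 ht)
  obtain ⟨f, hf, hf'⟩ := exists_threshold hP (A := A) fun i x hx => hA x (hT i x hx)
  have hne : A.Nonempty := ⟨_, (hf' 1 le_rfl zero_le_one).1⟩
  have hM0 : (0 : ℚ) < M := by exact_mod_cast hM
  have hle : ∀ m : ℕ, m ≤ M → (m : ℚ) / M ≤ 1 := fun m hm => by
    rw [div_le_one hM0]; exact_mod_cast hm
  -- The inner boundaries are the quantiles at `1/M, …, (M-1)/M`. The last one is the maximum over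
  -- all pieces, also those of other configurations, so that for every configuration the bins cover
  -- all draws.
  let g : Fin M → PUtil := fun j => if (j : ℕ) + 1 = M then A.max' hne else f (((j + 1 : ℕ) : ℚ) / M)
  have hgA : ∀ j, g j ∈ A := by
    intro j
    simp only [g]
    split_ifs
    · exact A.max'_mem hne
    · exact (hf' _ (hle _ j.2) (by positivity)).1
  have hg : Monotone g := by
    intro j k hjk
    by_cases hk : (k : ℕ) + 1 = M
    · have : g k = A.max' hne := if_pos hk
      rw [this]
      exact A.le_max' _ (hgA j)
    · have hjk' : (j : ℕ) ≤ k := hjk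
      have hj : ¬ (j : ℕ) + 1 = M := by have := k.2; omega
      simp only [g, if_neg hk, if_neg hj]
      refine hf (hle _ j.2) (hle _ k.2) ?_
      gcongr
      exact Nat.succ_le_succ hjk'
  have htop : ∀ x ∈ T, InBins g M x.agent := by
    intro x hx
    have hlt : M - 1 < M := by omega
    have h1 := inBins_succ_iff hg ⟨M - 1, hlt⟩ (u := x.agent)
    have h2 : g ⟨M - 1, hlt⟩ = A.max' hne := if_pos (by simp only; omega)
    simp only [Nat.sub_add_cancel hM, h2, true_and] at h1
    exact h1.2 (A.le_max' _ (hA x hx)).lt_or_eq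
  have hmid : ∀ m (h0 : 0 < m) (hm : m < M), ∀ u, InBins g m u ↔ u < f ((m : ℚ) / M) := by
    intro m h0 hm u
    have hlt : m - 1 < M := by omega
    have h1 := inBins_succ_iff hg ⟨m - 1, hlt⟩ (u := u)
    have h2 : g ⟨m - 1, hlt⟩ = f ((m : ℚ) / M) := by
      simp only [g]
      rw [if_neg (by omega), Nat.sub_add_cancel h0]
    rw [h2] at h1
    simp only [Nat.sub_add_cancel h0] at h1
    rw [h1]
    exact or_iff_left fun h => by omega
  have hlow : ∀ m (h0 : 0 < m) (hm : m < M),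
      allLow P g m = ∏ i, probLt P i (f ((m : ℚ) / M)) := fun m h0 hm =>
    Finset.prod_congr rfl fun i _ => Finset.sum_congr rfl fun x _ =>
      if_congr (hmid m h0 hm _) rfl rfl
  have h0 : allLow P g 0 = 0 := by
    refine Finset.prod_eq_zero (Finset.mem_univ 0) (Finset.sum_eq_zero fun x _ => ?_)
    exact if_neg inBins_zero
  have h1 : allLow P g M = 1 := allLow_top hP fun i x hx => htop x (hT i x hx)
  refine ⟨g, ⟨hg, fun j => hA' _ (hgA j)⟩, htop, fun m hm0 hm => ⟨f ((m : ℚ) / M),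
    hA' _ (hf' _ (hle m hm.le) (by positivity)).1, hmid m hm0 hm⟩, fun m hm => ?_, fun m hm => ?_⟩
  · rcases Nat.eq_zero_or_pos m with rfl | hm0
    · rw [h0]; simp
    · rcases hm.eq_or_lt with rfl | hm
      · rw [h1, div_self hM0.ne']
      · rw [hlow m hm0 hm]
        exact (hf' _ (hle m hm.le) (by positivity)).2.1
  · rcases Nat.eq_zero_or_pos m with rfl | hm0
    · rw [h0]; simp
    · rcases hm.eq_or_lt with rfl | hm
      · rw [h1, div_self hM0.ne']
        have : (0 : ℚ) ≤ 1 / (m : ℚ) ^ 2 := by positivity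
        linarith
      · rw [hlow m hm0 hm]
        exact (hf' _ (hle m hm.le) (by positivity)).2.2

end Guess

/-! ### Bin probabilities for the quantile profile. -/

section GoodGuess

variable {M n : ℕ} {P : Fin n → Finset Piece} {g : Fin M → PUtil}

theorem lowProb_pos (hP : IsPieceSystem M P) (hM : 3 ≤ M)
    (hge : ∀ m ≤ M, (m : ℚ) / M ≤ allLow P g m + 1 / (M : ℚ) ^ 2) {m : ℕ} (hm0 : 0 < m)
    (hm : m ≤ M) : 0 < allLow P g m ∧ ∀ i, 0 < lowProb P g m i := by
  have hM0 : (3 : ℚ) ≤ M := by exact_mod_cast hM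
  have h : 0 < allLow P g m := by
    have h1 := hge m hm
    have h2 : 1 / (M : ℚ) ^ 2 < m / M := by
      rw [div_lt_div_iff₀ (by positivity) (by positivity)]
      have : (1 : ℚ) ≤ m := by exact_mod_cast hm0
      nlinarith [mul_le_mul_of_nonneg_right this (by positivity : (0 : ℚ) ≤ (M : ℚ) ^ 2)]
    linarith
  refine ⟨h, fun i => (lowProb_nonneg hP m i).lt_of_ne fun e => h.ne' ?_⟩
  exact Finset.prod_eq_zero (Finset.mem_univ i) e.symm

/-- With `s = ∑ q`, the union bound gives `1 - s ≤ allLow j / allLow (j+1)`, and the quantile bounds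
make this at most `jM / ((j+1)M - 1)`. So `s ≥ (M-1)/((j+1)M - 1)`, which is more than claimed. -/
theorem sum_binRatio_ge (hP : IsPieceSystem M P) (hM : 3 ≤ M)
    (hle : ∀ m ≤ M, allLow P g m ≤ m / (M : ℚ))
    (hge : ∀ m ≤ M, (m : ℚ) / M ≤ allLow P g m + 1 / (M : ℚ) ^ 2) {j : ℕ} (hj : j < M) :
    (1 - 1 / (M : ℚ)) / (j + 1) ≤ ∑ i, binRatio P g j i := by
  obtain ⟨h1, h2⟩ := lowProb_pos hP hM hge (Nat.succ_pos j) hj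
  have h3 := allLow_succ_mul_prod j h2
  have h4 := one_sub_sum_le_prod univ (binRatio P g j) (fun i _ => binRatio_nonneg hP j i)
    fun i _ => binRatio_le_one hP j i
  have h5 := hle j hj.le
  have h6 := hge (j + 1) hj
  push_cast at h6
  have hM0 : (3 : ℚ) ≤ M := by exact_mod_cast hM
  have hM' : (0 : ℚ) < M := by linarith
  have hj0 : (0 : ℚ) ≤ j := by positivity
  set a := allLow P g (j + 1)
  set b := allLow P g j
  set s := ∑ i, binRatio P g j i
  have h7 : a * (1 - s) ≤ b := by rw [← h3]; exact mul_le_mul_of_nonneg_left h4 h1.le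
  by_contra hc
  push Not at hc
  have hc' : s * (j + 1) < 1 - 1 / (M : ℚ) := by rwa [lt_div_iff₀ (by positivity)] at hc
  have hs1 : s < 1 := by
    have : (1 - 1 / (M : ℚ)) / (j + 1) ≤ 1 := by
      rw [div_le_one (by positivity)]
      have : (0 : ℚ) ≤ 1 / (M : ℚ) := by positivity
      linarith
    linarith
  have h8 : ((j + 1 : ℚ) / M - 1 / (M : ℚ) ^ 2) * (1 - s) ≤ j / M :=
    (mul_le_mul_of_nonneg_right (by linarith) (by linarith)).trans (h7.trans h5)
  have h9 : ((j + 1 : ℚ) * M - 1) * (1 - s) ≤ j * M := by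
    have e1 : ((j + 1 : ℚ) / M - 1 / (M : ℚ) ^ 2) * (1 - s) =
      (((j + 1 : ℚ) * M - 1) * (1 - s)) / (M : ℚ) ^ 2 := by field_simp
    have e2 : (j : ℚ) / M = (j * M) / (M : ℚ) ^ 2 := by field_simp
    rw [e1, e2, div_le_div_iff_of_pos_right (by positivity)] at h8
    exact h8
  have h10 : s * (j + 1) * M < M - 1 := by
    have := mul_lt_mul_of_pos_right hc' hM'
    have e : (1 - 1 / (M : ℚ)) * M = M - 1 := by field_simp
    linarith
  have hs0 : 0 ≤ s := Finset.sum_nonneg fun i _ => binRatio_nonneg hP j i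
  nlinarith

/-- By `1 - q ≤ exp (-q)`, the ratio `allLow (j+1) / allLow j` is at least `exp (∑ q)`, while the
quantile bounds make it at most `(j+1)/(j - 1/M)`. If `∑ q` exceeded `s = (1 + 1/M)/j`, the
second-order lower bound `1 + s + s²/2` of `exp s` would contradict this; the first-order bound
would not suffice. -/
theorem sum_binRatio_le_of_guess (hP : IsPieceSystem M P) (hM : 3 ≤ M)
    (hle : ∀ m ≤ M, allLow P g m ≤ m / (M : ℚ))
    (hge : ∀ m ≤ M, (m : ℚ) / M ≤ allLow P g m + 1 / (M : ℚ) ^ 2) {j : ℕ} (hj0 : 0 < j)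
    (hj : j < M) : ∑ i, binRatio P g j i ≤ (1 + 1 / (M : ℚ)) / j := by
  obtain ⟨h1, h2⟩ := lowProb_pos hP hM hge (Nat.succ_pos j) hj
  have h3 := allLow_succ_mul_prod j h2
  have h5 := hle (j + 1) hj
  have h6 := hge j hj.le
  by_contra hc
  push Not at hc
  have hM0 : (3 : ℝ) ≤ M := by exact_mod_cast hM
  have hM' : (0 : ℝ) < M := by linarith
  have hj1 : (1 : ℝ) ≤ j := by exact_mod_cast hj0
  set a := allLow P g (j + 1)
  set b := allLow P g j
  set e : ℝ := 1 / (M : ℝ) with he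
  have he0 : 0 < e := by positivity
  have he3 : e ≤ 1 / 3 := one_div_le_one_div_of_le (by norm_num) hM0
  set s : ℝ := (1 + e) / j with hs
  have hs0 : 0 < s := by positivity
  have hprod : ((∏ i, (1 - binRatio P g j i) : ℚ) : ℝ) < Real.exp (-s) := by
    rw [Rat.cast_prod]
    calc (∏ i, ((1 - binRatio P g j i : ℚ) : ℝ)) ≤ ∏ i, Real.exp (-(binRatio P g j i : ℝ)) := by
          refine Finset.prod_le_prod (fun i _ => ?_) fun i _ => ?_
          · exact_mod_cast sub_nonneg.2 (binRatio_le_one hP j i)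
          · push_cast
            exact Real.one_sub_le_exp_neg _
      _ = Real.exp (-((∑ i, binRatio P g j i : ℚ) : ℝ)) := by
          rw [← Real.exp_sum, Finset.sum_neg_distrib, Rat.cast_sum]
      _ < _ := by
          refine Real.exp_lt_exp.2 (neg_lt_neg ?_)
          have : (((1 + 1 / (M : ℚ)) / j : ℚ) : ℝ) < ((∑ i, binRatio P g j i : ℚ) : ℝ) := by
            exact_mod_cast hc
          push_cast at this ⊢
          exact this
  have hexp : Real.exp (-s) * (1 + s + s ^ 2 / 2) ≤ 1 := by
    have := Real.quadratic_le_exp_of_nonneg hs0.le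
    calc Real.exp (-s) * (1 + s + s ^ 2 / 2) ≤ Real.exp (-s) * Real.exp s :=
          mul_le_mul_of_nonneg_left this (Real.exp_pos _).le
      _ = 1 := by rw [← Real.exp_add]; simp
  have h3' : (a : ℝ) * ((∏ i, (1 - binRatio P g j i) : ℚ) : ℝ) = b := by exact_mod_cast h3
  have h5' : (a : ℝ) ≤ (j + 1) * e := by
    have : (a : ℝ) ≤ (((j + 1 : ℕ) : ℚ) / (M : ℚ) : ℚ) := by exact_mod_cast h5
    push_cast at this
    rw [he]
    calc _ ≤ _ := this
      _ = _ := by ring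
  have h6' : j * e ≤ (b : ℝ) + e ^ 2 := by
    have : (((j : ℚ) / (M : ℚ) : ℚ) : ℝ) ≤ ((b + 1 / (M : ℚ) ^ 2 : ℚ) : ℝ) := by exact_mod_cast h6
    push_cast at this
    rw [he]
    calc _ = (j : ℝ) / M := by ring
      _ ≤ _ := this
      _ = _ := by ring
  have ha : (0 : ℝ) < a := by exact_mod_cast h1
  have hq : 0 < 1 + s + s ^ 2 / 2 := by positivity
  have k1 : (j * e - e ^ 2) * (1 + s + s ^ 2 / 2) < (j + 1) * e := by
    calc (j * e - e ^ 2) * (1 + s + s ^ 2 / 2) ≤ b * (1 + s + s ^ 2 / 2) :=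
          mul_le_mul_of_nonneg_right (by linarith) hq.le
      _ < a * Real.exp (-s) * (1 + s + s ^ 2 / 2) := by
          refine mul_lt_mul_of_pos_right ?_ hq
          rw [← h3']
          exact mul_lt_mul_of_pos_left hprod ha
      _ = a * (Real.exp (-s) * (1 + s + s ^ 2 / 2)) := by ring
      _ ≤ a * 1 := mul_le_mul_of_nonneg_left hexp ha.le
      _ ≤ _ := by rw [mul_one]; exact h5'
  have k2 : (j - e) * (1 + s + s ^ 2 / 2) < j + 1 := by
    have : (j - e) * (1 + s + s ^ 2 / 2) * e < (j + 1) * e := by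
      calc _ = (j * e - e ^ 2) * (1 + s + s ^ 2 / 2) := by ring
        _ < _ := k1
    exact lt_of_mul_lt_mul_right this he0.le
  -- The last factor is positive since `j ≥ 1` and `e ≤ 1/3`; this uses `M ≥ 3`.
  have k3 : (j - e) * (1 + s + s ^ 2 / 2) - (j + 1) =
      (1 + e) / (2 * (j : ℝ) ^ 2) * (j * (1 - e) - e - e ^ 2) := by
    rw [hs]; field_simp; ring
  have k4 : 0 ≤ (1 + e) / (2 * (j : ℝ) ^ 2) * (j * (1 - e) - e - e ^ 2) := by
    refine mul_nonneg (by positivity) ?_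
    nlinarith
  linarith

end GoodGuess

/-! ### Feasibility and objective of a configuration at its quantile profile. -/

section FeasibleOpt

variable {M : ℕ} {I : UCInstance} {T : List Piece} {g : Fin M → PUtil} {C : I.Config}

theorem feasible_of_guess (hT : T.Nodup) (hP : IsPieceSystem M (configPieces I T C))
    (hg : Monotone g) (hn : I ≠ []) (hM : 3 ≤ M)
    (hle : ∀ m ≤ M, allLow (configPieces I T C) g m ≤ m / (M : ℚ))
    (hge : ∀ m ≤ M, (m : ℚ) / M ≤ allLow (configPieces I T C) g m + 1 / (M : ℚ) ^ 2) :
    Feasible I T g C where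
  cond_defined j i := by
    rw [cumProb_eq_lowProb hT]
    exact (lowProb_pos hP hM hge (Nat.succ_pos j) j.2).2 i
  lower j := by
    have h1 := sum_binRatio_ge hP hM hle hge j.2
    have h2 := sum_binRatio_le (C := C) hT hg hn (by omega) j
    linarith
  upper j hj := (roundedEst_le hT hg hn (by omega) j).trans
    (sum_binRatio_le_of_guess hP hM hle hge hj j.2)

/-- The contribution of bin `J` is at most `J/M` times the conditional utilities, and the weight
satisfies `(J-5)/(M-1) ≥ (J-5)/M = (1 - 5/J)(J/M)`. -/
theorem le_utilEst (hT : T.Nodup) (hP : IsPieceSystem M (configPieces I T C))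
    (hg : Monotone g) (hM : 3 ≤ M)
    (hle : ∀ m ≤ M, allLow (configPieces I T C) g m ≤ m / (M : ℚ))
    (hge : ∀ m ≤ M, (m : ℚ) / M ≤ allLow (configPieces I T C) g m + 1 / (M : ℚ) ^ 2) :
    ∑ j : Fin M, (1 - 5 / ((j : ℕ) + 1 : ℚ)) * binValue (configPieces I T C) g j ≤
      utilEst I T g C := by
  refine Finset.sum_le_sum fun j _ => ?_
  obtain ⟨hpos, hpos'⟩ := lowProb_pos hP hM hge (Nat.succ_pos j) j.2
  have h0 := binValue_nonneg hP (g := g) j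
  split_ifs with h6
  · have h1 := binValue_le hP hg j hpos'
    have h2 := hle (j + 1) j.2
    simp only [condBinUtil_eq_div hT]
    set X := ∑ i, binUtil (configPieces I T C) g j i / lowProb (configPieces I T C) g (j + 1) i
    have hX : 0 ≤ X := Finset.sum_nonneg fun i _ =>
      div_nonneg (binUtil_nonneg hP _ _) (lowProb_nonneg hP _ _)
    have hj5 : (5 : ℚ) ≤ (j : ℕ) := by exact_mod_cast (by omega : 5 ≤ (j : ℕ))
    have hjM : ((j : ℕ) : ℚ) + 1 ≤ M := by exact_mod_cast j.2
    have h3 : binValue (configPieces I T C) g j ≤ (((j : ℕ) : ℚ) + 1) / M * X := by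
      refine h1.trans (mul_le_mul_of_nonneg_right ?_ hX)
      exact_mod_cast h2
    have h4 : 0 ≤ 1 - 5 / (((j : ℕ) : ℚ) + 1) := by
      rw [sub_nonneg, div_le_one (by linarith)]
      linarith
    refine (mul_le_mul_of_nonneg_left h3 h4).trans ?_
    rw [← mul_assoc]
    refine mul_le_mul_of_nonneg_right ?_ hX
    have e : (1 - 5 / (((j : ℕ) : ℚ) + 1)) * ((((j : ℕ) : ℚ) + 1) / M) =
      (((j : ℕ) : ℚ) + 1 - 5) / M := by
      field_simp
    rw [e]
    exact div_le_div_of_nonneg_left (by linarith) (by linarith) (by linarith)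
  -- For the first five bins `1 - 5/J ≤ 0`, so dropping them from the objective does no harm.
  · have hj5 : ((j : ℕ) : ℚ) + 1 ≤ 5 := by exact_mod_cast (by omega : (j : ℕ) + 1 ≤ 5)
    refine mul_nonpos_of_nonpos_of_nonneg ?_ h0
    rw [sub_nonpos, one_le_div (by positivity)]
    exact hj5

end FeasibleOpt

/-! ### Aligned instances -/

/-- Concavity of the square root. An atom of the agent utility is cut into a part of mass `p₁` with
principal utility at most `u` and a part of mass `p₂` with principal utility at least `u`; so the
value up to the cut lies below the chord, and the chord below the root. -/
theorem sqrt_interpolate {κ a b₁ b₂ p p₁ p₂ u : ℝ} (hκ : 0 ≤ κ) (hp : 0 ≤ p) (hp₁ : 0 ≤ p₁)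
    (hp₂ : 0 ≤ p₂) (ha : a ≤ κ * √p) (hb : a + b₁ + b₂ ≤ κ * √(p + p₁ + p₂))
    (h₁ : b₁ ≤ u * p₁) (h₂ : u * p₂ ≤ b₂) : a + b₁ ≤ κ * √(p + p₁) := by
  rcases (add_nonneg hp₁ hp₂).eq_or_lt with h0 | h0
  · have e1 : p₁ = 0 := by linarith
    rw [e1] at h₁ ⊢
    rw [add_zero]
    linarith
  -- The fraction of the atom's mass that lies below the cut.
  · set θ := p₁ / (p₁ + p₂) with hθ
    have hθ0 : 0 ≤ θ := by positivity
    have hθ1 : θ ≤ 1 := by rw [hθ, div_le_one h0]; linarith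
    have e1 : θ * (p₁ + p₂) = p₁ := by rw [hθ]; field_simp
    have hb' : b₁ ≤ θ * (b₁ + b₂) := by
      rw [hθ, div_mul_eq_mul_div, le_div_iff₀ h0]
      nlinarith [mul_le_mul_of_nonneg_right h₁ hp₂, mul_le_mul_of_nonneg_right h₂ hp₁]
    have hs : (1 - θ) * √p + θ * √(p + p₁ + p₂) ≤ √(p + p₁) := by
      apply Real.le_sqrt_of_sq_le
      have s1 := Real.sq_sqrt hp
      have s2 := Real.sq_sqrt (by positivity : 0 ≤ p + p₁ + p₂)
      have s3 : p + p₁ = (1 - θ) * p + θ * (p + p₁ + p₂) := by linear_combination -e1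
      have s4 : (1 - θ) * p + θ * (p + p₁ + p₂) = (1 - θ) * √p ^ 2 + θ * √(p + p₁ + p₂) ^ 2 := by
        rw [s1, s2]
      refine le_of_le_of_eq ?_ (s3.trans s4).symm
      nlinarith [mul_nonneg (mul_nonneg hθ0 (sub_nonneg.2 hθ1)) (sq_nonneg (√p - √(p + p₁ + p₂)))]
    calc a + b₁ ≤ (1 - θ) * a + θ * (a + b₁ + b₂) := by linarith
      _ ≤ (1 - θ) * (κ * √p) + θ * (κ * √(p + p₁ + p₂)) :=
        add_le_add (mul_le_mul_of_nonneg_left ha (by linarith)) (mul_le_mul_of_nonneg_left hb hθ0)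
      _ = κ * ((1 - θ) * √p + θ * √(p + p₁ + p₂)) := by ring
      _ ≤ _ := mul_le_mul_of_nonneg_left hs hκ

/-! ### Means over the winning piece, and perturbed thresholds. -/

section WinMean

variable {M n : ℕ} {P : Fin n → Finset Piece}

theorem winMean_congr {h h' : Piece → ℚ} (hh : ∀ i, ∀ x ∈ P i, h x = h' x) :
    winMean P h = winMean P h' :=
  Finset.sum_congr rfl fun i _ => Finset.sum_congr rfl fun x hx => by rw [hh i x hx]

theorem winMean_add (h h' : Piece → ℚ) :
    winMean P (fun x => h x + h' x) = winMean P h + winMean P h' := by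
  simp only [winMean, mul_add, Finset.sum_add_distrib]

theorem winMean_mul (c : ℚ) (h : Piece → ℚ) : winMean P (fun x => c * h x) = c * winMean P h := by
  simp only [winMean, Finset.mul_sum]
  exact Finset.sum_congr rfl fun i _ => Finset.sum_congr rfl fun x _ => by ring

theorem winMean_mono (hP : IsPieceSystem M P) {h h' : Piece → ℚ}
    (hh : ∀ i, ∀ x ∈ P i, h x ≤ h' x) : winMean P h ≤ winMean P h' :=
  Finset.sum_le_sum fun i _ => Finset.sum_le_sum fun x hx =>
    mul_le_mul_of_nonneg_left (hh i x hx) (winProb_nonneg hP hx)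

theorem winMean_nonneg (hP : IsPieceSystem M P) {h : Piece → ℚ}
    (hh : ∀ i, ∀ x ∈ P i, 0 ≤ h x) : 0 ≤ winMean P h :=
  Finset.sum_nonneg fun i _ => Finset.sum_nonneg fun x hx =>
    mul_nonneg (winProb_nonneg hP hx) (hh i x hx)

theorem winMean_eq_zero (hP : IsPieceSystem M P) {p : Piece → Prop} [DecidablePred p]
    (h0 : winMean P (fun x => if p x then 1 else 0) = 0) (h : Piece → ℚ) :
    winMean P (fun x => if p x then h x else 0) = 0 := by
  have h1 : ∀ i, ∀ x ∈ P i, 0 ≤ winProb P i x * (if p x then 1 else 0) := fun i x hx =>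
    mul_nonneg (winProb_nonneg hP hx) (by split_ifs <;> norm_num)
  refine Finset.sum_eq_zero fun i hi => Finset.sum_eq_zero fun x hx => ?_
  have h2 := (Finset.sum_eq_zero_iff_of_nonneg fun i _ => Finset.sum_nonneg (h1 i)).1 h0 i hi
  have h3 := (Finset.sum_eq_zero_iff_of_nonneg (h1 i)).1 h2 x hx
  change winProb P i x * (if p x then h x else 0) = 0
  split_ifs at h3 ⊢
  · rw [mul_one] at h3
    rw [h3, zero_mul]
  · rw [mul_zero]

/-- A bound by the square root of the probability extends from thresholds for the agent utility to
thresholds for the perturbed agent utility. -/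
theorem winMean_lt_le_sqrt (hP : IsPieceSystem M P) {κ : ℝ} (hκ : 0 ≤ κ)
    (hal : ∀ U : WithBot ℚ,
      (winMean P (fun x => if (ofLex x.agent).1 ≤ U then x.principal else 0) : ℝ) ≤
        κ * √(winMean P (fun x => if (ofLex x.agent).1 ≤ U then 1 else 0) : ℚ))
    {z : Piece}
    (hz : ∀ i, ∀ x ∈ P i, ((ofLex x.agent).2 ≤ (ofLex z.agent).2 → x.principal ≤ z.principal) ∧
      ((ofLex z.agent).2 ≤ (ofLex x.agent).2 → z.principal ≤ x.principal)) :
    (winMean P (fun x => if x.agent < z.agent then x.principal else 0) : ℝ) ≤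
      κ * √(winMean P (fun x => if x.agent < z.agent then 1 else 0) : ℚ) := by
  classical
  set u := (ofLex z.agent).1
  let F : (Piece → Prop) → (Piece → ℚ) → ℚ := fun p h =>
    open Classical in winMean P fun x => if p x then h x else 0
  have hlt : ∀ x : Piece, x.agent < z.agent ↔ (ofLex x.agent).1 < u ∨
      (ofLex x.agent).1 = u ∧ (ofLex x.agent).2 < (ofLex z.agent).2 := fun x => Prod.Lex.lt_iff
  -- Winners strictly below the atom of `z`, in the atom and before `z`, and in the rest of the
  -- atom. Since `z` may belong to another configuration, it is compared with the pieces only by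
  -- `hz`.
  let A : Piece → Prop := fun x => (ofLex x.agent).1 < u
  let B : Piece → Prop := fun x => (ofLex x.agent).1 = u ∧ (ofLex x.agent).2 < (ofLex z.agent).2
  let B' : Piece → Prop := fun x => (ofLex x.agent).1 = u ∧ ¬ (ofLex x.agent).2 < (ofLex z.agent).2
  have e1 : ∀ h : Piece → ℚ, winMean P (fun x => if x.agent < z.agent then h x else 0) =
      F A h + F B h := fun h => by
    rw [← winMean_add]
    refine winMean_congr fun i x _ => ?_
    simp only [hlt, A, B]
    rcases lt_trichotomy (ofLex x.agent).1 u with k | k | k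
    · simp [k, k.ne]
    · simp [k]
    · simp [k.not_gt, k.ne']
  have e2 : ∀ h : Piece → ℚ, winMean P (fun x => if (ofLex x.agent).1 ≤ u then h x else 0) =
      F A h + F B h + F B' h := fun h => by
    rw [← winMean_add, ← winMean_add]
    refine winMean_congr fun i x _ => ?_
    simp only [A, B, B']
    rcases lt_trichotomy (ofLex x.agent).1 u with k | k | k
    · simp [k, k.ne, k.le]
    · by_cases k' : (ofLex x.agent).2 < (ofLex z.agent).2
      · simp [k, k']
      · simp [k, k']
    · simp [k.not_gt, k.ne', k.not_ge]
  have hA : (F A Piece.principal : ℝ) ≤ κ * √(F A fun _ => 1 : ℚ) := by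
    -- The hypothesis concerns closed thresholds `≤ U`, so a strict threshold is replaced by the
    -- largest occurring utility below it.
    let V : Finset (WithBot ℚ) :=
      (univ.biUnion fun i => (P i).image fun x => (ofLex x.agent).1).filter (· < u)
    have hV : ∀ i, ∀ x ∈ P i, A x → (ofLex x.agent).1 ∈ V := fun i x hx h =>
      Finset.mem_filter.2 ⟨Finset.mem_biUnion.2 ⟨i, Finset.mem_univ i,
        Finset.mem_image_of_mem (fun x : Piece => (ofLex x.agent).1) hx⟩, h⟩
    rcases V.eq_empty_or_nonempty with hV0 | hne
    · have h0 : F A Piece.principal = 0 :=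
        Finset.sum_eq_zero fun i _ => Finset.sum_eq_zero fun x hx => by
          have : ¬ A x := fun h => by simpa [hV0] using hV i x hx h
          simp only [this, if_false, mul_zero]
      rw [h0, Rat.cast_zero]
      positivity
    · have h1 := hal (V.max' hne)
      have e3 : ∀ h : Piece → ℚ, winMean P (fun x =>
          if (ofLex x.agent).1 ≤ V.max' hne then h x else 0) = F A h := fun h => by
        refine winMean_congr fun i x hx => ?_
        have k : (ofLex x.agent).1 ≤ V.max' hne ↔ A x :=
          ⟨fun k => k.trans_lt (Finset.mem_filter.1 (V.max'_mem hne)).2,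
            fun k => V.le_max' _ (hV i x hx k)⟩
        by_cases k' : A x
        · rw [if_pos (k.2 k'), if_pos k']
        · rw [if_neg (mt k.1 k'), if_neg k']
      rwa [e3, e3] at h1
  have hu := hal u
  have h0 : ∀ p, 0 ≤ F p fun _ => 1 := fun p => winMean_nonneg hP fun i x _ => by
    split_ifs <;> norm_num
  have h1 : F B Piece.principal ≤ z.principal * F B fun _ => 1 := by
    rw [← winMean_mul]
    refine winMean_mono hP fun i x hx => ?_
    by_cases k : B x
    · simp only [k, if_true, mul_one]
      exact (hz i x hx).1 k.2.le
    · simp only [k, if_false, mul_zero, le_refl]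
  have h2 : (z.principal * F B' fun _ => 1) ≤ F B' Piece.principal := by
    rw [← winMean_mul]
    refine winMean_mono hP fun i x hx => ?_
    by_cases k : B' x
    · simp only [k, if_true, mul_one]
      exact (hz i x hx).2 (not_lt.1 k.2)
    · simp only [k, if_false, mul_zero, le_refl]
  rw [e2, e2] at hu
  rw [e1, e1]
  push_cast at hu ⊢
  exact sqrt_interpolate hκ (by exact_mod_cast h0 A) (by exact_mod_cast h0 B)
    (by exact_mod_cast h0 B') hA hu (u := z.principal) (by exact_mod_cast h1)
    (by exact_mod_cast h2)

end WinMean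

/-! ### The loss from the weights of the bins -/

/-- The left side is `5/(√m (m+1))`; the right side is chosen to telescope. -/
theorem five_div_le {m : ℕ} (hm : 0 < m) :
    5 * √(m : ℝ) * (1 / m - 1 / (m + 1)) ≤ 10 * (1 / √(m : ℝ) - 1 / √((m : ℝ) + 1)) := by
  have hm0 : (0 : ℝ) < m := by exact_mod_cast hm
  have h1 : 0 < √(m : ℝ) := Real.sqrt_pos.2 hm0
  have h2 : 0 < √((m : ℝ) + 1) := Real.sqrt_pos.2 (by linarith)
  have s1 := Real.sq_sqrt hm0.le
  have s2 := Real.sq_sqrt (by linarith : (0 : ℝ) ≤ m + 1)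
  have h3 : √(m : ℝ) ≤ √((m : ℝ) + 1) := Real.sqrt_le_sqrt (by linarith)
  set x := √(m : ℝ)
  set y := √((m : ℝ) + 1)
  have e1 : 5 * x * (1 / m - 1 / (m + 1)) = 5 / (x * y ^ 2) := by
    rw [s2, ← s1]
    field_simp
    ring
  have e2 : 10 * (1 / x - 1 / y) = 10 / (x * y * (x + y)) := by
    have : (y - x) * (x + y) = 1 := by linear_combination s2 - s1
    field_simp
    linear_combination this
  rw [e1, e2, div_le_div_iff₀ (by positivity) (by positivity)]
  have : 0 ≤ x * y * (y - x) := mul_nonneg (by positivity) (by linarith)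
  nlinarith

/-- Summation by parts: the partial sum up to `k`, which is at most `A√k`, has the coefficient `5/k
- 5/(k+1)`, and these terms telescope by `five_div_le`. The total sum is kept exact, since its
coefficient `5/m` is small already. -/
theorem sum_weights_le {V : ℕ → ℝ} {A : ℝ} (hA : 0 ≤ A) {m : ℕ} (hm : 0 < m)
    (hV : ∀ k, 0 < k → k < m → ∑ j ∈ range k, V j ≤ A * √(k : ℝ)) :
    ∑ j ∈ range m, 5 / ((j : ℝ) + 1) * V j ≤
      5 / m * (∑ j ∈ range m, V j) + 10 * A * (1 - 1 / √(m : ℝ)) := by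
  induction m, hm using Nat.le_induction with
  | base => simp
  | succ m hm ih =>
    have ih := ih fun k h0 hk => hV k h0 (hk.trans (Nat.lt_succ_self m))
    have hm0 : (0 : ℝ) < m := by exact_mod_cast hm
    have h1 := hV m hm (Nat.lt_succ_self m)
    have h2 := five_div_le hm
    rw [Finset.sum_range_succ, Finset.sum_range_succ]
    push_cast
    have h3 : (0 : ℝ) ≤ 5 * (1 / m - 1 / (m + 1)) := by
      have : (1 : ℝ) / (m + 1) ≤ 1 / m := one_div_le_one_div_of_le hm0 (by linarith)
      linarith
    have h4 := mul_le_mul_of_nonneg_left h1 h3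
    have h5 := mul_le_mul_of_nonneg_left h2 hA
    have e : 5 / (m : ℝ) = 5 * (1 / m) := by ring
    have e' : 5 / ((m : ℝ) + 1) = 5 * (1 / (m + 1)) := by ring
    rw [e] at ih
    rw [e']
    nlinarith

/-! ### The approximation guarantee. -/

section Approximation

variable {M : ℕ} {I : UCInstance} {C : I.Config}

theorem UCInstance.value_nonneg (hI : I.Valid) (C : I.Config) : 0 ≤ I.value C := by
  refine Finset.sum_nonneg fun ω _ => mul_nonneg (Finset.prod_nonneg fun i _ => ?_) ?_
  · exact ((hI.dist _ (List.get_mem _ _) _ (List.get_mem _ _)).1 _ (List.get_mem _ _)).le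
  · exact favouritePayoff_nonneg fun i _ => hI.principal_nonneg _ (List.get_mem _ _) _
      (List.get_mem _ _) _ (List.get_mem _ _)

theorem sum_range_binValue {n : ℕ} {P : Fin n → Finset Piece} {g : Fin M → PUtil}
    (hg : Monotone g) (m : ℕ) :
    ∑ j ∈ range m, (if h : j < M then binValue P g ⟨j, h⟩ else 0) =
      winMean P fun x => if InBins g m x.agent then x.principal else 0 := by
  induction m with
  | zero =>
    symm
    refine Finset.sum_eq_zero fun i _ => Finset.sum_eq_zero fun x _ => ?_
    simp only [inBins_zero, if_false, mul_zero]
  | succ m ih =>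
    rw [Finset.sum_range_succ, ih]
    split_ifs with h
    · have e : binValue P g ⟨m, h⟩ =
          winMean P fun x => if InBin g ⟨m, h⟩ x.agent then x.principal else 0 := by
        refine Finset.sum_congr rfl fun i _ => Finset.sum_congr rfl fun x _ => ?_
        rw [mul_ite, mul_zero]
      rw [e, ← winMean_add]
      refine winMean_congr fun i x _ => ?_
      have h1 := inBin_iff_of_monotone hg ⟨m, h⟩ (u := x.agent)
      by_cases h2 : InBins g m x.agent
      · rw [if_pos h2, if_pos (inBins_mono (Nat.le_succ m) h2), if_neg fun k => (h1.1 k).2 h2,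
          add_zero]
      · rw [if_neg h2, zero_add]
        exact if_congr (h1.trans (and_iff_left h2)) rfl rfl
    · rw [add_zero]
      refine winMean_congr fun i x _ => if_congr ⟨inBins_mono (Nat.le_succ m), ?_⟩ rfl rfl
      rintro ⟨k, -, hk⟩
      exact ⟨k, k.2.trans_le (not_lt.1 h), hk⟩

/-- On an aligned instance, some guess makes an optimal configuration feasible, with an estimate
close to the optimal value. -/
theorem exists_guess_utilEst {c : ℝ} (hc : 0 < c) (hM : 3 ≤ M) (hI : I.Valid) (hn : I ≠ [])
    (hal : ∀ U : WithBot ℚ, 0 < I.probLe C U →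
      (I.condValue C U : ℝ) ≤ 1 / (c * √(I.probLe C U : ℝ)) * (I.value C : ℝ))
    {L : List Mass} (hL : L.Perm I.masses)
    (hs : L.Pairwise fun x y => x.principal ≤ y.principal) :
    ∃ g : Fin M → PUtil, IsGuess (pieces M L) g ∧
      (∀ x ∈ pieces M L, InBins g M x.agent) ∧ Feasible I (pieces M L) g C ∧
      (1 - (5 + 10 / c) / √(M : ℝ)) * (I.value C : ℝ) ≤ (utilEst I (pieces M L) g C : ℝ) := by
  have : NeZero I.length := ⟨fun e => hn (List.length_eq_zero_iff.1 e)⟩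
  have hP := isPieceSystem hI (by omega) hL hs C (M := M)
  have hT : ∀ i, ∀ x ∈ configPieces I (pieces M L) C i, x ∈ pieces M L := fun i x hx =>
    (mem_configPieces.1 hx).1
  obtain ⟨g, hg, htop, hmid, hle, hge⟩ := exists_guess hP (by omega) hT
  have hnd := pieces_nodup M L
  refine ⟨g, hg, htop, feasible_of_guess hnd hP hg.1 hn hM hle hge, ?_⟩
  have h1 := le_utilEst hnd hP hg.1 hM hle hge
  have hV := value_eq_winMean hP hL
  have hV0 := UCInstance.value_nonneg hI C
  have hV0' : (0 : ℝ) ≤ I.value C := by exact_mod_cast hV0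
  have hM0 : (0 : ℝ) < M := by exact_mod_cast (by omega : 0 < M)
  have hMs : 0 < √(M : ℝ) := Real.sqrt_pos.2 hM0
  set P := configPieces I (pieces M L) C
  -- Multiplying the alignment inequality by `q` turns `1/√q` into `√q` and also covers the case `q
  -- = 0`.
  have hal' : ∀ U : WithBot ℚ,
      (winMean P (fun x => if (ofLex x.agent).1 ≤ U then x.principal else 0) : ℝ) ≤
        (I.value C / c) * √(winMean P (fun x => if (ofLex x.agent).1 ≤ U then 1 else 0) : ℚ) := by
    intro U
    have hq : 0 ≤ winMean P (fun x => if (ofLex x.agent).1 ≤ U then 1 else 0) :=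
      winMean_nonneg hP fun i x _ => by split_ifs <;> norm_num
    rcases hq.eq_or_lt with h0 | h0
    · rw [winMean_eq_zero hP h0.symm, Rat.cast_zero]
      positivity
    · have h2 := hal U (by rwa [probLe_eq_winMean hP hL hn])
      rw [condValue_eq_winMean hP hL hn, probLe_eq_winMean hP hL hn, Rat.cast_div] at h2
      have h0' : (0 : ℝ) < (winMean P (fun x => if (ofLex x.agent).1 ≤ U then 1 else 0) : ℚ) := by
        exact_mod_cast h0
      rw [div_le_iff₀ h0'] at h2
      refine h2.trans_eq ?_
      set q : ℝ := ((winMean P (fun x => if (ofLex x.agent).1 ≤ U then 1 else 0) : ℚ) : ℝ)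
      have s := Real.sq_sqrt h0'.le
      have s0 := Real.sqrt_pos.2 h0'
      nth_rewrite 2 [← s]
      field_simp
  -- The first `m` bins are cut off by the utility of a piece `z`, and the winner lies below it with
  -- probability `allLow m ≤ m/M`.
  have hmidb : ∀ m, 0 < m → m < M →
      ((winMean P fun x => if InBins g m x.agent then x.principal else 0 : ℚ) : ℝ) ≤
        (I.value C / c / √(M : ℝ)) * √(m : ℝ) := by
    intro m h0 hm
    obtain ⟨t, ⟨z, hz, rfl⟩, ht⟩ := hmid m h0 hm
    have h2 := winMean_lt_le_sqrt hP (by positivity) hal' (z := z) fun i x hx =>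
      ⟨pieces_mono hs (hT i x hx) hz, pieces_mono hs hz (hT i x hx)⟩
    rw [winMean_lt hP hn] at h2
    have e1 : (∏ i, probLt P i z.agent) = allLow P g m :=
      Finset.prod_congr rfl fun i _ => Finset.sum_congr rfl fun x _ =>
        if_congr (ht _).symm rfl rfl
    have e2 : (winMean P fun x => if InBins g m x.agent then x.principal else 0) =
        winMean P fun x => if x.agent < z.agent then x.principal else 0 :=
      winMean_congr fun i x _ => if_congr (ht _) rfl rfl
    rw [e2]
    refine h2.trans ?_
    have h3 : ((allLow P g m : ℚ) : ℝ) ≤ m / M := by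
      have := Rat.cast_le (K := ℝ).2 (hle m hm.le)
      push_cast at this
      exact this
    rw [e1]
    calc _ ≤ (I.value C / c) * √((m : ℝ) / M) :=
          mul_le_mul_of_nonneg_left (Real.sqrt_le_sqrt h3) (by positivity)
      _ = _ := by rw [Real.sqrt_div' _ hM0.le]; ring
  let V : ℕ → ℝ := fun j => ((if h : j < M then binValue P g ⟨j, h⟩ else 0 : ℚ) : ℝ)
  have hsum : ∀ m, ∑ j ∈ range m, V j =
      ((winMean P fun x => if InBins g m x.agent then x.principal else 0 : ℚ) : ℝ) := fun m => by
    rw [← sum_range_binValue hg.1, Rat.cast_sum]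
  have hVM : ∑ j ∈ range M, V j = I.value C := by
    rw [hsum, hV]
    exact congrArg _ (winMean_congr fun i x hx => if_pos (htop x (hT i x hx)))
  have hw := sum_weights_le (V := V) (A := I.value C / c / √(M : ℝ)) (by positivity)
    (by omega : 0 < M) fun k h0 hk => (hsum k).le.trans (hmidb k h0 hk)
  have h2 : ((∑ j : Fin M, (1 - 5 / ((j : ℕ) + 1 : ℚ)) * binValue P g j : ℚ) : ℝ) =
      ∑ j ∈ range M, V j - ∑ j ∈ range M, 5 / ((j : ℝ) + 1) * V j := by
    rw [← Finset.sum_sub_distrib, Finset.sum_range, Rat.cast_sum]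
    refine Finset.sum_congr rfl fun j _ => ?_
    simp only [V, dif_pos j.2]
    push_cast
    ring
  have h1' : ((∑ j : Fin M, (1 - 5 / ((j : ℕ) + 1 : ℚ)) * binValue P g j : ℚ) : ℝ) ≤
      utilEst I (pieces M L) g C := by exact_mod_cast h1
  refine le_trans ?_ h1'
  rw [h2, hVM]
  rw [hVM] at hw
  have h3 : 5 / (M : ℝ) ≤ 5 / √(M : ℝ) := by
    refine div_le_div_of_nonneg_left (by norm_num) hMs ?_
    exact (Real.sqrt_le_left hM0.le).2 (by
      have : (1 : ℝ) ≤ M := by exact_mod_cast (by omega : 1 ≤ M)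
      nlinarith)
  have h4 := mul_le_mul_of_nonneg_right h3 hV0'
  have h5 : 10 * ((I.value C : ℝ) / c / √(M : ℝ)) * (1 - 1 / √(M : ℝ)) ≤
      10 * ((I.value C : ℝ) / c / √(M : ℝ)) := by
    refine mul_le_of_le_one_right (by positivity) ?_
    have : 0 ≤ 1 / √(M : ℝ) := by positivity
    linarith
  have e : (1 - (5 + 10 / c) / √(M : ℝ)) * (I.value C : ℝ) = I.value C -
      5 / √(M : ℝ) * I.value C - 10 * ((I.value C : ℝ) / c / √(M : ℝ)) := by
    field_simp
    ring
  rw [e]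
  linarith

/-- For the good guess: the output is at least as good as the inner optimum, whose value is at least
its estimate, which is at least the estimate of an optimal configuration. -/
theorem value_ge_of_isAlgOutput {c : ℝ} (hc : 0 < c) (hM : 1 ≤ M) (hI : I.Valid)
    (hal : I.UtilityAligned fun q => 1 / (c * √q)) (hC : IsAlgOutput M I C) (C' : I.Config) :
    (1 - (5 + 10 / c) / √(M : ℝ)) * (I.value C' : ℝ) ≤ (I.value C : ℝ) := by
  have hC0 : (0 : ℝ) ≤ I.value C := by exact_mod_cast UCInstance.value_nonneg hI C
  have hC0' : (0 : ℝ) ≤ I.value C' := by exact_mod_cast UCInstance.value_nonneg hI C'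
  rcases eq_or_ne I [] with hn | hn
  · have e : C' = C := by
      subst hn
      exact funext fun i => i.elim0
    rw [e]
    refine mul_le_of_le_one_left hC0 ?_
    have : 0 ≤ (5 + 10 / c) / √(M : ℝ) := by positivity
    linarith
  have hM0 : (0 : ℝ) < M := by exact_mod_cast hM
  have hMs : 0 < √(M : ℝ) := Real.sqrt_pos.2 hM0
  rcases lt_or_ge M 3 with hM3 | hM3
  -- For `M < 3` the claimed factor is not positive, because `√M ≤ 5`.
  · refine (mul_nonpos_of_nonpos_of_nonneg ?_ hC0').trans hC0
    rw [sub_nonpos, one_le_div hMs]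
    have h1 : √(M : ℝ) ≤ 5 := by
      rw [Real.sqrt_le_left (by norm_num)]
      have : (M : ℝ) ≤ 3 := by exact_mod_cast hM3.le
      linarith
    have : 0 ≤ 10 / c := by positivity
    linarith
  obtain ⟨Co, hopt, hal⟩ := hal
  obtain ⟨L, hL, hs, sol, hsol, hbest, hout⟩ := hC
  obtain ⟨g, hg, htop, hfeas, hest⟩ := exists_guess_utilEst hc hM3 hI hn hal hL hs
  have h1 := hsol g hg
  have key : (1 - (5 + 10 / c) / √(M : ℝ)) * (I.value Co : ℝ) ≤ (I.value C : ℝ) := by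
    cases hsg : sol g with
    | none =>
      rw [hsg] at h1
      exact absurd hfeas (h1 Co)
    | some Cg =>
      rw [hsg] at h1
      have hP := isPieceSystem hI hM hL hs Cg (M := M)
      have h2 := utilEst_le_winMean (pieces_nodup M L) hP hg.1 hn hM
        (fun i x hx => htop x (mem_configPieces.1 hx).1) h1.1
      rw [← value_eq_winMean hP hL] at h2
      have h3 : utilEst I (pieces M L) g Co ≤ I.value C :=
        (h1.2 Co hfeas).trans (h2.trans (hbest g hg Cg hsg))
      exact hest.trans (by exact_mod_cast h3)
  rcases le_or_gt 0 (1 - (5 + 10 / c) / √(M : ℝ)) with h | h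
  · refine le_trans (mul_le_mul_of_nonneg_left ?_ h) key
    exact_mod_cast hopt C'
  · exact (mul_nonpos_of_nonpos_of_nonneg h.le hC0').trans hC0

end Approximation

/-! ### Approximation schemes by reduction to aligned instances of utility configuration -/

theorem enc_listBool (l : List Bool) : (enc l : (Ty.list .bool).Val) = l :=
  List.map_id'' (fun _ => rfl) l

/-- A fineness parameter that suffices for a `(1 - ε)`-approximation. -/
def fineness (ε : ℚ) : ℕ := ⌊35 / ε * (35 / ε)⌋₊ + 1

theorem div_sqrt_fineness_le {ε : ℚ} (hε : 0 < ε) : 35 / √(fineness ε : ℝ) ≤ ε := by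
  have hε' : (0 : ℝ) < ε := by exact_mod_cast hε
  have h1 : (35 / (ε : ℝ)) ^ 2 ≤ fineness ε := by
    have h2 : (35 / ε * (35 / ε) : ℚ) ≤ fineness ε := by
      have := (Nat.lt_floor_add_one (35 / ε * (35 / ε))).le
      simpa [fineness] using this
    have h3 : ((35 / ε * (35 / ε) : ℚ) : ℝ) ≤ ((fineness ε : ℚ) : ℝ) := Rat.cast_le.2 h2
    push_cast at h3
    rwa [sq]
  have h4 : 35 / (ε : ℝ) ≤ √(fineness ε : ℝ) := Real.le_sqrt_of_sq_le h1
  have h5 : 0 < 35 / (ε : ℝ) := by positivity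
  rw [div_le_iff₀ (h5.trans_le h4)]
  rwa [div_le_iff₀ hε', mul_comm] at h4

theorem HasPTAS.of_reduction {α : Type} [Data α] [TameData α]
    (dec : (ty α).Val → α) (hdec : ∀ y, enc (dec y) = y) (P : MaxProblem (ty α) (.list .bool))
    {J : α → RawUC} {post : α → List ℕ → List Bool} (hJ : PolyTime J)
    (hpost : PolyTime fun x : α × List ℕ => post x.1 x.2)
    (h : ∀ x, P.IsInstance x → UCInstance.Valid (J (dec x)) ∧
      UCInstance.UtilityAligned (fun q => 1 / (1 / 3 * √q)) (J (dec x)) ∧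
      (∀ C : UCInstance.Config (J (dec x)),
        P.IsSolution x (post (dec x) (List.ofFn fun i => (C i : ℕ))) ∧
        UCInstance.value (J (dec x)) C ≤
          P.value x (post (dec x) (List.ofFn fun i => (C i : ℕ)))) ∧
      ∀ y, P.IsSolution x y → ∃ C : UCInstance.Config (J (dec x)),
        P.value x y = UCInstance.value (J (dec x)) C) : HasPTAS P := by
  -- As in `exists_program`, with `M` computed from `ε`: the padding is polynomial in the instance
  -- for each fixed `ε`.
  let E : ℚ × α → ℕ := fun x => (wt (J x.2) + fineness x.1 + 2) ^ (fineness x.1 + 1)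
  have h1 : PolyTime fun x : ℚ × α => J x.2 := hJ.comp PolyTime.snd'
  have h2 : PolyTime fun x : ℚ × α => fineness x.1 := by
    unfold fineness
    fun_prop
  have h3 : PolyTime fun x : Padded (ℚ × α) (fun _ => True) E =>
      Impl.main (fineness x.1.1) (J x.1.2) :=
    PolyTime.main (PolyTime.padded_val h2) (PolyTime.padded_val h1)
      ⟨1, fun x => by
        show E x.1 ≤ (wt x.1 + E x.1 + 2) ^ 1
        rw [pow_one]; omega⟩
  have h4 : PolyTime fun x : Padded (ℚ × α) (fun _ => True) E => x.1.2 :=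
    PolyTime.padded_val PolyTime.snd'
  obtain ⟨A, hA, k, hk⟩ := PolyTime.padded_prog
    (f := fun x : ℚ × α => post x.2 (Impl.main (fineness x.1) (J x.2)))
    (hpost.comp (h4.prodMk h3))
  obtain ⟨j, hj⟩ := hJ.wt_le
  refine ⟨A, fun ε hε => ⟨⟨((Polynomial.C (wt ε + 1) + 2 * Polynomial.X) +
    ((2 * Polynomial.X + 2) ^ j + Polynomial.C (fineness ε + 2)) ^ (fineness ε + 1) + 2) ^ k,
    fun y _ => ?_⟩, fun y hy => ?_⟩⟩
  · have h5 := hk (ε, dec y) trivial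
    have h6 := TameData.wt_le (dec y)
    have h7 : wt (J (dec y)) ≤ _ := (hj (dec y)).trans
      (Nat.pow_le_pow_left (Nat.add_le_add_right h6 2) j)
    have e : (enc (ε, dec y) : (Ty.prod .rat (ty α)).Val) = (ε, y) := congrArg (Prod.mk ε) (hdec y)
    rw [e] at h5
    rw [hdec] at h6 h7
    refine h5.trans ?_
    simp only [Polynomial.eval_pow, Polynomial.eval_add, Polynomial.eval_mul, Polynomial.eval_C,
      Polynomial.eval_X, Polynomial.eval_ofNat]
    refine Nat.pow_le_pow_left (add_le_add (add_le_add ?_ ?_) le_rfl) k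
    · show wt ε + wt (dec y) + 1 ≤ _
      omega
    · refine Nat.pow_le_pow_left ?_ _
      simp only
      omega
  · obtain ⟨hv, hal, hout, hin⟩ := h y hy
    have hM : 1 ≤ fineness ε := Nat.le_add_left _ _
    obtain ⟨C, hC, e⟩ := Impl.main_spec hM hv
    have e2 : A.eval (ε, y) = post (dec y) (List.ofFn fun i => (C i : ℕ)) := by
      have h5 := hA (ε, dec y) trivial
      have h6 : (enc (ε, dec y) : (Ty.prod .rat (ty α)).Val) = (ε, y) :=
        congrArg (Prod.mk ε) (hdec y)
      rw [h6] at h5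
      rw [← enc_listBool (post (dec y) _), ← e]
      exact h5
    rw [e2]
    refine ⟨(hout C).1, fun y' hy' => ?_⟩
    obtain ⟨C', e'⟩ := hin y' hy'
    rw [e']
    refine le_trans ?_ (hout C).2
    have h5 := value_ge_of_isAlgOutput (by norm_num) hM hv hal hC C'
    have h6 := div_sqrt_fineness_le hε
    have h7 := UCInstance.value_nonneg hv C'
    have h8 : (0 : ℝ) ≤ (UCInstance.value (J (dec y)) C' : ℝ) := by exact_mod_cast h7
    -- Alignment with `c = 1/3` gives the loss `35/√M`, which is at most `ε` by the choice of
    -- `fineness`.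
    have h9 : (5 + 10 / (1 / 3) : ℝ) = 35 := by norm_num
    rw [h9] at h5
    have h10 : (1 - (ε : ℝ)) * (UCInstance.value (J (dec y)) C' : ℝ) ≤ (UCInstance.value (J (dec y)) C : ℝ) :=
      (mul_le_mul_of_nonneg_right (by linarith) h8).trans h5
    exact_mod_cast h10

/-! ### Selecting a set of actions -/

section Expect

variable {α : Type} {n : ℕ} {D : Fin n → List (α × ℚ)}

theorem mean_nonneg {L : List (α × ℚ)} (hL : IsDist L) {f : α → ℚ} (hf : ∀ x ∈ L, 0 ≤ f x.1) :
    0 ≤ mean L f :=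
  List.sum_nonneg fun y hy => by
    obtain ⟨x, hx, rfl⟩ := List.mem_map.1 hy
    exact mul_nonneg (hL.1 x hx).le (hf x hx)

theorem mean_mono {L : List (α × ℚ)} (hL : IsDist L) {f g : α → ℚ}
    (h : ∀ x ∈ L, f x.1 ≤ g x.1) : mean L f ≤ mean L g :=
  List.sum_le_sum fun x hx => mul_le_mul_of_nonneg_left (h x hx) (hL.1 x hx).le

theorem expect_mono (hD : ∀ i, IsDist (D i)) {f g : (Fin n → α) → ℚ}
    (h : ∀ x : Fin n → α, (∀ i, ∃ p, (x i, p) ∈ D i) → f x ≤ g x) : expect D f ≤ expect D g := by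
  refine Finset.sum_le_sum fun ω _ => mul_le_mul_of_nonneg_left (h _ fun i => ⟨_, List.get_mem _ _⟩)
    (Finset.prod_nonneg fun i _ => ((hD i).1 _ (List.get_mem _ _)).le)

theorem expect_add (f g : (Fin n → α) → ℚ) :
    (expect D fun x => f x + g x) = expect D f + expect D g := by
  simp only [_root_.expect, mul_add, Finset.sum_add_distrib]

theorem expect_zero_fun : (expect D fun _ => 0) = 0 := by simp [_root_.expect]

/-- Independence: `f` ignores coordinate `k`, so the factor `g (x k)` can be averaged separately. -/
theorem expect_mul_apply (hD : ∀ i, IsDist (D i)) (k : Fin n) {f : (Fin n → α) → ℚ}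
    (hf : ∀ x y : Fin n → α, (∀ i, i ≠ k → x i = y i) → f x = f y) (g : α → ℚ) :
    (expect D fun x => f x * g (x k)) = expect D f * mean (D k) g := by
  -- The coordinate `k` is filled with the first mass point of its law, an arbitrary value since `f`
  -- does not depend on it. The case `g = 1` then identifies the first factor as the expectation of
  -- `f`.
  have key : ∀ g : α → ℚ, (expect D fun x => f x * g (x k)) =
      (∑ ω : (j : {j // j ≠ k}) → Fin (D j).length, (∏ j : {j // j ≠ k}, ((D j).get (ω j)).2) *
        f fun i => if h : i ≠ k then ((D i).get (ω ⟨i, h⟩)).1 else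
          ((D i).get ⟨0, List.length_pos_iff.2 fun e => by simpa [e] using (hD i).2⟩).1) *
        mean (D k) g := by
    intro g
    rw [_root_.expect, ← (Equiv.piSplitAt k fun i => Fin (D i).length).symm.sum_comp,
      Fintype.sum_prod_type, mean_eq_sum, Finset.sum_mul_sum, Finset.sum_comm]
    refine Finset.sum_congr rfl fun ω _ => Finset.sum_congr rfl fun m _ => ?_
    rw [Fintype.prod_eq_mul_prod_subtype_ne _ k]
    have e1 : (Equiv.piSplitAt k fun i => Fin (D i).length).symm (m, ω) k = m := by
      simp [Equiv.piSplitAt]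
    have e2 : ∀ j : {j // j ≠ k},
        (Equiv.piSplitAt k fun i => Fin (D i).length).symm (m, ω) j = ω j := fun j => by
      simp [Equiv.piSplitAt, j.2]
    simp only [e1, e2]
    rw [hf _ fun i => if h : i ≠ k then ((D i).get (ω ⟨i, h⟩)).1 else
          ((D i).get ⟨0, List.length_pos_iff.2 fun e => by simpa [e] using (hD i).2⟩).1]
    · ring
    · intro i hi
      rw [dif_pos hi]
      simp only [e2 ⟨i, hi⟩]
  have h1 := key fun _ => 1
  simp only [mul_one] at h1
  rw [key, h1, mean_one (hD k), mul_one]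

theorem expect_mul_prod (hD : ∀ i, IsDist (D i)) (B : Finset (Fin n)) {f : (Fin n → α) → ℚ}
    (hf : ∀ x y : Fin n → α, (∀ i, i ∉ B → x i = y i) → f x = f y) (g : Fin n → α → ℚ) :
    (expect D fun x => f x * ∏ i ∈ B, g i (x i)) = expect D f * ∏ i ∈ B, mean (D i) (g i) := by
  induction B using Finset.induction_on with
  | empty => simp
  | insert k B hk ih =>
    have e : (fun x : Fin n → α => f x * ∏ i ∈ insert k B, g i (x i)) =
        fun x => (f x * ∏ i ∈ B, g i (x i)) * g k (x k) := funext fun x => by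
      rw [Finset.prod_insert hk]; ring
    rw [e, expect_mul_apply hD k, ih, Finset.prod_insert hk]
    · ring
    · exact fun x y h => hf x y fun i hi => h i fun h' => hi (Finset.mem_insert_of_mem h')
    · intro x y h
      rw [hf x y fun i hi => h i fun h' => hi (h' ▸ Finset.mem_insert_self _ _)]
      congr 1
      exact Finset.prod_congr rfl fun i hi => by rw [h i fun h' => hk (h' ▸ hi)]

end Expect

/-- A set whose product is positive splits into one element and two parts, the squares of whose
products are at least the product of the set. -/
theorem exists_split {ι : Type} [DecidableEq ι] {S : Finset ι} (hS : S.Nonempty) (F : ι → ℚ)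
    (h0 : ∀ i ∈ S, 0 < F i) (h1 : ∀ i ∈ S, F i ≤ 1) :
    ∃ i ∈ S, ∃ A ⊆ S.erase i, ∏ j ∈ S, F j ≤ (∏ j ∈ A, F j) ^ 2 ∧
      ∏ j ∈ S, F j ≤ (∏ j ∈ S.erase i \ A, F j) ^ 2 := by
  have hpos : ∀ B ⊆ S, 0 < ∏ j ∈ B, F j := fun B hB => Finset.prod_pos fun j hj => h0 j (hB hj)
  have hle : ∀ B ⊆ S, ∏ j ∈ B, F j ≤ 1 := fun B hB =>
    Finset.prod_le_one (fun j hj => (h0 j (hB hj)).le) fun j hj => h1 j (hB hj)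
  -- Take `A` of maximal size. Adding any `i` makes the squared product `b²` smaller than the whole
  -- product `ab`, where `a` belongs to the complement of `insert i A`; so `b < a` and `ab ≤ a²`.
  have hne : (S.powerset.filter fun A => ∏ j ∈ S, F j ≤ (∏ j ∈ A, F j) ^ 2).Nonempty :=
    ⟨∅, by simpa using hle S subset_rfl⟩
  obtain ⟨A, hA, hmax⟩ := Finset.exists_max_image _ Finset.card hne
  rw [Finset.mem_filter, Finset.mem_powerset] at hA
  by_cases hAS : A = S
  · obtain ⟨i, hi⟩ := hS
    refine ⟨i, hi, S.erase i, subset_rfl, ?_, ?_⟩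
    · refine (hAS ▸ hA.2).trans (pow_le_pow_left₀ (hpos S subset_rfl).le ?_ 2)
      rw [← Finset.mul_prod_erase S F hi]
      exact mul_le_of_le_one_left (hpos _ (Finset.erase_subset _ _)).le (h1 i hi)
    · simpa using hle S subset_rfl
  · obtain ⟨i, hi, hiA⟩ := Finset.exists_of_ssubset (hA.1.ssubset_of_ne hAS)
    have hsub : insert i A ⊆ S := Finset.insert_subset hi hA.1
    refine ⟨i, hi, A, fun j hj => Finset.mem_erase.2 ⟨fun e => hiA (e ▸ hj), hA.1 hj⟩, hA.2, ?_⟩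
    have h2 : (∏ j ∈ insert i A, F j) ^ 2 < ∏ j ∈ S, F j := by
      by_contra hc
      have := hmax (insert i A) (Finset.mem_filter.2 ⟨Finset.mem_powerset.2 hsub, not_lt.1 hc⟩)
      rw [Finset.card_insert_of_notMem hiA] at this
      omega
    have h3 : S.erase i \ A = S \ insert i A := by
      ext j; simp only [Finset.mem_sdiff, Finset.mem_erase, Finset.mem_insert]; tauto
    have h4 := Finset.prod_sdiff hsub (f := F)
    rw [h3]
    have p1 := hpos _ (Finset.sdiff_subset (s := S) (t := insert i A))
    have p2 := hpos _ hsub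
    set a := ∏ j ∈ S \ insert i A, F j
    set b := ∏ j ∈ insert i A, F j
    rw [← h4] at h2 ⊢
    have h5 : b < a := by
      rw [sq] at h2
      exact lt_of_mul_lt_mul_right h2 p2.le
    rw [sq]
    exact mul_le_mul_of_nonneg_left h5.le p1.le

/-! ### Offering a set of actions: value from low agent utilities. -/

section Selection

variable {n : ℕ} (D : Fin n → List ((ℚ × ℚ) × ℚ))

/-- The expected utility of the principal if the set `S` is offered. -/
def selectionValue (S : Finset (Fin n)) : ℚ :=
  expect D fun x => favouritePayoff S (fun i => (x i).1) fun i => (x i).2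

/-- Each law is a distribution of pairs of utilities, the utility of the principal is nonnegative,
and conditioning on a small utility of the agent does not increase its mean. -/
structure IsWeaklyAligned : Prop where
  dist : ∀ i, IsDist (D i)
  nonneg : ∀ i, ∀ x ∈ D i, 0 ≤ x.1.2
  cond_le : ∀ i U, (mean (D i) fun x => if x.1 ≤ U then x.2 else 0) ≤
    (mean (D i) fun x => if x.1 ≤ U then 1 else 0) * mean (D i) Prod.snd

variable {D}

theorem favouritePayoff_singleton {ι κ : Type} [LinearOrder κ] (i : ι) (a : ι → κ) (u : ι → ℚ) :
    favouritePayoff {i} a u = u i :=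
  favouritePayoff_eq (Finset.mem_singleton_self i) (fun k hk => by rw [Finset.mem_singleton.1 hk])
    fun k hk _ => by rw [Finset.mem_singleton.1 hk]

/-- The favourite of the union is also the favourite of the part that contains it. -/
theorem favouritePayoff_union_le {ι κ : Type} [LinearOrder κ] [DecidableEq ι] {A B : Finset ι}
    {a : ι → κ} {u : ι → ℚ} (h : ∀ i ∈ A ∪ B, 0 ≤ u i) :
    favouritePayoff (A ∪ B) a u ≤ favouritePayoff A a u + favouritePayoff B a u := by
  have hA := favouritePayoff_nonneg (a := a) fun i hi => h i (Finset.mem_union_left B hi)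
  have hB := favouritePayoff_nonneg (a := a) fun i hi => h i (Finset.mem_union_right A hi)
  rcases (A ∪ B).eq_empty_or_nonempty with he | hne
  · rw [he, favouritePayoff_empty]
    exact add_nonneg hA hB
  · obtain ⟨i, hi, h1, h2⟩ := exists_favourite hne a u
    rw [favouritePayoff_eq hi h1 h2]
    rcases Finset.mem_union.1 hi with hi | hi
    · rw [favouritePayoff_eq hi (fun k hk => h1 k (Finset.mem_union_left B hk))
        fun k hk => h2 k (Finset.mem_union_left B hk)]
      linarith
    · rw [favouritePayoff_eq hi (fun k hk => h1 k (Finset.mem_union_right A hk))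
        fun k hk => h2 k (Finset.mem_union_right A hk)]
      linarith

theorem favouritePayoff_congr {ι κ : Type} [LinearOrder κ] {S : Finset ι} {a a' : ι → κ}
    {u u' : ι → ℚ} (ha : ∀ i ∈ S, a i = a' i) (hu : ∀ i ∈ S, u i = u' i) :
    favouritePayoff S a u = favouritePayoff S a' u' := by
  rcases S.eq_empty_or_nonempty with rfl | hne
  · rw [favouritePayoff_empty, favouritePayoff_empty]
  · obtain ⟨i, hi, h1, h2⟩ := exists_favourite hne a u
    rw [favouritePayoff_eq hi h1 h2, favouritePayoff_eq hi, hu i hi]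
    · exact fun k hk => by rw [← ha i hi, ← ha k hk]; exact h1 k hk
    · exact fun k hk e => by
        rw [← hu i hi, ← hu k hk]
        exact h2 k hk (by rw [ha i hi, ha k hk, e])

/-- The contribution of the draws in which all offered actions have agent utility at most `U`. -/
def lowValue (D : Fin n → List ((ℚ × ℚ) × ℚ)) (S A : Finset (Fin n)) (U : ℚ) : ℚ :=
  expect D fun x => if ∀ i ∈ S, (x i).1 ≤ U then
    favouritePayoff A (fun i => (x i).1) (fun i => (x i).2) else 0

/-- The draws outside `A` matter only through the event that they are at most `U`. -/
theorem lowValue_eq (hD : ∀ i, IsDist (D i)) {S A : Finset (Fin n)} (h : A ⊆ S) (U : ℚ) :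
    lowValue D S A U = lowValue D A A U *
      ∏ i ∈ S \ A, mean (D i) fun x => if x.1 ≤ U then 1 else 0 := by
  rw [lowValue, lowValue, ← expect_mul_prod hD]
  · congr 1
    funext x
    rw [Finset.prod_ite_zero, Finset.prod_const_one]
    have : (∀ i ∈ S, (x i).1 ≤ U) ↔ (∀ i ∈ A, (x i).1 ≤ U) ∧ ∀ i ∈ S \ A, (x i).1 ≤ U := by
      refine ⟨fun h' => ⟨fun i hi => h' i (h hi), fun i hi => h' i (Finset.mem_sdiff.1 hi).1⟩,
        fun h' i hi => ?_⟩
      by_cases hA : i ∈ A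
      · exact h'.1 i hA
      · exact h'.2 i (Finset.mem_sdiff.2 ⟨hi, hA⟩)
    simp only [this, ite_and, mul_ite, mul_one, mul_zero]
    split_ifs <;> rfl
  · intro x y hxy
    have : ∀ i ∈ A, x i = y i := fun i hi => hxy i fun h' => (Finset.mem_sdiff.1 h').2 hi
    refine if_congr (forall₂_congr fun i hi => by rw [this i hi]) ?_ rfl
    exact favouritePayoff_congr (fun i hi => by rw [this i hi]) fun i hi => by rw [this i hi]

theorem lowValue_le (hD : IsWeaklyAligned D) (S A : Finset (Fin n)) (U : ℚ) :
    lowValue D S A U ≤ selectionValue D A := by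
  refine expect_mono hD.dist fun x hx => ?_
  have : 0 ≤ favouritePayoff A (fun i => (x i).1) fun i => (x i).2 :=
    favouritePayoff_nonneg fun i _ => by
      obtain ⟨p, hp⟩ := hx i
      exact hD.nonneg i _ hp
  split_ifs
  · exact le_rfl
  · exact this

theorem lowValue_union_le (hD : IsWeaklyAligned D) (S A B : Finset (Fin n)) (U : ℚ) :
    lowValue D S (A ∪ B) U ≤ lowValue D S A U + lowValue D S B U := by
  rw [lowValue, lowValue, lowValue, ← expect_add]
  refine expect_mono hD.dist fun x hx => ?_
  split_ifs
  · refine favouritePayoff_union_le fun i _ => ?_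
    obtain ⟨p, hp⟩ := hx i
    exact hD.nonneg i _ hp
  · rw [add_zero]

theorem selectionValue_nonneg (hD : IsWeaklyAligned D) (S : Finset (Fin n)) :
    0 ≤ selectionValue D S := by
  rw [← expect_zero_fun (D := D)]
  refine expect_mono hD.dist fun x hx => favouritePayoff_nonneg fun i _ => ?_
  obtain ⟨p, hp⟩ := hx i
  exact hD.nonneg i _ hp

theorem expect_apply (hD : ∀ i, IsDist (D i)) (i : Fin n) (g : ℚ × ℚ → ℚ) :
    (expect D fun x => g (x i)) = mean (D i) g := by
  have h1 := expect_mul_apply hD i (f := fun _ => 1) (fun _ _ _ => rfl) g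
  have h2 := expect_prod D fun _ _ => (1 : ℚ)
  simp only [Finset.prod_const_one, mean_one (hD _)] at h2
  rw [h2, one_mul] at h1
  simpa only [one_mul] using h1

/-- If offering `S` is optimal, then low agent utilities make up for a small part of its value. -/
theorem lowValue_self_le (hD : IsWeaklyAligned D) {S : Finset (Fin n)} (hne : S.Nonempty)
    (hS : ∀ A, selectionValue D A ≤ selectionValue D S) (U : ℚ)
    (hq : 0 < ∏ i ∈ S, mean (D i) fun x => if x.1 ≤ U then (1 : ℚ) else 0) :
    (lowValue D S S U : ℝ) ≤ 3 * √((∏ i ∈ S, mean (D i) fun x => if x.1 ≤ U then 1 else 0 : ℚ) : ℝ) *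
      selectionValue D S := by
  classical
  set F : Fin n → ℚ := fun i => mean (D i) fun x => if x.1 ≤ U then 1 else 0 with hF
  have hF0 : ∀ i, 0 ≤ F i := fun i => mean_nonneg (hD.dist i) fun x _ => by split_ifs <;> norm_num
  have hF1 : ∀ i, F i ≤ 1 := fun i => by
    rw [← mean_one (hD.dist i)]
    exact mean_mono (hD.dist i) fun x _ => by split_ifs <;> norm_num
  have hFpos : ∀ i ∈ S, 0 < F i := fun i hi => (hF0 i).lt_of_ne fun e =>
    hq.ne' (Finset.prod_eq_zero hi e.symm)
  obtain ⟨i, hi, A, hA, h1, h2⟩ := exists_split hne F hFpos fun i _ => hF1 i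
  set B := S.erase i \ A
  set V := selectionValue D S
  set q := ∏ i ∈ S, F i
  have hV : 0 ≤ V := selectionValue_nonneg hD S
  have hAS : A ⊆ S := hA.trans (Finset.erase_subset _ _)
  have hBS : B ⊆ S := Finset.sdiff_subset.trans (Finset.erase_subset _ _)
  -- Offering `A` alone is worth at most `V`, so `A` contributes at most `V` times the product over
  -- `S \ A`; that product is at most `√q`, since the one over `A` is at least `√q`.
  have hpart : ∀ A ⊆ S, q ≤ (∏ j ∈ A, F j) ^ 2 →
      (lowValue D S A U : ℝ) ≤ √(q : ℝ) * V := by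
    intro A hA h
    have e1 : lowValue D S A U ≤ V * ∏ j ∈ S \ A, F j := by
      rw [lowValue_eq hD.dist hA]
      exact mul_le_mul_of_nonneg_right ((lowValue_le hD A A U).trans (hS A))
        (Finset.prod_nonneg fun j _ => hF0 j)
    have e2 : (∏ j ∈ S \ A, F j) * ∏ j ∈ A, F j = q := Finset.prod_sdiff hA
    have e3 : (0 : ℚ) < ∏ j ∈ A, F j := Finset.prod_pos fun j hj => hFpos j (hA hj)
    set a := ∏ j ∈ A, F j
    set b := ∏ j ∈ S \ A, F j
    have e4 : (b : ℝ) ≤ √(q : ℝ) := by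
      refine Real.le_sqrt_of_sq_le ?_
      have h3 : b ≤ a := by
        rw [← e2, sq] at h
        exact le_of_mul_le_mul_right h e3
      have h4 : b ^ 2 ≤ q := by
        rw [← e2, sq]
        exact mul_le_mul_of_nonneg_left h3 (Finset.prod_nonneg fun j _ => hF0 j)
      exact_mod_cast h4
    have hV' : (0 : ℝ) ≤ V := by exact_mod_cast hV
    calc (lowValue D S A U : ℝ) ≤ V * b := by exact_mod_cast e1
      _ ≤ V * √(q : ℝ) := mul_le_mul_of_nonneg_left e4 hV'
      _ = _ := mul_comm _ _
  -- The remaining action may carry most of the smallness of `q`, so independence alone does not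
  -- help; weak alignment supplies the factor `F i`.
  have hone : (lowValue D S {i} U : ℝ) ≤ √(q : ℝ) * V := by
    have e1 : lowValue D {i} {i} U ≤ F i * V := by
      have h3 : lowValue D {i} {i} U = mean (D i) fun x => if x.1 ≤ U then x.2 else 0 := by
        rw [← expect_apply hD.dist i, lowValue]
        congr 1
        funext x
        simp only [Finset.mem_singleton, forall_eq, favouritePayoff_singleton]
      have h4 : selectionValue D {i} = mean (D i) Prod.snd := by
        rw [← expect_apply hD.dist i, selectionValue]
        simp only [favouritePayoff_singleton]
      rw [h3]
      refine (hD.cond_le i U).trans (mul_le_mul_of_nonneg_left ?_ (hF0 i))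
      rw [← h4]
      exact hS _
    have e2 : lowValue D S {i} U ≤ q * V := by
      rw [lowValue_eq hD.dist (Finset.singleton_subset_iff.2 hi)]
      have h5 : q = F i * ∏ j ∈ S \ {i}, F j := by
        rw [Finset.sdiff_singleton_eq_erase, Finset.mul_prod_erase S F hi]
      rw [h5, mul_right_comm]
      exact mul_le_mul_of_nonneg_right e1 (Finset.prod_nonneg fun j _ => hF0 j)
    have hq1 : (q : ℝ) ≤ √(q : ℝ) := by
      refine Real.le_sqrt_of_sq_le ?_
      have h6 : q ≤ 1 := Finset.prod_le_one (fun j _ => hF0 j) fun j _ => hF1 j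
      have h7 : q ^ 2 ≤ q := by rw [sq]; exact mul_le_of_le_one_left hq.le h6
      exact_mod_cast h7
    have hV' : (0 : ℝ) ≤ V := by exact_mod_cast hV
    calc (lowValue D S {i} U : ℝ) ≤ q * V := by exact_mod_cast e2
      _ ≤ _ := mul_le_mul_of_nonneg_right hq1 hV'
  have hSu : S = {i} ∪ (A ∪ B) := by
    rw [Finset.union_sdiff_of_subset hA, ← Finset.insert_eq, Finset.insert_erase hi]
  have e5 : lowValue D S S U ≤ lowValue D S {i} U + (lowValue D S A U + lowValue D S B U) := by
    calc lowValue D S S U = lowValue D S ({i} ∪ (A ∪ B)) U := by rw [← hSu]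
      _ ≤ _ := (lowValue_union_le hD S _ _ U).trans
        (add_le_add le_rfl (lowValue_union_le hD S A B U))
  have e6 : (lowValue D S S U : ℝ) ≤
      lowValue D S {i} U + (lowValue D S A U + lowValue D S B U) := by exact_mod_cast e5
  have := hpart A hAS h1
  have := hpart B hBS h2
  linarith

end Selection

/-! ### Selection problems as utility configuration. -/

section SelectionInstance

/-- The configurations of an action that may be offered or not. -/
def selectionConfigs (d : List ((ℚ × ℚ) × ℚ)) : List (List ((Option ℚ × ℚ) × ℚ)) :=
  [d.map fun x => ((some x.1.1, x.1.2), x.2), [((none, 0), 1)]]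

theorem mean_map {α β : Type} (d : List (α × ℚ)) (f : α → β) (φ : β → ℚ) :
    mean (d.map fun x => (f x.1, x.2)) φ = mean d fun x => φ (f x) := by
  simp [mean, Function.comp_def]

theorem mean_const {α : Type} {d : List (α × ℚ)} (hd : IsDist d) (c : ℚ) :
    (mean d fun _ => c) = c := by
  simp only [mean, List.sum_map_mul_right, hd.2, one_mul]

/-- The two utilities of an action with law on `ℚ × ℚ`, if the actions in `S` are offered. -/
def offeredUtils {n : ℕ} (S : Finset (Fin n)) (i : Fin n) (x : ℚ × ℚ) : Option ℚ × ℚ :=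
  if i ∈ S then (some x.1, x.2) else (none, 0)

/-- Actions that are not offered have agent utility `-∞` and lose against every offered one; if
nothing is offered, all principal utilities are `0`, in accordance with the payoff of the empty set.
-/
theorem principalPayoff_offeredUtils {n : ℕ} (S : Finset (Fin n)) (x : Fin n → ℚ × ℚ) :
    (principalPayoff fun i => offeredUtils S i (x i)) =
      favouritePayoff S (fun i => (x i).1) fun i => (x i).2 := by
  rcases S.eq_empty_or_nonempty with rfl | hne
  · rw [favouritePayoff_empty, principalPayoff]
    rcases (univ : Finset (Fin n)).eq_empty_or_nonempty with h | ⟨i, hi⟩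
    · rw [h, favouritePayoff_empty]
    · rw [favouritePayoff_eq hi] <;> simp [offeredUtils]
  · obtain ⟨i, hi, h1, h2⟩ := exists_favourite hne (fun i => (x i).1) fun i => (x i).2
    rw [favouritePayoff_eq hi h1 h2, principalPayoff, favouritePayoff_eq (Finset.mem_univ i)]
    · simp [offeredUtils, hi]
    · intro k _
      by_cases hk : k ∈ S
      · simpa [offeredUtils, hi, hk, agentUtil] using h1 k hk
      · simp [offeredUtils, hk, agentUtil]
    · intro k _ h
      by_cases hk : k ∈ S
      · simp only [offeredUtils, hi, hk, if_true, agentUtil, WithBot.coe_inj] at h ⊢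
        exact h2 k hk h
      · simp [offeredUtils, hi, hk, agentUtil] at h

theorem bestAgent_offeredUtils_le {n : ℕ} (S : Finset (Fin n)) (x : Fin n → ℚ × ℚ)
    (U : WithBot ℚ) : (bestAgent fun i => offeredUtils S i (x i)) ≤ U ↔
      ∀ i ∈ S, ((x i).1 : WithBot ℚ) ≤ U := by
  rw [bestAgent, Finset.sup_le_iff]
  refine ⟨fun h i hi => ?_, fun h i _ => ?_⟩
  · simpa [offeredUtils, hi, agentUtil] using h i (Finset.mem_univ i)
  · by_cases hi : i ∈ S
    · simpa [offeredUtils, hi, agentUtil] using h i hi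
    · simp [offeredUtils, hi, agentUtil]

variable {I : UCInstance} {D : Fin I.length → List ((ℚ × ℚ) × ℚ)}

/-- The actions that a configuration offers. -/
def chosen (C : I.Config) : Finset (Fin I.length) := univ.filter fun i => (C i : ℕ) = 0

theorem mean_selectionConfigs {A : List (List ((Option ℚ × ℚ) × ℚ))} {d : List ((ℚ × ℚ) × ℚ)}
    (hd : IsDist d) (hA : A = selectionConfigs d) (c : Fin A.length) (φ : Option ℚ × ℚ → ℚ) :
    mean (A.get c) φ =
      mean d fun x => φ (if (c : ℕ) = 0 then (some x.1, x.2) else (none, 0)) := by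
  subst hA
  obtain ⟨_ | _ | c, hc⟩ := c
  · exact mean_map d (fun x => (some x.1, x.2)) φ
  · simp only [Nat.zero_add, one_ne_zero, if_false, mean_const hd]
    simp [selectionConfigs, mean]
  · exact absurd hc (by simp [selectionConfigs])

theorem expect_law (h : ∀ i, I.get i = selectionConfigs (D i)) (hD : IsWeaklyAligned D)
    (C : I.Config) (F : (Fin I.length → Option ℚ × ℚ) → ℚ) :
    expect (I.law C) F = expect D fun x => F fun i => offeredUtils (chosen C) i (x i) := by
  refine expect_congr_mean (fun i => offeredUtils (chosen C) i) (fun i φ => ?_) F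
  rw [UCInstance.law, mean_selectionConfigs (hD.dist i) (h i)]
  simp [offeredUtils, chosen]

theorem value_eq_selectionValue (h : ∀ i, I.get i = selectionConfigs (D i))
    (hD : IsWeaklyAligned D) (C : I.Config) : I.value C = selectionValue D (chosen C) := by
  rw [UCInstance.value, expect_law h hD]
  simp only [principalPayoff_offeredUtils]
  rfl

theorem exists_chosen_eq (h : ∀ i, I.get i = selectionConfigs (D i)) (S : Finset (Fin I.length)) :
    ∃ C : I.Config, chosen C = S := by
  have hl : ∀ i, (I.get i).length = 2 := fun i => by rw [h i]; rfl
  refine ⟨fun i => ⟨if i ∈ S then 0 else 1, by rw [hl]; split_ifs <;> norm_num⟩, ?_⟩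
  ext i
  by_cases hi : i ∈ S <;> simp [chosen, hi]

theorem valid_of_selection (h : ∀ i, I.get i = selectionConfigs (D i)) (hD : IsWeaklyAligned D) :
    I.Valid where
  has_config A hA := by
    obtain ⟨i, rfl⟩ := List.get_of_mem hA
    rw [h i]
    exact List.cons_ne_nil _ _
  dist A hA d hd := by
    obtain ⟨i, rfl⟩ := List.get_of_mem hA
    rw [h i] at hd
    rcases List.mem_cons.1 hd with rfl | hd
    · refine ⟨fun x hx => ?_, ?_⟩
      · obtain ⟨y, hy, rfl⟩ := List.mem_map.1 hx
        exact (hD.dist i).1 y hy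
      · rw [List.map_map]
        exact (hD.dist i).2
    · rw [List.mem_singleton.1 hd]
      simp [IsDist]
  principal_nonneg A hA d hd x hx := by
    obtain ⟨i, rfl⟩ := List.get_of_mem hA
    rw [h i] at hd
    rcases List.mem_cons.1 hd with rfl | hd
    · obtain ⟨y, hy, rfl⟩ := List.mem_map.1 hx
      exact hD.nonneg i y hy
    · rw [List.mem_singleton.1 hd] at hx
      rw [List.mem_singleton.1 hx]

/-- An optimal configuration offers an optimal set, and `lowValue_self_le` divided by `q` is
alignment with `3/√q`. -/
theorem aligned_of_selection (h : ∀ i, I.get i = selectionConfigs (D i))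
    (hD : IsWeaklyAligned D) : I.UtilityAligned fun q => 1 / (1 / 3 * √q) := by
  have : Nonempty I.Config := (exists_chosen_eq h ∅).nonempty
  obtain ⟨C, hC⟩ := Finite.exists_max fun C : I.Config => I.value C
  refine ⟨C, hC, fun U hU => ?_⟩
  have hopt : ∀ A, selectionValue D A ≤ selectionValue D (chosen C) := fun A => by
    obtain ⟨C', rfl⟩ := exists_chosen_eq h A
    rw [← value_eq_selectionValue h hD, ← value_eq_selectionValue h hD]
    exact hC C'
  have hprob : I.probLe C U =
      expect D fun x => if ∀ i ∈ chosen C, ((x i).1 : WithBot ℚ) ≤ U then 1 else 0 := by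
    rw [UCInstance.probLe, expect_law h hD]
    simp only [bestAgent_offeredUtils_le]
  have hval0 := selectionValue_nonneg hD (chosen C)
  have hval0' : (0 : ℝ) ≤ selectionValue D (chosen C) := by exact_mod_cast hval0
  rw [UCInstance.condValue, expect_law h hD, value_eq_selectionValue h hD]
  simp only [bestAgent_offeredUtils_le, principalPayoff_offeredUtils]
  set S := chosen C
  rcases S.eq_empty_or_nonempty with hS | hne
  · have e : (expect D fun x => if ∀ i ∈ S, ((x i).1 : WithBot ℚ) ≤ U then
        favouritePayoff S (fun i => (x i).1) fun i => (x i).2 else 0) = 0 := by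
      refine (expect_congr fun x _ => ?_).trans expect_zero_fun
      rw [hS, favouritePayoff_empty, ite_self]
    rw [e, zero_div, Rat.cast_zero]
    positivity
  · cases U with
    -- Offered actions have finite agent utility, so the threshold `-∞` has probability `0`.
    | bot =>
      obtain ⟨i, hi⟩ := hne
      rw [hprob, expect_congr (g := fun _ => 0) fun x _ => if_neg fun h' => by simpa using h' i hi,
        expect_zero_fun] at hU
      exact absurd hU (lt_irrefl _)
    | coe U =>
      simp only [WithBot.coe_le_coe] at hprob ⊢
      have hq : I.probLe C U = ∏ i ∈ S, mean (D i) fun x => if x.1 ≤ U then 1 else 0 := by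
        have h1 := expect_mul_prod hD.dist S (f := fun _ => 1) (fun _ _ _ => rfl)
          fun _ x => if x.1 ≤ U then 1 else 0
        have h2 := expect_prod D fun _ _ => (1 : ℚ)
        simp only [Finset.prod_const_one, mean_one (hD.dist _)] at h2
        rw [h2, one_mul] at h1
        rw [hprob, ← h1]
        congr 1
        funext x
        rw [Finset.prod_ite_zero, Finset.prod_const_one, one_mul]
        by_cases hx : ∀ i ∈ S, (x i).1 ≤ U
        · rw [if_pos hx, if_pos hx]
        · rw [if_neg hx, if_neg hx]
      have h3 := lowValue_self_le hD hne hopt U (hq ▸ hU)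
      rw [← hq] at h3
      change ((lowValue D S S U / I.probLe C U : ℚ) : ℝ) ≤ _
      have hU' : (0 : ℝ) < I.probLe C U := by exact_mod_cast hU
      rw [Rat.cast_div, div_le_iff₀ hU']
      refine h3.trans_eq ?_
      have s := Real.sq_sqrt hU'.le
      have s0 := Real.sqrt_pos.2 hU'
      nth_rewrite 3 [← s]
      field_simp

theorem selection_reduction {I : UCInstance} {n : ℕ} (hn : I.length = n)
    {D : Fin n → List ((ℚ × ℚ) × ℚ)} (h : ∀ i, I.get i = selectionConfigs (D (Fin.cast hn i)))
    (hD : IsWeaklyAligned D) :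
    I.Valid ∧ I.UtilityAligned (fun q => 1 / (1 / 3 * √q)) ∧
    (∀ C : I.Config, I.value C = selectionValue D
      (offered n ((List.ofFn fun i => (C i : ℕ)).map fun k => decide (k ≤ 0)))) ∧
    ∀ S : Finset (Fin n), ∃ C : I.Config, I.value C = selectionValue D S := by
  subst hn
  refine ⟨valid_of_selection h hD, aligned_of_selection h hD, fun C => ?_, fun S => ?_⟩
  · rw [value_eq_selectionValue h hD]
    congr 1
    ext i
    simp [chosen, offered]
  · obtain ⟨C, rfl⟩ := exists_chosen_eq h S
    exact ⟨C, value_eq_selectionValue h hD C⟩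

end SelectionInstance

/-! ### The weakly aligned applications -/

section Chebyshev

variable {α β : Type} {L : List (α × ℚ)}

theorem mean_add (f g : α → ℚ) : (mean L fun x => f x + g x) = mean L f + mean L g := by
  simp only [mean_eq_sum, mul_add, Finset.sum_add_distrib]

theorem mean_const_mul (c : ℚ) (f : α → ℚ) : (mean L fun x => c * f x) = c * mean L f := by
  simp only [mean_eq_sum, Finset.mul_sum, mul_left_comm]

theorem mean_comm (L' : List (β × ℚ)) (f : α → β → ℚ) :
    (mean L fun x => mean L' (f x)) = mean L' fun y => mean L fun x => f x y := by
  simp only [mean_eq_sum, Finset.mul_sum]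
  rw [Finset.sum_comm]
  simp only [mul_left_comm]

/-- Chebyshev's inequality for oppositely ordered functions. -/
theorem mean_mul_le (hL : IsDist L) {f g : α → ℚ}
    (h : ∀ x ∈ L, ∀ y ∈ L, (f x.1 - f y.1) * (g x.1 - g y.1) ≤ 0) :
    (mean L fun x => f x * g x) ≤ mean L f * mean L g := by
  -- Two independent copies of the variable.
  have h1 : (mean L fun x => mean L fun y => (f x - f y) * (g x - g y)) ≤ 0 := by
    rw [← mean_const hL 0]
    refine mean_mono hL fun x hx => ?_
    rw [← mean_const hL 0]
    exact mean_mono hL fun y hy => h x hx y hy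
  have h2 : ∀ x, (mean L fun y => (f x - f y) * (g x - g y)) =
      (f x * g x + -mean L g * f x) + (-mean L f * g x + mean L fun y => f y * g y) := by
    intro x
    have e : (fun y => (f x - f y) * (g x - g y)) =
        fun y => (f x * g x + -f x * g y) + (-g x * f y + f y * g y) := funext fun y => by ring
    rw [e, mean_add, mean_add, mean_add, mean_const hL (f x * g x), mean_const_mul (-f x) g,
      mean_const_mul (-g x) f]
    ring
  simp only [h2] at h1
  rw [mean_add, mean_add, mean_add, mean_const_mul, mean_const_mul, mean_const hL] at h1
  linarith

end Chebyshev

section Delegation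

/-- The joint law of a value and an independent bias. -/
def biasLaw (A : List (ℚ × ℚ) × List (ℚ × ℚ)) : List ((ℚ × ℚ) × ℚ) :=
  A.1.flatMap fun v => A.2.map fun b => ((v.1, b.1), v.2 * b.2)

theorem mean_biasLaw (A : List (ℚ × ℚ) × List (ℚ × ℚ)) (φ : ℚ × ℚ → ℚ) :
    mean (biasLaw A) φ = mean A.1 fun v => mean A.2 fun b => φ (v, b) := by
  rw [mean, biasLaw, sum_flatMap, mean]
  congr 1
  refine List.map_congr_left fun v _ => ?_
  rw [List.map_map, mean, ← List.sum_map_mul_left]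
  congr 1
  exact List.map_congr_left fun b _ => by simp only [Function.comp_apply]; ring

theorem isDist_biasLaw {A : List (ℚ × ℚ) × List (ℚ × ℚ)} (h1 : IsDist A.1) (h2 : IsDist A.2) :
    IsDist (biasLaw A) := by
  refine ⟨fun x hx => ?_, ?_⟩
  · obtain ⟨v, hv, hx⟩ := List.mem_flatMap.1 hx
    obtain ⟨b, hb, rfl⟩ := List.mem_map.1 hx
    exact mul_pos (h1.1 v hv) (h2.1 b hb)
  · have h := mean_biasLaw A fun _ => 1
    rw [mean_one h2, mean_one h1] at h
    simpa [mean] using h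

/-- The law of the utilities of agent and principal, if the agent's utility is `value + bias`, and
an action with agent utility `u` is worth its value times `G u` to the principal. -/
def delegationLaw (G : ℚ → ℚ) (A : List (ℚ × ℚ) × List (ℚ × ℚ)) : List ((ℚ × ℚ) × ℚ) :=
  (biasLaw A).map fun x => ((x.1.1 + x.1.2, x.1.1 * G (x.1.1 + x.1.2)), x.2)

theorem mean_delegationLaw (G : ℚ → ℚ) (A : List (ℚ × ℚ) × List (ℚ × ℚ)) (φ : ℚ × ℚ → ℚ) :
    mean (delegationLaw G A) φ =
      mean A.2 fun b => mean A.1 fun v => φ (v + b, v * G (v + b)) :=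
  (mean_map (biasLaw A) (fun x => (x.1 + x.2, x.1 * G (x.1 + x.2))) φ).trans
    ((mean_biasLaw A _).trans (mean_comm _ _))

theorem isDist_map {α β : Type} {L : List (α × ℚ)} (hL : IsDist L) (f : α → β) :
    IsDist (L.map fun x => (f x.1, x.2)) := by
  refine ⟨fun x hx => ?_, ?_⟩
  · obtain ⟨y, hy, rfl⟩ := List.mem_map.1 hx
    exact hL.1 y hy
  · rw [List.map_map]
    exact hL.2

theorem mul_sub_ite_nonpos {a b x y U : ℚ} (h : x ≤ y → a ≤ b) (h' : y ≤ x → b ≤ a) :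
    (a - b) * ((if x ≤ U then 1 else 0) - if y ≤ U then 1 else 0) ≤ 0 := by
  rcases le_total x y with hxy | hxy
  · refine mul_nonpos_of_nonpos_of_nonneg (sub_nonpos.2 (h hxy)) ?_
    split_ifs with h1 h2 h2
    · simp
    · simp
    · exact absurd (hxy.trans h2) h1
    · simp
  · refine mul_nonpos_of_nonneg_of_nonpos (sub_nonneg.2 (h' hxy)) ?_
    split_ifs with h1 h2 h2
    · simp
    · exact absurd (hxy.trans h1) h2
    · simp
    · simp

/-- Chebyshev's inequality twice. For a fixed bias, the principal's utility increases and the event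
of small agent utility decreases with the value; averaged over the value, they increase and decrease
with the bias. -/
theorem isWeaklyAligned_delegationLaw {G : ℚ → ℚ} (hG0 : ∀ u, 0 ≤ G u) (hG : Monotone G) {n : ℕ}
    {A : Fin n → List (ℚ × ℚ) × List (ℚ × ℚ)} (h1 : ∀ i, IsDist (A i).1)
    (h2 : ∀ i, IsDist (A i).2) (h3 : ∀ i, ∀ v ∈ (A i).1, 0 ≤ v.1) :
    IsWeaklyAligned fun i => delegationLaw G (A i) where
  dist i := isDist_map (isDist_biasLaw (h1 i) (h2 i)) fun x => (x.1 + x.2, x.1 * G (x.1 + x.2))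
  nonneg i x hx := by
    obtain ⟨y, hy, rfl⟩ := List.mem_map.1 hx
    obtain ⟨v, hv, hy⟩ := List.mem_flatMap.1 hy
    obtain ⟨b, hb, rfl⟩ := List.mem_map.1 hy
    exact mul_nonneg (h3 i v hv) (hG0 _)
  cond_le i U := by
    have hw : ∀ b, ∀ v ∈ (A i).1, ∀ v' ∈ (A i).1, v.1 ≤ v'.1 →
        v.1 * G (v.1 + b) ≤ v'.1 * G (v'.1 + b) := fun b v _ v' hv' h =>
      mul_le_mul h (hG (by linarith)) (hG0 _) (h3 i v' hv')
    let H : ℚ → ℚ := fun b => mean (A i).1 fun v => v * G (v + b)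
    let R : ℚ → ℚ := fun b => mean (A i).1 fun v => if v + b ≤ U then 1 else 0
    have hH : ∀ b b', b ≤ b' → H b ≤ H b' := fun b b' h => mean_mono (h1 i) fun v hv =>
      mul_le_mul_of_nonneg_left (hG (by linarith)) (h3 i v hv)
    have hR : ∀ b b', b ≤ b' → R b' ≤ R b := fun b b' h => mean_mono (h1 i) fun v hv => by
      by_cases h1 : v.1 + b' ≤ U
      · rw [if_pos h1, if_pos (by linarith)]
      · rw [if_neg h1]
        split_ifs <;> norm_num
    rw [mean_delegationLaw, mean_delegationLaw, mean_delegationLaw, mul_comm]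
    calc (mean (A i).2 fun b => mean (A i).1 fun v =>
          if v + b ≤ U then v * G (v + b) else 0) ≤ mean (A i).2 fun b => H b * R b := by
          refine mean_mono (h2 i) fun b hb => ?_
          have e : (fun v => if v + b.1 ≤ U then v * G (v + b.1) else 0) =
              fun v => (v * G (v + b.1)) * if v + b.1 ≤ U then 1 else 0 := funext fun v => by
            rw [mul_ite, mul_one, mul_zero]
          rw [e]
          exact mean_mul_le (h1 i) fun v hv v' hv' => mul_sub_ite_nonpos
            (fun h => hw _ v hv v' hv' (by linarith)) fun h => hw _ v' hv' v hv (by linarith)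
      _ ≤ mean (A i).2 H * mean (A i).2 R := by
          refine mean_mul_le (h2 i) fun b _ b' _ => ?_
          rcases le_total b.1 b'.1 with h | h
          · exact mul_nonpos_of_nonpos_of_nonneg (sub_nonpos.2 (hH _ _ h)) (sub_nonneg.2 (hR _ _ h))
          · exact mul_nonpos_of_nonneg_of_nonpos (sub_nonneg.2 (hH _ _ h)) (sub_nonpos.2 (hR _ _ h))

theorem selectionValue_delegationLaw (G : ℚ → ℚ) (I : List (List (ℚ × ℚ) × List (ℚ × ℚ)))
    (S : Finset (Fin I.length)) :
    selectionValue (fun i => delegationLaw G (I.get i)) S = expect (valueBiasLaw I) fun x =>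
      favouritePayoff S (fun i => (x i).1 + (x i).2) fun i =>
        (x i).1 * G ((x i).1 + (x i).2) :=
  expect_congr_mean (D := fun i => delegationLaw G (I.get i)) (D' := valueBiasLaw I)
    (fun _ x => (x.1 + x.2, x.1 * G (x.1 + x.2)))
    (fun i φ => mean_map (biasLaw (I.get i)) (fun x => (x.1 + x.2, x.1 * G (x.1 + x.2))) φ)
    fun x => favouritePayoff S (fun i => (x i).1) fun i => (x i).2

end Delegation

/-! ### Averaging over the outside option. -/

section OutsideOption

/-- The probability that the outside option is at most `u`. -/
def outsideProb (B : List (ℚ × ℚ)) (u : ℚ) : ℚ := mean B fun b => if b ≤ u then 1 else 0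

variable {B : List (ℚ × ℚ)}

theorem outsideProb_nonneg (hB : IsDist B) (u : ℚ) : 0 ≤ outsideProb B u :=
  mean_nonneg hB fun _ _ => by split_ifs <;> norm_num

theorem outsideProb_mono (hB : IsDist B) : Monotone (outsideProb B) := fun u u' h =>
  mean_mono hB fun b _ => by
    by_cases h1 : b.1 ≤ u
    · rw [if_pos h1, if_pos (h1.trans h)]
    · rw [if_neg h1]
      split_ifs <;> norm_num

/-- Whether the outside option wins depends only on the largest agent utility, so its average is a
factor on the favourite's payoff. Tied actions get the same factor, so tie-breaking is unaffected.
-/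
theorem mean_outside (hB : IsDist B) {ι : Type} (S : Finset ι) (a v : ι → ℚ)
    [∀ b : ℚ, Decidable (∃ i ∈ S, b ≤ a i)] :
    (mean B fun b => if ∃ i ∈ S, b ≤ a i then favouritePayoff S a v else 0) =
      favouritePayoff S a fun i => v i * outsideProb B (a i) := by
  rcases S.eq_empty_or_nonempty with rfl | hne
  · simp [favouritePayoff_empty, mean]
  · obtain ⟨i, hi, h1, h2⟩ := exists_favourite hne a v
    rw [favouritePayoff_eq hi h1 h2, favouritePayoff_eq hi h1 fun k hk e => by
      rw [e]; exact mul_le_mul_of_nonneg_right (h2 k hk e) (outsideProb_nonneg hB _),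
      outsideProb, ← mean_const_mul]
    refine mean_congr fun b _ => ?_
    have : (∃ k ∈ S, b.1 ≤ a k) ↔ b.1 ≤ a i :=
      ⟨fun ⟨k, hk, h⟩ => h.trans (h1 k hk), fun h => ⟨i, hi, h⟩⟩
    by_cases h : b.1 ≤ a i
    · rw [if_pos (this.2 h), if_pos h, mul_one]
    · rw [if_neg (mt this.1 h), if_neg h, mul_zero]

theorem mean_expect {α : Type} {n : ℕ} (D : Fin n → List (α × ℚ)) (f : ℚ → (Fin n → α) → ℚ) :
    (mean B fun b => expect D (f b)) = expect D fun x => mean B fun b => f b x := by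
  simp only [mean_eq_sum, _root_.expect, Finset.mul_sum]
  rw [Finset.sum_comm]
  simp only [mul_left_comm]

end OutsideOption

/-! ### Assortment optimization. -/

section Assortment

/-- The law of the utilities of buyer and seller from an item, where the utility of the seller
takes into account that the buyer may prefer not to buy. -/
def assortmentLaw (G : ℚ → ℚ) (A : ℚ × List (ℚ × ℚ)) : List ((ℚ × ℚ) × ℚ) :=
  A.2.map fun v => ((v.1 - A.1, A.1 * G (v.1 - A.1)), v.2)

/-- The price is fixed, so the seller's utility is a nondecreasing function of the buyer's, and one
application of Chebyshev's inequality suffices. -/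
theorem isWeaklyAligned_assortmentLaw {G : ℚ → ℚ} (hG0 : ∀ u, 0 ≤ G u) (hG : Monotone G) {n : ℕ}
    {A : Fin n → ℚ × List (ℚ × ℚ)} (h1 : ∀ i, 0 ≤ (A i).1) (h2 : ∀ i, IsDist (A i).2) :
    IsWeaklyAligned fun i => assortmentLaw G (A i) where
  dist i := isDist_map (h2 i) fun v => (v - (A i).1, (A i).1 * G (v - (A i).1))
  nonneg i x hx := by
    obtain ⟨v, hv, rfl⟩ := List.mem_map.1 hx
    exact mul_nonneg (h1 i) (hG0 _)
  cond_le i U := by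
    have hm := mean_map (A i).2 fun v => (v - (A i).1, (A i).1 * G (v - (A i).1))
    simp only [assortmentLaw]
    rw [hm, hm, hm, mul_comm]
    simp only
    have e : (fun v => if v - (A i).1 ≤ U then (A i).1 * G (v - (A i).1) else 0) =
        fun v => ((A i).1 * G (v - (A i).1)) * if v - (A i).1 ≤ U then 1 else 0 :=
      funext fun v => by rw [mul_ite, mul_one, mul_zero]
    rw [e]
    exact mean_mul_le (h2 i) fun v _ v' _ => mul_sub_ite_nonpos
      (fun h => mul_le_mul_of_nonneg_left (hG h) (h1 i))
      fun h => mul_le_mul_of_nonneg_left (hG h) (h1 i)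

theorem selectionValue_assortmentLaw (G : ℚ → ℚ) (I : List (ℚ × List (ℚ × ℚ)))
    (S : Finset (Fin I.length)) :
    selectionValue (fun i => assortmentLaw G (I.get i)) S = expect (fun i => (I.get i).2) fun v =>
      favouritePayoff S (fun i => v i - (I.get i).1) fun i =>
        (I.get i).1 * G (v i - (I.get i).1) :=
  expect_congr_mean (D := fun i => assortmentLaw G (I.get i)) (D' := fun i => (I.get i).2)
    (fun i v => (v - (I.get i).1, (I.get i).1 * G (v - (I.get i).1)))
    (fun i φ => mean_map (I.get i).2
      (fun v => (v - (I.get i).1, (I.get i).1 * G (v - (I.get i).1))) φ)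
    fun x => favouritePayoff S (fun i => (x i).1) fun i => (x i).2

end Assortment

/-! ### Programs for the reductions, and the approximation schemes. -/

section Programs

/-- The set of actions offered by a configuration, as a list of booleans. -/
def offeredList (c : List ℕ) : List Bool := c.map fun k => decide (k ≤ 0)

theorem PolyTime.offeredList : PolyTime offeredList := by
  unfold _root_.offeredList
  fun_prop

theorem enc_dist (l : List (ℚ × ℚ)) : (enc l : distTy.Val) = l := List.map_id'' (fun _ => rfl) l

theorem enc_valueBias (l : List (List (ℚ × ℚ) × List (ℚ × ℚ))) :
    (enc l : (Ty.list (.prod distTy distTy)).Val) = l :=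
  List.map_id'' (fun A => Prod.ext (enc_dist A.1) (enc_dist A.2)) l

theorem enc_items (l : List (ℚ × List (ℚ × ℚ))) :
    (enc l : (Ty.list (.prod .rat distTy)).Val) = l :=
  List.map_id'' (fun A => congrArg (Prod.mk A.1) (enc_dist A.2)) l

namespace PolyTime

variable {Γ : Type} [Data Γ]

theorem selectionConfigs {d : Γ → List ((ℚ × ℚ) × ℚ)} (hd : PolyTime d) :
    PolyTime fun x => selectionConfigs (d x) := by
  unfold _root_.selectionConfigs
  fun_prop

theorem delegationLaw {G : Γ → ℚ → ℚ} (hG : PolyTime fun x : Γ × ℚ => G x.1 x.2)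
    {A : Γ → List (ℚ × ℚ) × List (ℚ × ℚ)} (hA : PolyTime A) :
    PolyTime fun x => delegationLaw (G x) (A x) := by
  unfold _root_.delegationLaw biasLaw
  have h : PolyTime fun y : Γ × ((ℚ × ℚ) × ℚ) => G y.1 (y.2.1.1 + y.2.1.2) :=
    hG.comp (f := fun y : Γ × ((ℚ × ℚ) × ℚ) => (y.1, y.2.1.1 + y.2.1.2)) (by fun_prop)
  fun_prop

theorem assortmentLaw {G : Γ → ℚ → ℚ} (hG : PolyTime fun x : Γ × ℚ => G x.1 x.2)
    {A : Γ → ℚ × List (ℚ × ℚ)} (hA : PolyTime A) :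
    PolyTime fun x => assortmentLaw (G x) (A x) := by
  unfold _root_.assortmentLaw
  have h : PolyTime fun y : Γ × (ℚ × ℚ) => G y.1 (y.2.1 - (A y.1).1) :=
    hG.comp (f := fun y : Γ × (ℚ × ℚ) => (y.1, y.2.1 - (A y.1).1)) (by fun_prop)
  fun_prop

theorem outsideProb {B : Γ → List (ℚ × ℚ)} (hB : PolyTime B) {u : Γ → ℚ} (hu : PolyTime u) :
    PolyTime fun x => outsideProb (B x) (u x) := by
  have h : PolyTime fun x => ((B x).map fun b => b.2 * bif decide (b.1 ≤ u x) then 1 else 0).sum := by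
    fun_prop
  refine h.congr fun x => ?_
  rw [_root_.outsideProb, mean]
  congr 1
  exact List.map_congr_left fun b _ => by by_cases h : b.1 ≤ u x <;> simp [h]

end PolyTime

end Programs

theorem offeredList_length (c : List ℕ) : (offeredList c).length = c.length := by
  simp [offeredList]

theorem delegationOutsideOption_value {x : List (ℚ × ℚ) × List (List (ℚ × ℚ) × List (ℚ × ℚ))}
    (hx : IsDist x.1) (s : List Bool) : delegationOutsideOption.value x s =
      selectionValue (fun i => delegationLaw (outsideProb x.1) (x.2.get i))
        (offered x.2.length s) := by
  rw [selectionValue_delegationLaw]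
  change (mean x.1 fun b₀ => expect (valueBiasLaw x.2) fun y =>
    if ∃ i ∈ offered x.2.length s, b₀ ≤ (y i).1 + (y i).2 then
      favouritePayoff (offered x.2.length s) (fun i => (y i).1 + (y i).2) fun i => (y i).1
    else 0) = _
  rw [mean_expect]
  congr 1
  funext y
  exact mean_outside hx _ _ _

theorem hasPTAS_delegationOutsideOption : HasPTAS delegationOutsideOption := by
  refine HasPTAS.of_reduction (α := List (ℚ × ℚ) × List (List (ℚ × ℚ) × List (ℚ × ℚ)))
    (fun y => y) (fun y => Prod.ext (enc_dist y.1) (enc_valueBias y.2)) _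
    (J := fun x => x.2.map fun A => selectionConfigs (delegationLaw (outsideProb x.1) A))
    (post := fun _ c => offeredList c) ?_ (PolyTime.offeredList.comp PolyTime.snd')
    fun x hx => ?_
  · refine PolyTime.snd'.map (PolyTime.selectionConfigs (PolyTime.delegationLaw ?_ PolyTime.snd'))
    exact PolyTime.outsideProb (by fun_prop) (by fun_prop)
  · obtain ⟨h1, h2⟩ := hx
    have hA := fun i : Fin x.2.length => h2 (x.2.get i) (List.get_mem _ _)
    obtain ⟨k1, k2, k3, k4⟩ := selection_reduction
      (I := x.2.map fun A => selectionConfigs (delegationLaw (outsideProb x.1) A))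
      (D := fun i => delegationLaw (outsideProb x.1) (x.2.get i)) (List.length_map _)
      (fun i => by simp) (isWeaklyAligned_delegationLaw (outsideProb_nonneg h1)
        (outsideProb_mono h1) (fun i => (hA i).1) (fun i => (hA i).2.1) fun i => (hA i).2.2)
    refine ⟨k1, k2, fun C => ⟨?_, ?_⟩, fun s _ => ?_⟩
    · exact (offeredList_length _).trans ((List.length_ofFn).trans (List.length_map _))
    · rw [k3 C]
      exact (delegationOutsideOption_value h1 _).ge
    · obtain ⟨C, e⟩ := k4 (offered x.2.length s)
      exact ⟨C, (delegationOutsideOption_value h1 s).trans e.symm⟩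

theorem assortment_value {x : List (ℚ × ℚ) × List (ℚ × List (ℚ × ℚ))}
    (hx : IsDist x.1) (s : List Bool) : assortment.value x s =
      selectionValue (fun i => assortmentLaw (outsideProb x.1) (x.2.get i))
        (offered x.2.length s) := by
  rw [selectionValue_assortmentLaw]
  change (mean x.1 fun u₀ => expect (fun i => (x.2.get i).2) fun v =>
    if ∃ i ∈ offered x.2.length s, u₀ ≤ v i - (x.2.get i).1 then
      favouritePayoff (offered x.2.length s) (fun i => v i - (x.2.get i).1)
        fun i => (x.2.get i).1
    else 0) = _
  rw [mean_expect]
  congr 1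
  funext y
  exact mean_outside hx _ _ _

theorem hasPTAS_assortment : HasPTAS assortment := by
  refine HasPTAS.of_reduction (α := List (ℚ × ℚ) × List (ℚ × List (ℚ × ℚ)))
    (fun y => y) (fun y => Prod.ext (enc_dist y.1) (enc_items y.2)) _
    (J := fun x => x.2.map fun A => selectionConfigs (assortmentLaw (outsideProb x.1) A))
    (post := fun _ c => offeredList c) ?_ (PolyTime.offeredList.comp PolyTime.snd')
    fun x hx => ?_
  · refine PolyTime.snd'.map (PolyTime.selectionConfigs (PolyTime.assortmentLaw ?_ PolyTime.snd'))
    exact PolyTime.outsideProb (by fun_prop) (by fun_prop)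
  · obtain ⟨h1, h2⟩ := hx
    have hA := fun i : Fin x.2.length => h2 (x.2.get i) (List.get_mem _ _)
    obtain ⟨k1, k2, k3, k4⟩ := selection_reduction
      (I := x.2.map fun A => selectionConfigs (assortmentLaw (outsideProb x.1) A))
      (D := fun i => assortmentLaw (outsideProb x.1) (x.2.get i)) (List.length_map _)
      (fun i => by simp) (isWeaklyAligned_assortmentLaw (outsideProb_nonneg h1)
        (outsideProb_mono h1) (fun i => (hA i).1) fun i => (hA i).2)
    refine ⟨k1, k2, fun C => ⟨?_, ?_⟩, fun s _ => ?_⟩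
    · exact (offeredList_length _).trans ((List.length_ofFn).trans (List.length_map _))
    · rw [k3 C]
      exact (assortment_value h1 _).ge
    · obtain ⟨C, e⟩ := k4 (offered x.2.length s)
      exact ⟨C, (assortment_value h1 s).trans e.symm⟩

theorem delegationRandomBias_value (x : List (List (ℚ × ℚ) × List (ℚ × ℚ))) (s : List Bool) :
    delegationRandomBias.value x s =
      selectionValue (fun i => delegationLaw (fun _ => 1) (x.get i)) (offered x.length s) := by
  rw [selectionValue_delegationLaw]
  simp only [mul_one]
  rfl

/-- Replace the empty set by the set of all actions. -/
def offerSome (s : List Bool) : List Bool := bif s.any (fun b => b) then s else s.map fun _ => true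

theorem offered_nonempty_of_any {n : ℕ} {s : List Bool} (hs : s.length = n)
    (h : s.any (fun b => b) = true) : (offered n s).Nonempty := by
  obtain ⟨b, hb, rfl⟩ := List.any_eq_true.1 h
  obtain ⟨i, hi, e⟩ := List.getElem_of_mem hb
  exact ⟨⟨i, hs ▸ hi⟩, Finset.mem_filter.2 ⟨Finset.mem_univ _,
    (List.getElem?_eq_getElem hi).trans (congrArg some e)⟩⟩

/-- Here `G = 1`, as there is no outside option. The reduced instance also permits the empty set,
which is not a solution; it has value `0`, so replacing it by the set of all actions loses nothing.
-/
theorem hasPTAS_delegationRandomBias : HasPTAS delegationRandomBias := by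
  refine HasPTAS.of_reduction (α := List (List (ℚ × ℚ) × List (ℚ × ℚ)))
    (fun y => y) enc_valueBias _
    (J := fun x => x.map fun A => selectionConfigs (delegationLaw (fun _ => 1) A))
    (post := fun _ c => offerSome (offeredList c)) ?_ ?_ fun x hx => ?_
  · exact PolyTime.id.map (PolyTime.selectionConfigs (PolyTime.delegationLaw
      (PolyTime.const 1) PolyTime.snd'))
  · have h : PolyTime offerSome := by
      unfold offerSome
      fun_prop
    exact h.comp (PolyTime.offeredList.comp PolyTime.snd')
  · obtain ⟨h1, h2⟩ := hx
    have hA := fun i : Fin x.length => h2 (x.get i) (List.get_mem _ _)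
    have hD : IsWeaklyAligned fun i => delegationLaw (fun _ => 1) (x.get i) :=
      isWeaklyAligned_delegationLaw (fun _ => zero_le_one) monotone_const
        (fun i => (hA i).1) (fun i => (hA i).2.1) fun i => (hA i).2.2
    obtain ⟨k1, k2, k3, k4⟩ := selection_reduction
      (I := x.map fun A => selectionConfigs (delegationLaw (fun _ => 1) A))
      (D := fun i => delegationLaw (fun _ => 1) (x.get i)) (List.length_map _)
      (fun i => by simp) hD
    refine ⟨k1, k2, fun C => ?_, fun s _ => ?_⟩
    · have hl : (offeredList (List.ofFn fun i => (C i : ℕ))).length = x.length :=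
        (offeredList_length _).trans ((List.length_ofFn).trans (List.length_map _))
      have k3 : _ = selectionValue _ (offered x.length (offeredList _)) := k3 C
      rw [k3]
      generalize offeredList (List.ofFn fun i => (C i : ℕ)) = s at hl
      cases hs : s.any fun b => b with
      | true =>
        have e : offerSome s = s := by rw [offerSome, hs, cond_true]
        rw [e]
        exact ⟨⟨hl, offered_nonempty_of_any hl hs⟩, (delegationRandomBias_value x s).ge⟩
      | false =>
        have e : offerSome s = s.map fun _ => true := by rw [offerSome, hs, cond_false]
        have hl' : (s.map fun _ => true).length = x.length := (List.length_map _).trans hl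
        rw [e]
        refine ⟨⟨hl', offered_nonempty_of_any hl' ?_⟩, ?_⟩
        · have hne : s ≠ [] := fun h => h1 (List.length_eq_zero_iff.1 (by rw [← hl, h]; rfl))
          obtain ⟨b, hb⟩ := List.exists_mem_of_ne_nil s hne
          exact List.any_eq_true.2 ⟨true, List.mem_map.2 ⟨b, hb, rfl⟩, rfl⟩
        · have he : offered x.length s = ∅ := by
            refine Finset.filter_eq_empty_iff.2 fun i _ h => ?_
            have : s.any (fun b => b) = true :=
              List.any_eq_true.2 ⟨true, List.mem_of_getElem? h, rfl⟩
            rw [hs] at this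
            exact absurd this (by decide)
          rw [he, delegationRandomBias_value]
          refine le_of_eq_of_le ?_ (selectionValue_nonneg hD _)
          simp only [selectionValue, favouritePayoff_empty]
          exact expect_zero_fun
    · obtain ⟨C, e⟩ := k4 (offered x.length s)
      exact ⟨C, (delegationRandomBias_value x s).trans e.symm⟩

theorem mainTheorem3 :
    -- on `1 / (c √q)`-utility aligned instances, every output of the algorithm with parameter `M`
    -- is a `(1 - O(1 / √M))`-approximation
    (∀ c : ℝ, 0 < c → ∃ K : ℝ, 0 < K ∧ ∀ M : ℕ, 1 ≤ M → ∀ I : UCInstance, I.Valid →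
      I.UtilityAligned (fun q => 1 / (c * √q)) →
      ∀ C : I.Config, IsAlgOutput M I C →
        ∀ C' : I.Config, (1 - K / √(M : ℝ)) * (I.value C' : ℝ) ≤ (I.value C : ℝ)) ∧
    -- the algorithm is implemented by a program that runs in polynomial time for each fixed `M`
    (∃ A : Prog (.prod .nat ucTy) (.list .nat),
      (∀ M : ℕ, 1 ≤ M → ∃ p : Polynomial ℕ, ∀ I : UCInstance, I.Valid →
        A.time (M, I) ≤ p.eval (ucTy.size I)) ∧
      ∀ M : ℕ, 1 ≤ M → ∀ I : UCInstance, I.Valid →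
        ∃ C : I.Config, IsAlgOutput M I C ∧ A.eval (M, I) = List.ofFn fun i => (C i : ℕ)) ∧
    -- approximation schemes for the weakly aligned applications
    HasPTAS delegationRandomBias ∧ HasPTAS delegationOutsideOption ∧ HasPTAS assortment :=
  ⟨fun c hc => ⟨5 + 10 / c, by positivity, fun _ hM _ hI hal _ hC C' =>
    value_ge_of_isAlgOutput hc hM hI hal hC C'⟩, exists_program, hasPTAS_delegationRandomBias,
    hasPTAS_delegationOutsideOption, hasPTAS_assortment⟩
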